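/- **Setting and notation.** Let $0<r<q$, $n\ge 1$ and $d$ be integers. Matrices in $\mathbb R^{q\times q}$ carry the Frobenius norm and the inner product $\langle A,B\rangle=\operatorname{tr}(A'B)$. Linear operators on $\mathbb R^{q\times q}$ carry the Euclidean (Hilbert–Schmidt) norm $\|\cdot\|_{\mathrm{eu}}$ and its inner product; $\|\cdot\|_2$ is the spectral norm of a linear map, and $P_{\mathbb V}$ is the orthogonal projection onto a subspace $\mathbb V$. Put $(A\boxtimes B)(Z)=\langle B,Z\rangle A$. For $X=(X^{(j)})_{j=1}^n\subset\mathbb R^{q\times q}$ let $\Sigma=\frac1n\sum_j X^{(j)}\boxtimes X^{(j)}$ and $$\Lambda=\tfrac12(\lambda_{\max}(\Sigma)+\lambda_{\min}(\Sigma)),\qquad \Delta=\tfrac12(\lambda_{\max}(\Sigma)-\lambda_{\min}(\Sigma)),\qquad \Omega=\bigl\|P_{\mathbb W^\perp}\circ\mathsf A\bigr\|_2 .$$ Here $\mathsf A$ acts on operators by $\mathsf A(F)=\frac1n\sum_j P_{\mathcal T(X^{(j)})}\circ F\circ (X^{(j)}\boxtimes X^{(j)})$, with $\mathcal T(X)=\{XA+BX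 : A,B\in\mathbb R^{q\times q}\}$, and $\mathbb W$ is the space of operators $Z\mapsto AZ+ZB$ with $A,B\in\mathbb R^{q\times q}$. For a linear map $\mathcal L:\mathbb R^{q\times q}\to\mathbb R^d$, let $\mathcal L_1,\dots,\mathcal L_d\in\mathbb R^{q\times q}$ be the matrices with $\mathcal L(X)_i=\langle\mathcal L_i,X\rangle$. The map is *normalized* if $\sum_i\mathcal L_i\mathcal L_i'=\sum_i\mathcal L_i'\mathcal L_i=qI$. Its restricted isometry constant $\delta_k(\mathcal L)$ is the smallest $\delta$ such that $(1-\delta)\|X\|_F^2\le\|\mathcal L(X)\|^2\le(1+\delta)\|X\|_F^2$ whenever $\operatorname{rank}X\le k$. A *rank-preserver* is a linear operator $\mathcal M$ on $\mathbb R^{q\times q}$ with $\operatorname{rank}\mathcal M(X)=\operatorname{rank}X$ for all $X$. Define $$\xi_{\mathcal L^\star}(\mathcal L)=\inf\{\|\mathsf E\|_{\mathrm{eu}} : \mathcal L=\mathcal L^\star\circ(\mathsf I+\mathsf E)\circ\mathcal M \text{ for some operator } \mathsf E \text{ and some rank-preserver } \mathcal M\}.$$ **The algorithm.** Given data $y^{(1)},\dots,y^{(n)}\in\mathbb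 R^d$, a target rank $r$, a damping parameter $\nu\in(0,1]$ and $\mathcal L^{(0)}$, one iteration takes $\mathcal L^{(t)}$ to $\mathcal L^{(t+1)}$ as follows. 1. (Singular Value Projection.) For each $j$, $\hat X^{(j)}$ is the limit of the iteration started at $Z=0$ that replaces $Z$ by the top-$r$ truncation of a singular value decomposition of $Z+\nu\,(\mathcal L^{(t)})'(y^{(j)}-\mathcal L^{(t)}(Z))$. Its purpose is to minimize $\|y^{(j)}-\mathcal L^{(t)}(X)\|$ subject to $\operatorname{rank}X\le r$; we say that it *succeeds* if $\hat X^{(j)}$ is such a minimizer. 2. (Least squares.) $\tilde{\mathcal L}$ minimizes $\sum_j\|y^{(j)}-\bar{\mathcal L}(\hat X^{(j)})\|^2$ over all linear maps $\bar{\mathcal L}$. 3. (Operator Sinkhorn.) $\mathcal L^{(t+1)}$ is the limit of the iteration started at $\tilde{\mathcal L}$ that alternates $\mathcal L_i\leftarrow\sqrt q\,R^{-1/2}\mathcal L_i$ with $R=\sum_i\mathcal L_i\mathcal L_i'$, and $\mathcal L_i\leftarrow\sqrt q\,\mathcal L_iC^{-1/2}$ with $C=\sum_i\mathcal L_i'\mathcal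 L_i$. A *run* is a sequence $(\mathcal L^{(t)})_{t\ge0}$ produced in this way, in which all these limits exist. **Theorem.** Let $y^{(j)}=\mathcal L^\star(X^{(j)\star})$ for $j=1,\dots,n$, where $\mathcal L^\star:\mathbb R^{q\times q}\to\mathbb R^d$ is linear, and let $\Lambda,\Delta,\Omega$ be those of $(X^{(j)\star})_j$. Suppose that * for some $s>0$, every $X^{(j)\star}$ has rank $r$ and $s\ge\sigma_1(X^{(j)\star})\ge\sigma_r(X^{(j)\star})\ge s/2$; * $\dfrac{\Omega}{\Lambda}\le\dfrac{d}{40q^2}$ and $\dfrac{\Delta}{\Lambda}\le\dfrac{\sqrt d}{150q^3}$; * $\delta_{4r}(\mathcal L^\star)\le\frac1{20}$, $\mathcal L^\star$ is normalized and surjective, and $\|\mathcal L^\star\|_2^2\le\frac{5q^2}{d}$; * $\mathcal L^{(0)}$ is normalized and $\xi_{\mathcal L^\star}(\mathcal L^{(0)})<\dfrac{1}{36000\,q^{7/2}r^2\|\mathcal L^\star\|_2^2}$. Let $\nu\in(0,1]$ and $\gamma=2\|\mathcal L^\star\|_2^2\dfrac{\Omega}{\Lambda}+15q^2\|\mathcal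 L^\star\|_2\dfrac{\Delta}{\Lambda}$. Then: (a) $\gamma<1$. (b) If $\nu\ge\frac35$, then a run from $\mathcal L^{(0)}$ exists, and in every run from $\mathcal L^{(0)}$ every instance of Step 1 succeeds. (c) For every run from $\mathcal L^{(0)}$ in which every instance of Step 1 succeeds, $\xi_{\mathcal L^\star}(\mathcal L^{(t)})\to0$ and $$\limsup_{t\to\infty}\frac{\xi_{\mathcal L^\star}(\mathcal L^{(t+1)})}{\xi_{\mathcal L^\star}(\mathcal L^{(t)})}\le\gamma$$ (with $0/0=0$). Moreover, for every $\varepsilon>0$, $\xi_{\mathcal L^\star}(\mathcal L^{(t+1)})\le(\gamma+\varepsilon)\,\xi_{\mathcal L^\star}(\mathcal L^{(t)})$ for all large $t$. -/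

import Mathlib

open Filter Topology

noncomputable section

/-- The Euclidean space of real `q × q` matrices: its norm is the Frobenius norm and its inner
product is the trace inner product. -/
abbrev MatSp (q : ℕ) : Type := EuclideanSpace ℝ (Fin q × Fin q)

/-- The matrix with entries `X (a, b)`. -/
def mat {q : ℕ} (X : MatSp q) : Matrix (Fin q) (Fin q) ℝ := fun a b => X (a, b)

/-- The element of `MatSp q` with a given matrix. -/
def ofMat {q : ℕ} (A : Matrix (Fin q) (Fin q) ℝ) : MatSp q := WithLp.toLp 2 fun p => A p.1 p.2

@[simp] theorem mat_apply {q : ℕ} (X : MatSp q) (a b : Fin q) : mat X a b = X (a, b) := rfl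

@[simp] theorem ofMat_apply {q : ℕ} (A : Matrix (Fin q) (Fin q) ℝ) (p : Fin q × Fin q) :
    ofMat A p = A p.1 p.2 := rfl

@[simp] theorem mat_ofMat {q : ℕ} (A : Matrix (Fin q) (Fin q) ℝ) : mat (ofMat A) = A := rfl

@[simp] theorem ofMat_mat {q : ℕ} (X : MatSp q) : ofMat (mat X) = X := rfl

theorem norm_sq_eq_sum_entries {q : ℕ} (X : MatSp q) : ‖X‖ ^ 2 = ∑ a, ∑ b, mat X a b ^ 2 := by
  rw [EuclideanSpace.norm_sq_eq, Fintype.sum_prod_type]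
  simp

/-- The space of linear operators on `MatSp q`.  All maps between these finite-dimensional
spaces are continuous, so continuous linear maps are all linear maps, and `‖·‖` on them is the
spectral norm. -/
abbrev MatOp (q : ℕ) : Type := MatSp q →L[ℝ] MatSp q

/-- The space of linear maps from `q × q` matrices to `ℝ^d`. -/
abbrev MatMap (q d : ℕ) : Type := MatSp q →L[ℝ] EuclideanSpace ℝ (Fin d)

/-- The space of linear operators on `MatSp q` with its Euclidean (Hilbert-Schmidt) structure,
an operator being represented by its entries in the orthonormal basis of matrix units. -/
abbrev OpSp (q : ℕ) : Type := EuclideanSpace ℝ ((Fin q × Fin q) × (Fin q × Fin q))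

/-- The identification of operators on `MatSp q` with their arrays of entries. -/
def opVec (q : ℕ) : MatOp q ≃ₗ[ℝ] OpSp q :=
  ((Matrix.toEuclideanCLM (n := Fin q × Fin q) (𝕜 := ℝ)).symm.toAlgEquiv.toLinearEquiv.trans
    (LinearEquiv.curry ℝ ℝ (Fin q × Fin q) (Fin q × Fin q)).symm).trans
      (WithLp.linearEquiv 2 ℝ (((Fin q × Fin q) × (Fin q × Fin q)) → ℝ)).symm

/-- The Euclidean norm of an operator on `MatSp q`. -/
def euNorm {q : ℕ} (E : MatOp q) : ℝ := ‖opVec q E‖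

theorem opVec_apply {q : ℕ} (E : MatOp q) (a b : Fin q × Fin q) :
    opVec q E (a, b) = E (EuclideanSpace.single b 1) a := by
  obtain ⟨A, rfl⟩ : ∃ A, Matrix.toEuclideanCLM (n := Fin q × Fin q) (𝕜 := ℝ) A = E :=
    ⟨_, (Matrix.toEuclideanCLM (n := Fin q × Fin q) (𝕜 := ℝ)).apply_symm_apply E⟩
  have h : opVec q (Matrix.toEuclideanCLM (n := Fin q × Fin q) (𝕜 := ℝ) A) (a, b) = A a b :=
    congrFun (congrFun
      ((Matrix.toEuclideanCLM (n := Fin q × Fin q) (𝕜 := ℝ)).symm_apply_apply A) a) b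
  rw [h]
  simp [Matrix.ofLp_toEuclideanCLM]

theorem euNorm_sq {q : ℕ} (E : MatOp q) :
    euNorm E ^ 2 = ∑ p, ‖E (EuclideanSpace.single p 1)‖ ^ 2 := by
  rw [euNorm, EuclideanSpace.norm_sq_eq, Fintype.sum_prod_type, Finset.sum_comm]
  simp only [opVec_apply, EuclideanSpace.norm_sq_eq]

/-! ### Parameters of a collection of matrices -/

/-- The operator `A ⊠ B : X ↦ ⟨B, X⟩ A`. -/
def boxTimes {q : ℕ} (A B : MatSp q) : MatOp q := (innerSL ℝ B).smulRight A

/-- The covariance `(1/n) ∑ X_j ⊠ X_j`. -/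
def covariance {q n : ℕ} (X : Fin n → MatSp q) : MatOp q :=
  (n : ℝ)⁻¹ • ∑ j, boxTimes (X j) (X j)

/-- The largest eigenvalue of an operator on `MatSp q` (used for self-adjoint operators). -/
def lambdaMax {q : ℕ} (T : MatOp q) : ℝ :=
  sSup {μ : ℝ | Module.End.HasEigenvalue (T : MatSp q →ₗ[ℝ] MatSp q) μ}

/-- The smallest eigenvalue of an operator on `MatSp q` (used for self-adjoint operators). -/
def lambdaMin {q : ℕ} (T : MatOp q) : ℝ :=
  sInf {μ : ℝ | Module.End.HasEigenvalue (T : MatSp q →ₗ[ℝ] MatSp q) μ}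

/-- `Λ`, the mean of the extreme eigenvalues of the covariance. -/
def bigLambda {q n : ℕ} (X : Fin n → MatSp q) : ℝ :=
  (lambdaMax (covariance X) + lambdaMin (covariance X)) / 2

/-- `Δ`, half the spread of the extreme eigenvalues of the covariance. -/
def bigDelta {q n : ℕ} (X : Fin n → MatSp q) : ℝ :=
  (lambdaMax (covariance X) - lambdaMin (covariance X)) / 2

/-- The operator `Z ↦ A Z + Z B`. -/
def twoSided {q : ℕ} (A B : Matrix (Fin q) (Fin q) ℝ) : MatOp q :=
  LinearMap.toContinuousLinearMap
    { toFun := fun Z => ofMat (A * mat Z + mat Z * B)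
      map_add' := fun Y Z => by
        ext p
        have h : mat (Y + Z) = mat Y + mat Z := rfl
        simp only [h, Matrix.mul_add, Matrix.add_mul, ofMat_apply, Matrix.add_apply,
          PiLp.add_apply]
        ring
      map_smul' := fun c Z => by
        ext p
        have h : mat (c • Z) = c • mat Z := rfl
        simp only [h, Matrix.mul_smul, Matrix.smul_mul, ofMat_apply, Matrix.add_apply,
          Matrix.smul_apply, PiLp.smul_apply, smul_add, RingHom.id_apply] }

/-- `𝕎`, the tangent space at the identity of the set of rank-preservers, that is the span of the
operators `I ⊗ W₁ + W₂ ⊗ I`, as a subspace of the Euclidean space of operators. -/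
def tangentRankPreservers (q : ℕ) : Submodule ℝ (OpSp q) :=
  Submodule.span ℝ {F | ∃ A B : Matrix (Fin q) (Fin q) ℝ, F = opVec q (twoSided A B)}

/-- The tangent space `{X A + B X}` at `X` of the variety of matrices of rank at most
`rank X`. -/
def tangentSpace {q : ℕ} (X : MatSp q) : Submodule ℝ (MatSp q) :=
  Submodule.span ℝ
    {Z | ∃ A B : Matrix (Fin q) (Fin q) ℝ, Z = ofMat (mat X * A + B * mat X)}

/-- The operator `(1/n) ∑ (X_j ⊠ X_j) ⊗ P_{T(X_j)}` on the space of operators: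
it sends `F` to `(1/n) ∑ P_{T(X_j)} ∘ F ∘ (X_j ⊠ X_j)`. -/
def superOp {q n : ℕ} (X : Fin n → MatSp q) : OpSp q →L[ℝ] OpSp q :=
  LinearMap.toContinuousLinearMap
    { toFun := fun F => (n : ℝ)⁻¹ • ∑ j, opVec q
        ((tangentSpace (X j)).starProjection ∘L (opVec q).symm F ∘L boxTimes (X j) (X j))
      map_add' := fun F G => by
        simp only [map_add, ContinuousLinearMap.add_comp, ContinuousLinearMap.comp_add,
          Finset.sum_add_distrib, smul_add]
      map_smul' := fun c F => by
        simp only [map_smul, ContinuousLinearMap.smul_comp, ContinuousLinearMap.comp_smul,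
          ← Finset.smul_sum, RingHom.id_apply]
        rw [smul_comm] }

/-- `Ω`, the spectral norm of `P_{𝕎ᗮ} ∘ [(1/n) ∑ (X_j ⊠ X_j) ⊗ P_{T(X_j)}]`. -/
def bigOmega {q n : ℕ} (X : Fin n → MatSp q) : ℝ :=
  ‖(tangentRankPreservers q)ᗮ.starProjection ∘L superOp X‖

/-! ### Linear maps from matrices to vectors -/

/-- The matrix of the `i`-th component functional: `(L X)_i = ⟨L_i, X⟩`. -/
def component {q d : ℕ} (L : MatMap q d) (i : Fin d) : Matrix (Fin q) (Fin q) ℝ :=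
  fun a b => L (EuclideanSpace.single (a, b) 1) i

theorem map_apply_eq_sum_component {q d : ℕ} (L : MatMap q d) (X : MatSp q) (i : Fin d) :
    L X i = ∑ a, ∑ b, component L i a b * mat X a b := by
  have h : X = ∑ p, X p • EuclideanSpace.single p (1 : ℝ) := by
    ext p
    simp [Pi.single_apply]
  conv_lhs => rw [h]
  simp [map_sum, Fintype.sum_prod_type, component, mul_comm]

/-- `∑ L_i L_i'`. -/
def rowGram {q d : ℕ} (L : MatMap q d) : Matrix (Fin q) (Fin q) ℝ :=
  ∑ i, component L i * (component L i).transpose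

/-- `∑ L_i' L_i`. -/
def colGram {q d : ℕ} (L : MatMap q d) : Matrix (Fin q) (Fin q) ℝ :=
  ∑ i, (component L i).transpose * component L i

/-- Normalized linear maps. -/
def IsNormalized {q d : ℕ} (L : MatMap q d) : Prop :=
  rowGram L = (q : ℝ) • (1 : Matrix (Fin q) (Fin q) ℝ) ∧
    colGram L = (q : ℝ) • (1 : Matrix (Fin q) (Fin q) ℝ)

/-- The restricted isometry constant of order `k`. -/
def ripConst {q d : ℕ} (k : ℕ) (L : MatMap q d) : ℝ :=
  sInf {δ : ℝ | ∀ X : MatSp q, (mat X).rank ≤ k →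
    (1 - δ) * ‖X‖ ^ 2 ≤ ‖L X‖ ^ 2 ∧ ‖L X‖ ^ 2 ≤ (1 + δ) * ‖X‖ ^ 2}

/-- Linear rank-preservers. -/
def IsRankPreserver {q : ℕ} (M : MatOp q) : Prop :=
  ∀ X : MatSp q, (mat (M X)).rank = (mat X).rank

/-- The distance measure `ξ` of `L` to `Lstar`. -/
def xi {q d : ℕ} (Lstar L : MatMap q d) : ℝ :=
  sInf {e : ℝ | ∃ E M : MatOp q, IsRankPreserver M ∧
    L = Lstar ∘L (ContinuousLinearMap.id ℝ (MatSp q) + E) ∘L M ∧ e = euNorm E}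

/-- The `k`-th largest singular value of `X`, counted from `k = 1`. -/
def singVal {q : ℕ} (X : MatSp q) (k : ℕ) : ℝ :=
  (Matrix.toEuclideanLin (mat X)).singularValues (k - 1)

/-! ### The algorithms -/

/-- `Y = U_r Σ_r V_r'` is formed from top-`r` singular vectors and singular values of `W`, with
respect to some singular value decomposition `W = U diag(σ) V'`. -/
def IsTruncation {q : ℕ} (r : ℕ) (W Y : MatSp q) : Prop :=
  ∃ (U V : Matrix (Fin q) (Fin q) ℝ) (σ : Fin q → ℝ),
    U ∈ Matrix.orthogonalGroup (Fin q) ℝ ∧ V ∈ Matrix.orthogonalGroup (Fin q) ℝ ∧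
    Antitone σ ∧ (∀ i, 0 ≤ σ i) ∧
    mat W = U * Matrix.diagonal σ * V.transpose ∧
    mat Y = U * Matrix.diagonal (fun i : Fin q => if (i : ℕ) < r then σ i else 0) * V.transpose

/-- Singular Value Projection with damping `ν` and target rank `r`, started at `0`, converges
to `Xhat`. -/
def SVPReturns {q d : ℕ} (ν : ℝ) (r : ℕ) (L : MatMap q d) (y : EuclideanSpace ℝ (Fin d))
    (Xhat : MatSp q) : Prop :=
  ∃ Z : ℕ → MatSp q, Z 0 = 0 ∧
    (∀ k, IsTruncation r (Z k + ν • ContinuousLinearMap.adjoint L (y - L (Z k))) (Z (k + 1))) ∧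
    Tendsto Z atTop (𝓝 Xhat)

/-- `Xhat` minimizes `‖y - L X‖` over the matrices `X` of rank at most `r`. -/
def SolvesRankProblem {q d : ℕ} (r : ℕ) (L : MatMap q d) (y : EuclideanSpace ℝ (Fin d))
    (Xhat : MatSp q) : Prop :=
  (mat Xhat).rank ≤ r ∧ ∀ X : MatSp q, (mat X).rank ≤ r → ‖y - L Xhat‖ ≤ ‖y - L X‖

/-- `L` is a solution of the least-squares problem for the data `y` and the matrices `X`. -/
def IsLeastSquares {q d n : ℕ} (y : Fin n → EuclideanSpace ℝ (Fin d)) (X : Fin n → MatSp q)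
    (L : MatMap q d) : Prop :=
  ∀ K : MatMap q d, ∑ j, ‖y j - L (X j)‖ ^ 2 ≤ ∑ j, ‖y j - K (X j)‖ ^ 2

/-- `P` is the inverse positive-definite square root `R^{-1/2}`. -/
def IsInvSqrt {q : ℕ} (R P : Matrix (Fin q) (Fin q) ℝ) : Prop :=
  P.PosDef ∧ P * R * P = 1

/-- One pass of the Operator Sinkhorn iteration, taking `L` to `L'` through the intermediate
map `H` (the result of the row scaling). -/
def SinkhornStep {q d : ℕ} (L L' : MatMap q d) : Prop :=
  ∃ (H : MatMap q d) (P Q : Matrix (Fin q) (Fin q) ℝ),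
    IsInvSqrt (rowGram L) P ∧ (∀ i, component H i = √(q : ℝ) • (P * component L i)) ∧
    IsInvSqrt (colGram H) Q ∧ (∀ i, component L' i = √(q : ℝ) • (component H i * Q))

/-- The Operator Sinkhorn iteration started at `L` converges to `Lhat`. -/
def SinkhornReturns {q d : ℕ} (L Lhat : MatMap q d) : Prop :=
  ∃ K : ℕ → MatMap q d, K 0 = L ∧ (∀ k, SinkhornStep (K k) (K (k + 1))) ∧
    Tendsto K atTop (𝓝 Lhat)

/-- `L` is the sequence of iterates of the alternating update algorithm for the data `y`, the
target rank `r` and the initial guess `L0`; `X t j` is the matrix returned for the `j`-th data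
point in Step 1 of the iteration that takes `L t` to `L (t + 1)`. -/
structure IsRun {q d n : ℕ} (ν : ℝ) (r : ℕ) (y : Fin n → EuclideanSpace ℝ (Fin d))
    (L0 : MatMap q d) (L : ℕ → MatMap q d) (X : ℕ → Fin n → MatSp q) : Prop where
  init : L 0 = L0
  svp : ∀ t j, SVPReturns ν r (L t) (y j) (X t j)
  update : ∀ t, ∃ K : MatMap q d, IsLeastSquares y (X t) K ∧ SinkhornReturns K (L (t + 1))

/-- The bound `2 ‖L‖² Ω/Λ + 15 q² ‖L‖ Δ/Λ` on the asymptotic rate. -/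
def rateBound {q d n : ℕ} (Lstar : MatMap q d) (X : Fin n → MatSp q) : ℝ :=
  2 * ‖Lstar‖ ^ 2 * (bigOmega X / bigLambda X) +
    15 * (q : ℝ) ^ 2 * ‖Lstar‖ * (bigDelta X / bigLambda X)

end

section
open scoped Matrix.Norms.L2Operator

/-! ### Matrices and Frobenius norms -/

theorem mat_add {q : ℕ} (X Y : MatSp q) : mat (X + Y) = mat X + mat Y := rfl
theorem mat_sub {q : ℕ} (X Y : MatSp q) : mat (X - Y) = mat X - mat Y := rfl
theorem mat_smul {q : ℕ} (c : ℝ) (X : MatSp q) : mat (c • X) = c • mat X := rfl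
theorem mat_zero {q : ℕ} : mat (0 : MatSp q) = 0 := rfl
theorem ofMat_add {q : ℕ} (A B : Matrix (Fin q) (Fin q) ℝ) :
    ofMat (A + B) = ofMat A + ofMat B := rfl
theorem mat_injective {q : ℕ} : Function.Injective (mat (q := q)) := fun X Y h => by
  rw [← ofMat_mat X, h, ofMat_mat]

theorem norm_ofMat_transpose {q : ℕ} (A : Matrix (Fin q) (Fin q) ℝ) :
    ‖ofMat A.transpose‖ = ‖ofMat A‖ := by
  rw [← sq_eq_sq₀ (norm_nonneg _) (norm_nonneg _), norm_sq_eq_sum_entries,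
    norm_sq_eq_sum_entries, Finset.sum_comm]
  rfl

theorem norm_sq_ofMat_eq_sum_col {q : ℕ} (A : Matrix (Fin q) (Fin q) ℝ) :
    ‖ofMat A‖ ^ 2 = ∑ b, ‖(WithLp.toLp 2 (fun a => A a b) : EuclideanSpace ℝ (Fin q))‖ ^ 2 := by
  rw [norm_sq_eq_sum_entries, Finset.sum_comm]
  simp [EuclideanSpace.norm_sq_eq]

theorem l2norm_transpose {q : ℕ} (A : Matrix (Fin q) (Fin q) ℝ) : ‖A.transpose‖ = ‖A‖ := by
  rw [← Matrix.conjTranspose_eq_transpose_of_trivial, Matrix.l2_opNorm_conjTranspose]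

theorem norm_ofMat_mul_le {q : ℕ} (A B : Matrix (Fin q) (Fin q) ℝ) :
    ‖ofMat (A * B)‖ ≤ ‖A‖ * ‖ofMat B‖ := by
  rw [← sq_le_sq₀ (norm_nonneg _) (by positivity), mul_pow, norm_sq_ofMat_eq_sum_col,
    norm_sq_ofMat_eq_sum_col, Finset.mul_sum]
  refine Finset.sum_le_sum fun b _ => ?_
  rw [← mul_pow]
  gcongr
  exact Matrix.l2_opNorm_mulVec A (WithLp.toLp 2 (fun a => B a b) : EuclideanSpace ℝ (Fin q))

theorem norm_ofMat_mul_le' {q : ℕ} (A B : Matrix (Fin q) (Fin q) ℝ) :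
    ‖ofMat (A * B)‖ ≤ ‖ofMat A‖ * ‖B‖ := by
  rw [← norm_ofMat_transpose, Matrix.transpose_mul, ← norm_ofMat_transpose A, ← l2norm_transpose B,
    mul_comm]
  exact norm_ofMat_mul_le _ _

theorem l2norm_le_of_forall {q : ℕ} (A : Matrix (Fin q) (Fin q) ℝ) (c : ℝ) (hc : 0 ≤ c)
    (h : ∀ x : EuclideanSpace ℝ (Fin q), ‖Matrix.toEuclideanLin A x‖ ≤ c * ‖x‖) : ‖A‖ ≤ c :=
  ContinuousLinearMap.opNorm_le_bound _ hc h

theorem norm_toEuclideanLin_le {q : ℕ} (A : Matrix (Fin q) (Fin q) ℝ)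
    (x : EuclideanSpace ℝ (Fin q)) : ‖Matrix.toEuclideanLin A x‖ ≤ ‖A‖ * ‖x‖ :=
  Matrix.l2_opNorm_mulVec A x

theorem l2norm_le_frobenius {q : ℕ} (A : Matrix (Fin q) (Fin q) ℝ) : ‖A‖ ≤ ‖ofMat A‖ := by
  refine l2norm_le_of_forall A _ (norm_nonneg _) fun x => ?_
  rw [← sq_le_sq₀ (norm_nonneg _) (by positivity), mul_pow, norm_sq_eq_sum_entries,
    EuclideanSpace.norm_sq_eq, EuclideanSpace.norm_sq_eq, Finset.sum_mul]
  refine Finset.sum_le_sum fun a _ => ?_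
  simp only [Real.norm_eq_abs, sq_abs]
  exact Finset.sum_mul_sq_le_sq_mul_sq Finset.univ (fun b => mat (ofMat A) a b) (fun b => x b)

theorem l2norm_mem_orthogonalGroup {q : ℕ} {U : Matrix (Fin q) (Fin q) ℝ}
    (hU : U ∈ Matrix.orthogonalGroup (Fin q) ℝ) : ‖U‖ ≤ 1 := by
  refine l2norm_le_of_forall U _ zero_le_one fun x => ?_
  have h : ‖Matrix.toEuclideanLin U x‖ ^ 2 = ‖x‖ ^ 2 := by
    rw [← real_inner_self_eq_norm_sq, ← real_inner_self_eq_norm_sq]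
    simp only [EuclideanSpace.inner_eq_star_dotProduct, star_trivial]
    change (U.mulVec x.ofLp) ⬝ᵥ (U.mulVec x.ofLp) = _
    rw [Matrix.dotProduct_mulVec, Matrix.vecMul_mulVec,
      (Matrix.mem_orthogonalGroup_iff' (Fin q) ℝ).1 hU, Matrix.vecMul_one]
  rw [one_mul, ← sq_le_sq₀ (norm_nonneg _) (norm_nonneg _), h]

theorem norm_ofMat_orthogonal_mul {q : ℕ} {U : Matrix (Fin q) (Fin q) ℝ}
    (hU : U ∈ Matrix.orthogonalGroup (Fin q) ℝ) (A : Matrix (Fin q) (Fin q) ℝ) :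
    ‖ofMat (U * A)‖ = ‖ofMat A‖ := by
  have hU' : U.transpose ∈ Matrix.orthogonalGroup (Fin q) ℝ := by
    rw [Matrix.mem_orthogonalGroup_iff]
    exact (Matrix.mem_orthogonalGroup_iff' (Fin q) ℝ).1 hU
  apply le_antisymm
  · exact (norm_ofMat_mul_le _ _).trans
      (mul_le_of_le_one_left (norm_nonneg _) (l2norm_mem_orthogonalGroup hU))
  · calc ‖ofMat A‖ = ‖ofMat (U.transpose * (U * A))‖ := by
          rw [← Matrix.mul_assoc]
          rw [show U.transpose * U = 1 from (Matrix.mem_orthogonalGroup_iff' (Fin q) ℝ).1 hU, Matrix.one_mul]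
      _ ≤ _ := (norm_ofMat_mul_le _ _).trans
          (mul_le_of_le_one_left (norm_nonneg _) (l2norm_mem_orthogonalGroup hU'))

theorem transpose_mem_orthogonalGroup {q : ℕ} {U : Matrix (Fin q) (Fin q) ℝ}
    (hU : U ∈ Matrix.orthogonalGroup (Fin q) ℝ) :
    U.transpose ∈ Matrix.orthogonalGroup (Fin q) ℝ := by
  rw [Matrix.mem_orthogonalGroup_iff]
  exact (Matrix.mem_orthogonalGroup_iff' (Fin q) ℝ).1 hU

theorem norm_ofMat_mul_orthogonal {q : ℕ} {U : Matrix (Fin q) (Fin q) ℝ}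
    (hU : U ∈ Matrix.orthogonalGroup (Fin q) ℝ) (A : Matrix (Fin q) (Fin q) ℝ) :
    ‖ofMat (A * U)‖ = ‖ofMat A‖ := by
  rw [← norm_ofMat_transpose, Matrix.transpose_mul,
    norm_ofMat_orthogonal_mul (transpose_mem_orthogonalGroup hU), norm_ofMat_transpose]

theorem transpose_mul_self_orthogonal {q : ℕ} {U : Matrix (Fin q) (Fin q) ℝ}
    (hU : U ∈ Matrix.orthogonalGroup (Fin q) ℝ) : U.transpose * U = 1 :=
  (Matrix.mem_orthogonalGroup_iff' (Fin q) ℝ).1 hU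

theorem mul_transpose_self_orthogonal {q : ℕ} {U : Matrix (Fin q) (Fin q) ℝ}
    (hU : U ∈ Matrix.orthogonalGroup (Fin q) ℝ) : U * U.transpose = 1 :=
  (Matrix.mem_orthogonalGroup_iff (Fin q) ℝ).1 hU

/-! ### Singular value decompositions -/

theorem exists_svd {q : ℕ} (X : MatSp q) :
    ∃ (U V : Matrix (Fin q) (Fin q) ℝ) (σ : Fin q → ℝ),
      U ∈ Matrix.orthogonalGroup (Fin q) ℝ ∧ V ∈ Matrix.orthogonalGroup (Fin q) ℝ ∧
      Antitone σ ∧ (∀ i, 0 ≤ σ i) ∧ mat X = U * Matrix.diagonal σ * V.transpose ∧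
      ∀ i : Fin q, σ i = (Matrix.toEuclideanLin (mat X)).singularValues i := by
  set T := Matrix.toEuclideanLin (mat X) with hT
  have hn : Module.finrank ℝ (EuclideanSpace ℝ (Fin q)) = q := by simp
  have hs := T.isSymmetric_adjoint_comp_self
  set v := hs.eigenvectorBasis hn with hv
  set σ : Fin q → ℝ := fun i => T.singularValues i with hσ
  have hσ2 : ∀ i, (σ i) ^ 2 = hs.eigenvalues hn i := fun i => T.sq_singularValues_fin hn i
  have hip : ∀ i j, inner ℝ (T (v i)) (T (v j)) = if i = j then σ i ^ 2 else 0 := by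
    intro i j
    have h1 : (LinearMap.adjoint T ∘ₗ T) (v i) = (hs.eigenvalues hn i) • v i :=
      hs.apply_eigenvectorBasis hn i
    rw [← LinearMap.adjoint_inner_left]
    rw [LinearMap.comp_apply] at h1
    rw [h1, inner_smul_left, orthonormal_iff_ite.1 v.orthonormal, hσ2]
    simp
  obtain ⟨u, hu⟩ : ∃ u : OrthonormalBasis (Fin q) ℝ (EuclideanSpace ℝ (Fin q)),
      ∀ i ∈ {i | σ i ≠ 0}, u i = (σ i)⁻¹ • T (v i) := by
    apply Orthonormal.exists_orthonormalBasis_extension_of_card_eq (by simp)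
    rw [orthonormal_iff_ite]
    rintro ⟨i, hi⟩ ⟨j, hj⟩
    simp only [Set.domRestrict_apply, inner_smul_left, inner_smul_right, hip, Subtype.mk.injEq]
    split_ifs with h
    · subst h
      have : σ i ≠ 0 := hi
      simp
      field_simp
    · simp
  have hTv : ∀ i, T (v i) = σ i • u i := by
    intro i
    by_cases h : σ i = 0
    · have := hip i i
      rw [if_pos rfl, h] at this
      rw [h, zero_smul]
      simpa using this
    · rw [hu i h, smul_smul, mul_inv_cancel₀ h, one_smul]
  have orth : ∀ w : OrthonormalBasis (Fin q) ℝ (EuclideanSpace ℝ (Fin q)),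
      (Matrix.of fun a i => w i a) ∈ Matrix.orthogonalGroup (Fin q) ℝ := by
    intro w
    rw [Matrix.mem_orthogonalGroup_iff']
    ext i j
    have := orthonormal_iff_ite.1 w.orthonormal i j
    rw [PiLp.inner_apply] at this
    change (∑ a, w i a * w j a) = _
    rw [Matrix.one_apply]
    rw [← this]
    exact Finset.sum_congr rfl fun a _ => by simp [mul_comm]
  refine ⟨Matrix.of fun a i => u i a, Matrix.of fun a i => v i a, σ, orth u, orth v, ?_,
    fun i => T.singularValues_nonneg i, ?_, fun i => rfl⟩
  · intro i j hij
    exact T.singularValues_antitone hij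
  · have h : mat X * (Matrix.of fun a i => v i a) =
        (Matrix.of fun a i => u i a) * Matrix.diagonal σ := by
      ext a i
      rw [Matrix.mul_diagonal, Matrix.mul_apply]
      have := congrArg (fun z : EuclideanSpace ℝ (Fin q) => z a) (hTv i)
      simp only [PiLp.smul_apply, smul_eq_mul] at this
      rw [Matrix.of_apply, mul_comm, ← this]
      rfl
    rw [← h, Matrix.mul_assoc, mul_transpose_self_orthogonal (orth v), Matrix.mul_one]

theorem rank_toEuclideanLin {q : ℕ} (A : Matrix (Fin q) (Fin q) ℝ) :
    Module.finrank ℝ (Matrix.toEuclideanLin A).range = A.rank := by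
  rw [Matrix.toEuclideanLin, Matrix.toLpLin_eq_toLin, Matrix.rank_eq_finrank_range_toLin A (PiLp.basisFun 2 ℝ (Fin q))
    (PiLp.basisFun 2 ℝ (Fin q))]

theorem singularValues_ne_zero_iff {q : ℕ} (X : MatSp q) (i : ℕ) :
    (Matrix.toEuclideanLin (mat X)).singularValues i ≠ 0 ↔ i < (mat X).rank := by
  rw [← rank_toEuclideanLin, ← Finsupp.mem_support_iff, LinearMap.support_singularValues,
    Finset.mem_range]

theorem l2norm_orthogonal_conj_le {q : ℕ} {U V : Matrix (Fin q) (Fin q) ℝ}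
    (hU : U ∈ Matrix.orthogonalGroup (Fin q) ℝ) (hV : V ∈ Matrix.orthogonalGroup (Fin q) ℝ)
    (d : Fin q → ℝ) (c : ℝ) (hc : 0 ≤ c) (hd : ∀ i, |d i| ≤ c) :
    ‖U * Matrix.diagonal d * V.transpose‖ ≤ c := by
  have h1 : ‖Matrix.diagonal d‖ ≤ c := by
    rw [Matrix.l2_opNorm_diagonal]
    exact (pi_norm_le_iff_of_nonneg hc).2 hd
  have h2 := l2norm_mem_orthogonalGroup hU
  have h3 := l2norm_mem_orthogonalGroup (transpose_mem_orthogonalGroup hV)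
  calc _ ≤ ‖U‖ * ‖Matrix.diagonal d‖ * ‖V.transpose‖ :=
        (norm_mul_le _ _).trans (by gcongr; exact norm_mul_le _ _)
    _ ≤ 1 * c * 1 := by gcongr
    _ = c := by ring

theorem norm_ofMat_svd {q : ℕ} {U V : Matrix (Fin q) (Fin q) ℝ}
    (hU : U ∈ Matrix.orthogonalGroup (Fin q) ℝ) (hV : V ∈ Matrix.orthogonalGroup (Fin q) ℝ)
    (A : Matrix (Fin q) (Fin q) ℝ) : ‖ofMat (U * A * V.transpose)‖ = ‖ofMat A‖ := by
  rw [norm_ofMat_mul_orthogonal (transpose_mem_orthogonalGroup hV), norm_ofMat_orthogonal_mul hU]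

theorem norm_sq_ofMat_diagonal {q : ℕ} (d : Fin q → ℝ) :
    ‖ofMat (Matrix.diagonal d)‖ ^ 2 = ∑ i, d i ^ 2 := by
  rw [norm_sq_eq_sum_entries]
  refine Finset.sum_congr rfl fun i _ => ?_
  rw [mat_ofMat, Finset.sum_eq_single i]
  · simp
  · intro j _ hj
    simp [Matrix.diagonal_apply_ne _ hj.symm]
  · simp

/-- A Moore-Penrose inverse of norm at most `ρ`, as far as it is used. -/
structure IsPinv {q : ℕ} (X : MatSp q) (J : Matrix (Fin q) (Fin q) ℝ) (ρ : ℝ) : Prop where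
  mul_mul : mat X * J * mat X = mat X
  norm_le : ‖J‖ ≤ ρ
  norm_one_sub_left : ‖1 - mat X * J‖ ≤ 1
  norm_one_sub_right : ‖1 - J * mat X‖ ≤ 1

theorem exists_pinv {q r : ℕ} (hr : 0 < r) (hrq : r ≤ q) {X : MatSp q} {s : ℝ} (hs : 0 < s)
    (hrank : (mat X).rank = r) (h1 : singVal X 1 ≤ s) (h2 : s / 2 ≤ singVal X r) :
    (∃ J, IsPinv X J (2 / s)) ∧ ‖X‖ ^ 2 ≤ r * s ^ 2 ∧ r * s ^ 2 / 4 ≤ ‖X‖ ^ 2 := by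
  obtain ⟨U, V, σ, hU, hV, hσ, hσ0, hX, hsv⟩ := exists_svd X
  have hne : ∀ i : Fin q, σ i ≠ 0 ↔ (i : ℕ) < r := fun i => by
    rw [hsv, singularValues_ne_zero_iff, hrank]
  have hlow : ∀ i : Fin q, (i : ℕ) < r → s / 2 ≤ σ i := fun i hi => by
    rw [hsv]
    exact h2.trans ((Matrix.toEuclideanLin (mat X)).singularValues_antitone (by omega))
  have hup : ∀ i : Fin q, σ i ≤ s := fun i => by
    rw [hsv]
    exact ((Matrix.toEuclideanLin (mat X)).singularValues_antitone (by omega)).trans h1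
  have key : ∀ a b : Fin q → ℝ, ∀ A B C : Matrix (Fin q) (Fin q) ℝ,
      B ∈ Matrix.orthogonalGroup (Fin q) ℝ → A * Matrix.diagonal a * B.transpose *
        (B * Matrix.diagonal b * C) = A * Matrix.diagonal (fun i => a i * b i) * C := by
    intro a b A B C hB
    calc _ = A * Matrix.diagonal a * (B.transpose * B) * (Matrix.diagonal b * C) := by
          simp only [Matrix.mul_assoc]
      _ = _ := by
          rw [transpose_mul_self_orthogonal hB, Matrix.mul_one, Matrix.mul_assoc,
            ← Matrix.mul_assoc (Matrix.diagonal a), Matrix.diagonal_mul_diagonal,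
            ← Matrix.mul_assoc]
  have hone : ∀ A : Matrix (Fin q) (Fin q) ℝ, A ∈ Matrix.orthogonalGroup (Fin q) ℝ →
      (1 : Matrix (Fin q) (Fin q) ℝ) = A * Matrix.diagonal (fun _ => 1) * A.transpose := by
    intro A hA
    rw [Matrix.diagonal_one, Matrix.mul_one, mul_transpose_self_orthogonal hA]
  have hnorm : ‖X‖ ^ 2 = ∑ i, σ i ^ 2 := by
    rw [← ofMat_mat X, hX, norm_ofMat_svd hU hV, norm_sq_ofMat_diagonal]
  have hcard : (Finset.univ.filter fun i : Fin q => (i : ℕ) < r).card = r := by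
    rw [← Fintype.card_subtype]
    simpa using Fintype.card_congr (Fin.castLEquiv hrq).symm
  have hsum : ∑ i, σ i ^ 2 = ∑ i with (i : Fin q).1 < r, σ i ^ 2 := by
    rw [Finset.sum_filter]
    refine Finset.sum_congr rfl fun i _ => ?_
    split_ifs with h
    · rfl
    · rw [not_not.1 (mt (hne i).1 h)]
      simp
  refine ⟨⟨V * Matrix.diagonal (fun i => (σ i)⁻¹) * U.transpose, ?_, ?_, ?_, ?_⟩, ?_, ?_⟩
  · rw [hX, key _ _ _ _ _ hV, key _ _ _ _ _ hU]
    congr 3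
    ext i
    exact mul_inv_mul_cancel (σ i)
  · apply l2norm_orthogonal_conj_le hV hU _ _ (by positivity)
    intro i
    by_cases h : (i : ℕ) < r
    · have := hlow i h
      rw [abs_of_nonneg (inv_nonneg.2 (hσ0 i)), ← inv_div]
      gcongr
    · rw [not_not.1 (mt (hne i).1 h)]
      simp
      positivity
  · rw [hX, key _ _ _ _ _ hV, hone U hU, ← Matrix.sub_mul, ← Matrix.mul_sub,
      Matrix.diagonal_sub]
    apply l2norm_orthogonal_conj_le hU hU _ _ (by positivity)
    intro i
    by_cases h : σ i = 0
    · simp [h]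
    · simp [h]
  · rw [hX, key _ _ _ _ _ hU, hone V hV, ← Matrix.sub_mul, ← Matrix.mul_sub,
      Matrix.diagonal_sub]
    apply l2norm_orthogonal_conj_le hV hV _ _ (by positivity)
    intro i
    by_cases h : σ i = 0
    · simp [h]
    · simp [h]
  · rw [hnorm, hsum]
    calc _ ≤ ∑ i with (i : Fin q).1 < r, s ^ 2 :=
          Finset.sum_le_sum fun i _ => pow_le_pow_left₀ (hσ0 i) (hup i) 2
      _ = _ := by rw [Finset.sum_const, hcard, nsmul_eq_mul]
  · rw [hnorm, hsum]
    calc _ = ∑ i with (i : Fin q).1 < r, (s / 2) ^ 2 := by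
          rw [Finset.sum_const, hcard, nsmul_eq_mul]
          ring
      _ ≤ _ := Finset.sum_le_sum fun i hi =>
          pow_le_pow_left₀ (by positivity) (hlow i (Finset.mem_filter.1 hi).2) 2

end

section
open scoped Matrix.Norms.L2Operator

/-! ### Tangent spaces and generalized inverses -/

theorem mem_tangentSpace {q : ℕ} {X Z : MatSp q} :
    Z ∈ tangentSpace X ↔ ∃ A B : Matrix (Fin q) (Fin q) ℝ, mat Z = mat X * A + B * mat X := by
  constructor
  · intro h
    induction h using Submodule.span_induction with
    | mem Z h => obtain ⟨A, B, rfl⟩ := h; exact ⟨A, B, rfl⟩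
    | zero => exact ⟨0, 0, by simp [mat_zero]⟩
    | add Y Z _ _ hY hZ =>
      obtain ⟨A, B, h⟩ := hY
      obtain ⟨A', B', h'⟩ := hZ
      exact ⟨A + A', B + B', by rw [mat_add, h, h', Matrix.mul_add, Matrix.add_mul]; abel⟩
    | smul c Z _ hZ =>
      obtain ⟨A, B, h⟩ := hZ
      exact ⟨c • A, c • B, by rw [mat_smul, h, Matrix.mul_smul, Matrix.smul_mul, smul_add]⟩
  · rintro ⟨A, B, h⟩
    exact Submodule.subset_span ⟨A, B, by rw [← h, ofMat_mat]⟩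

theorem rank_add_le {q : ℕ} (A B : Matrix (Fin q) (Fin q) ℝ) :
    (A + B).rank ≤ A.rank + B.rank := by
  unfold Matrix.rank
  refine le_trans (Submodule.finrank_mono ?_)
    (Submodule.finrank_add_le_finrank_add_finrank A.mulVecLin.range B.mulVecLin.range)
  rintro _ ⟨v, rfl⟩
  rw [Matrix.mulVecLin_apply, Matrix.add_mulVec]
  exact Submodule.add_mem_sup ⟨v, rfl⟩ ⟨v, rfl⟩

theorem rank_sub_le {q : ℕ} (A B : Matrix (Fin q) (Fin q) ℝ) :
    (A - B).rank ≤ A.rank + B.rank := by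
  have h : (-B).rank ≤ B.rank := by
    rw [← Matrix.mul_one (-B), Matrix.neg_mul, ← Matrix.mul_neg]
    exact Matrix.rank_mul_le_left _ _
  rw [sub_eq_add_neg]
  exact (rank_add_le A (-B)).trans (by omega)

theorem rank_le_of_mem_tangentSpace {q : ℕ} {X Z : MatSp q} (h : Z ∈ tangentSpace X) :
    (mat Z).rank ≤ 2 * (mat X).rank := by
  obtain ⟨A, B, h⟩ := mem_tangentSpace.1 h
  rw [h]
  have h1 := Matrix.rank_mul_le_left (mat X) A
  have h2 := Matrix.rank_mul_le_right B (mat X)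
  have h3 := rank_add_le (mat X * A) (B * mat X)
  omega

theorem l2norm_one_le {q : ℕ} : ‖(1 : Matrix (Fin q) (Fin q) ℝ)‖ ≤ 1 :=
  l2norm_mem_orthogonalGroup (one_mem _)

theorem exists_inverse_one_add {q : ℕ} (A : Matrix (Fin q) (Fin q) ℝ) (h : ℝ) (h1 : h < 1)
    (hA : ‖A‖ ≤ h) :
    ∃ G : Matrix (Fin q) (Fin q) ℝ, G * (1 + A) = 1 ∧ (1 + A) * G = 1 ∧ ‖G‖ * (1 - h) ≤ 1 := by
  have hinj : Function.Injective (1 + A).mulVec := by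
    have key : ∀ v : Fin q → ℝ, (1 + A).mulVec v = 0 → v = 0 := by
      intro v hv
      have h2 := norm_toEuclideanLin_le A (WithLp.toLp 2 v)
      have h3 : Matrix.toEuclideanLin A (WithLp.toLp 2 v) = -WithLp.toLp 2 v := by
        rw [Matrix.add_mulVec, Matrix.one_mulVec] at hv
        have : A.mulVec v = -v := (neg_eq_of_add_eq_zero_right hv).symm
        change WithLp.toLp 2 (A.mulVec v) = _
        rw [this]
        rfl
      rw [h3, norm_neg] at h2
      have h4 : ‖(WithLp.toLp 2 v : EuclideanSpace ℝ (Fin q))‖ = 0 := by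
        by_contra hne
        have : 0 < ‖(WithLp.toLp 2 v : EuclideanSpace ℝ (Fin q))‖ :=
          lt_of_le_of_ne (norm_nonneg _) (Ne.symm hne)
        nlinarith
      simpa using h4
    intro u v huv
    have := key (u - v) (by rw [Matrix.mulVec_sub]; exact sub_eq_zero.2 huv)
    exact sub_eq_zero.1 this
  have hu := Matrix.mulVec_injective_iff_isUnit.1 hinj
  obtain ⟨u, hu⟩ := hu
  refine ⟨(u⁻¹ : (Matrix (Fin q) (Fin q) ℝ)ˣ), ?_, ?_, ?_⟩
  · rw [← hu, Units.inv_mul]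
  · rw [← hu, Units.mul_inv]
  · set G : Matrix (Fin q) (Fin q) ℝ := ↑(u⁻¹ : (Matrix (Fin q) (Fin q) ℝ)ˣ) with hG
    have h2 : (1 + A) * G = 1 := by rw [← hu, Units.mul_inv]
    have h3 : G = 1 - A * G := by
      rw [← h2, add_mul, one_mul, add_sub_cancel_right]
    have h4 : ‖G‖ ≤ 1 + h * ‖G‖ := by
      calc ‖G‖ = ‖1 - A * G‖ := congrArg _ h3
        _ ≤ ‖(1 : Matrix (Fin q) (Fin q) ℝ)‖ + ‖A * G‖ := norm_sub_le _ _
        _ ≤ 1 + h * ‖G‖ := add_le_add l2norm_one_le ((norm_mul_le _ _).trans (by gcongr))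
    linarith

theorem exists_mul_eq_of_rank_le {q : ℕ} (Y C : Matrix (Fin q) (Fin q) ℝ)
    (h : Y.rank ≤ (Y * C).rank) : ∃ B, Y = Y * C * B := by
  have hle : (Y * C).mulVecLin.range ≤ Y.mulVecLin.range := by
    rw [Matrix.mulVecLin_mul]
    exact LinearMap.range_comp_le_range _ _
  have heq := Submodule.eq_of_le_of_finrank_le hle h
  have : ∀ b, ∃ v, (Y * C).mulVec v = fun a => Y a b := by
    intro b
    have : Y.mulVecLin (Pi.single b 1) ∈ (Y * C).mulVecLin.range := by
      rw [heq]
      exact ⟨_, rfl⟩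
    obtain ⟨v, hv⟩ := this
    refine ⟨v, ?_⟩
    rw [Matrix.mulVecLin_apply] at hv
    rw [hv]
    ext a
    simp
  choose v hv using this
  refine ⟨Matrix.of fun a b => v b a, ?_⟩
  ext a b
  exact (congrFun (hv b) a).symm

/-- `J` is a generalized inverse of `X`, with bounds for its norm and for the norms of the
complementary projections. -/
structure IsGInv {q : ℕ} (X : MatSp q) (J : Matrix (Fin q) (Fin q) ℝ) (ρ c : ℝ) : Prop where
  mul_mul : mat X * J * mat X = mat X
  norm_le : ‖J‖ ≤ ρ
  norm_one_sub_left : ‖1 - mat X * J‖ ≤ c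
  norm_one_sub_right : ‖1 - J * mat X‖ ≤ c

theorem IsPinv.isGInv {q : ℕ} {X : MatSp q} {J : Matrix (Fin q) (Fin q) ℝ} {ρ : ℝ}
    (h : IsPinv X J ρ) : IsGInv X J ρ 1 :=
  ⟨h.mul_mul, h.norm_le, h.norm_one_sub_left, h.norm_one_sub_right⟩

theorem rank_perturbed {q : ℕ} {X Y J G : Matrix (Fin q) (Fin q) ℝ}
    (hJ : X * J * X = X) (hrank : Y.rank ≤ X.rank) (hG : G * (1 + (Y - X) * J) = 1) :
    (1 - X * J) * G * Y = 0 ∧ Y * (J * G) * Y = Y ∧ Y.rank = X.rank := by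
  have h1 : (1 + (Y - X) * J) * X = Y * (J * X) := by
    rw [Matrix.add_mul, Matrix.sub_mul, Matrix.sub_mul, hJ, Matrix.one_mul, Matrix.mul_assoc]
    abel
  have h2 : G * (Y * (J * X)) = X := by
    rw [← h1, ← Matrix.mul_assoc, hG, Matrix.one_mul]
  have h3 : X.rank ≤ (Y * (J * X)).rank := by
    conv_lhs => rw [← h2]
    exact Matrix.rank_mul_le_right _ _
  obtain ⟨B, hB⟩ := exists_mul_eq_of_rank_le Y (J * X) (hrank.trans h3)
  refine ⟨?_, ?_, le_antisymm hrank (h3.trans (Matrix.rank_mul_le_left _ _))⟩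
  · rw [Matrix.mul_assoc, hB, ← Matrix.mul_assoc G, h2, ← Matrix.mul_assoc, Matrix.sub_mul, hJ,
      Matrix.one_mul, sub_self, Matrix.zero_mul]
  · calc Y * (J * G) * Y = Y * (J * G) * (Y * (J * X) * B) := by rw [← hB]
      _ = Y * J * (G * (Y * (J * X))) * B := by simp only [Matrix.mul_assoc]
      _ = Y * (J * X) * B := by rw [h2]; simp only [Matrix.mul_assoc]
      _ = Y := hB.symm

theorem IsGInv.nonneg {q : ℕ} {X : MatSp q} {J : Matrix (Fin q) (Fin q) ℝ} {ρ c : ℝ}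
    (h : IsGInv X J ρ c) : 0 ≤ ρ ∧ 0 ≤ c :=
  ⟨(norm_nonneg _).trans h.norm_le, (norm_nonneg _).trans h.norm_one_sub_left⟩

theorem IsGInv.perturb {q : ℕ} {X Y : MatSp q} {J : Matrix (Fin q) (Fin q) ℝ} {ρ : ℝ}
    (h : IsGInv X J ρ 1) (hrank : (mat Y).rank ≤ (mat X).rank) (hD : ρ * ‖Y - X‖ ≤ 1 / 2) :
    (∃ J', IsGInv Y J' (2 * ρ) 2) ∧ (mat Y).rank = (mat X).rank := by
  set D := mat (Y - X) with hDdef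
  have hD' : ‖D‖ ≤ ‖Y - X‖ := l2norm_le_frobenius D
  have hρ := h.nonneg.1
  obtain ⟨G, hG1, hG2, hG3⟩ := exists_inverse_one_add (D * J) (1 / 2) (by norm_num) (by
    calc ‖D * J‖ ≤ ‖D‖ * ‖J‖ := norm_mul_le _ _
      _ ≤ ‖Y - X‖ * ρ := by gcongr; exact h.norm_le
      _ ≤ 1 / 2 := by linarith)
  obtain ⟨G', hG1', hG2', hG3'⟩ := exists_inverse_one_add (J * D) (1 / 2) (by norm_num) (by
    calc ‖J * D‖ ≤ ‖J‖ * ‖D‖ := norm_mul_le _ _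
      _ ≤ ρ * ‖Y - X‖ := by gcongr; exact h.norm_le
      _ ≤ 1 / 2 := by linarith)
  have hYD : mat Y = mat X + D := by rw [hDdef, mat_sub]; abel
  obtain ⟨_, h2, h3⟩ := rank_perturbed h.mul_mul hrank hG1
  have hJG : J * G = G' * J := by
    calc J * G = G' * (1 + J * D) * (J * G) := by rw [hG1', Matrix.one_mul]
      _ = G' * (J * ((1 + D * J) * G)) := by
          simp only [Matrix.mul_add, Matrix.add_mul, Matrix.mul_one, Matrix.one_mul,
            Matrix.mul_assoc]
      _ = G' * J := by rw [hG2, Matrix.mul_one]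
  refine ⟨⟨J * G, h2, ?_, ?_, ?_⟩, h3⟩
  · calc ‖J * G‖ ≤ ‖J‖ * ‖G‖ := norm_mul_le _ _
      _ ≤ ρ * 2 := by
          gcongr
          · exact h.norm_le
          · linarith
      _ = 2 * ρ := by ring
  · have : 1 - mat Y * (J * G) = (1 - mat X * J) * G := by
      have e : mat Y * (J * G) = mat X * J * G + (1 + D * J) * G - G := by
        rw [hYD]
        simp only [Matrix.add_mul, Matrix.one_mul, Matrix.mul_assoc]
        abel
      rw [e, hG2, Matrix.sub_mul, Matrix.one_mul]
      abel
    rw [this]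
    calc _ ≤ ‖1 - mat X * J‖ * ‖G‖ := norm_mul_le _ _
      _ ≤ 1 * 2 := by
          gcongr
          · exact h.norm_one_sub_left
          · linarith
      _ = 2 := by ring
  · have : 1 - (J * G) * mat Y = G' * (1 - J * mat X) := by
      have e : (J * G) * mat Y = G' * (J * mat X) + G' * (1 + J * D) - G' := by
        rw [hJG, hYD]
        simp only [Matrix.mul_add, Matrix.mul_one, Matrix.mul_assoc]
        abel
      rw [e, hG1', Matrix.mul_sub, Matrix.mul_one]
      abel
    rw [this]
    calc _ ≤ ‖G'‖ * ‖1 - J * mat X‖ := norm_mul_le _ _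
      _ ≤ 2 * 1 := by
          gcongr
          · linarith
          · exact h.norm_one_sub_right
      _ = 2 := by ring

theorem norm_ofMat_mul_mul_le {q : ℕ} (A B C : Matrix (Fin q) (Fin q) ℝ) :
    ‖ofMat (A * B * C)‖ ≤ ‖A‖ * ‖ofMat B‖ * ‖C‖ :=
  (norm_ofMat_mul_le' _ _).trans (by gcongr; exact norm_ofMat_mul_le _ _)

/-- A matrix of rank at most `rank X` differs from `X` by a tangent vector up to a quadratic
error. -/
theorem IsGInv.curvature {q : ℕ} {X Y : MatSp q} {J : Matrix (Fin q) (Fin q) ℝ} {ρ c : ℝ}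
    (h : IsGInv X J ρ c) (hrank : (mat Y).rank ≤ (mat X).rank) :
    ∃ Q : MatSp q, Y - X - Q ∈ tangentSpace X ∧ ‖Q‖ ≤ 2 * c ^ 2 * ρ * ‖Y - X‖ ^ 2 ∧
      (mat Q).rank ≤ (mat X).rank := by
  set D := mat (Y - X) with hDdef
  obtain ⟨hρ, hc⟩ := h.nonneg
  have hD' : ‖D‖ ≤ ‖Y - X‖ := l2norm_le_frobenius D
  have hYD : mat Y = mat X + D := by rw [hDdef, mat_sub]; abel
  have hX1 : (1 - mat X * J) * mat X = 0 := by
    rw [Matrix.sub_mul, h.mul_mul, Matrix.one_mul, sub_self]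
  have hX2 : mat X * (1 - J * mat X) = 0 := by
    rw [Matrix.mul_sub, ← Matrix.mul_assoc, h.mul_mul, Matrix.mul_one, sub_self]
  have hQY : (1 - mat X * J) * D * (1 - J * mat X) =
      (1 - mat X * J) * mat Y * (1 - J * mat X) := by
    rw [hYD, Matrix.mul_add, hX1, zero_add]
  refine ⟨ofMat ((1 - mat X * J) * D * (1 - J * mat X)), ?_, ?_, ?_⟩
  · refine mem_tangentSpace.2 ⟨J * D, (1 - mat X * J) * D * J, ?_⟩
    rw [mat_sub, mat_ofMat, ← hDdef]
    simp only [Matrix.sub_mul, Matrix.mul_sub, Matrix.one_mul, Matrix.mul_one, Matrix.mul_assoc]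
    abel
  · by_cases hsmall : ρ * ‖Y - X‖ ≤ 1 / 2
    · obtain ⟨G, hG1, hG2, hG3⟩ := exists_inverse_one_add (D * J) (1 / 2) (by norm_num) (by
        calc ‖D * J‖ ≤ ‖D‖ * ‖J‖ := norm_mul_le _ _
          _ ≤ ‖Y - X‖ * ρ := by gcongr; exact h.norm_le
          _ ≤ 1 / 2 := by linarith)
      obtain ⟨h1, _, _⟩ := rank_perturbed h.mul_mul hrank hG1
      have h4 : (1 - mat X * J) * mat Y = (1 - mat X * J) * (D * J * G) * mat Y := by
        have : D * J * G = 1 - G := by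
          rw [← hG2, Matrix.add_mul, Matrix.one_mul]
          abel
        rw [this, Matrix.mul_sub, Matrix.mul_one, Matrix.sub_mul (1 - mat X * J) _ (mat Y), h1,
          sub_zero]
      have h5 : (1 - mat X * J) * D * (1 - J * mat X) =
          ((1 - mat X * J) * (D * J * G)) * D * (1 - J * mat X) := by
        rw [hQY, h4, Matrix.mul_assoc _ (mat Y), Matrix.mul_assoc _ D, hYD, Matrix.add_mul, hX2,
          zero_add]
      rw [h5]
      calc _ ≤ ‖(1 - mat X * J) * (D * J * G)‖ * ‖ofMat D‖ * ‖1 - J * mat X‖ :=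
            norm_ofMat_mul_mul_le _ _ _
        _ ≤ (c * (‖Y - X‖ * ρ * 2)) * ‖Y - X‖ * c := by
            gcongr
            · refine (norm_mul_le _ _).trans ?_
              gcongr
              · exact h.norm_one_sub_left
              · refine (norm_mul_le _ _).trans ?_
                gcongr
                · refine (norm_mul_le _ _).trans ?_
                  gcongr
                  exact h.norm_le
                · linarith
            · rw [hDdef, ofMat_mat]
            · exact h.norm_one_sub_right
        _ = _ := by ring
    · calc _ ≤ ‖1 - mat X * J‖ * ‖ofMat D‖ * ‖1 - J * mat X‖ := norm_ofMat_mul_mul_le _ _ _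
        _ ≤ c * ‖Y - X‖ * c := by
            gcongr
            · exact h.norm_one_sub_left
            · rw [hDdef, ofMat_mat]
            · exact h.norm_one_sub_right
        _ = c ^ 2 * ‖Y - X‖ * 1 := by ring
        _ ≤ c ^ 2 * ‖Y - X‖ * (2 * (ρ * ‖Y - X‖)) := by
            gcongr
            linarith [not_le.1 hsmall]
        _ = _ := by ring
  · rw [mat_ofMat, hQY]
    exact ((Matrix.rank_mul_le_left _ _).trans (Matrix.rank_mul_le_right _ _)).trans hrank

theorem IsGInv.exists_coeff {q : ℕ} {X Z : MatSp q} {J : Matrix (Fin q) (Fin q) ℝ} {ρ c : ℝ}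
    (h : IsGInv X J ρ c) (hZ : Z ∈ tangentSpace X) :
    ∃ A B : Matrix (Fin q) (Fin q) ℝ, mat Z = mat X * A + B * mat X ∧ ‖A‖ ≤ ρ * ‖Z‖ ∧
      ‖B‖ ≤ c * ρ * ‖Z‖ := by
  obtain ⟨hρ, hc⟩ := h.nonneg
  have hZn : ‖mat Z‖ ≤ ‖Z‖ := l2norm_le_frobenius (mat Z)
  refine ⟨J * mat Z, (1 - mat X * J) * mat Z * J, ?_, ?_, ?_⟩
  · obtain ⟨A, B, hAB⟩ := mem_tangentSpace.1 hZ
    have hX1 : (1 - mat X * J) * mat X = 0 := by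
      rw [Matrix.sub_mul, h.mul_mul, Matrix.one_mul, sub_self]
    have h1 : (1 - mat X * J) * mat Z = (1 - mat X * J) * (B * mat X) := by
      rw [hAB, Matrix.mul_add, ← Matrix.mul_assoc, hX1, Matrix.zero_mul, zero_add]
    have h2 : (1 - mat X * J) * mat Z * J * mat X = (1 - mat X * J) * mat Z := by
      rw [h1]
      simp only [Matrix.mul_assoc]
      rw [← Matrix.mul_assoc (mat X), h.mul_mul]
    rw [h2, Matrix.sub_mul, Matrix.one_mul, Matrix.mul_assoc]
    abel
  · refine (norm_mul_le _ _).trans ?_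
    gcongr
    exact h.norm_le
  · calc _ ≤ ‖1 - mat X * J‖ * ‖mat Z‖ * ‖J‖ :=
          (norm_mul_le _ _).trans (by gcongr; exact norm_mul_le _ _)
      _ ≤ c * ‖Z‖ * ρ := by
          gcongr
          · exact h.norm_one_sub_left
          · exact h.norm_le
      _ = _ := by ring

end

section
open scoped Matrix.Norms.L2Operator

/-! ### Restricted isometries and rank-constrained minimizers -/

/-- `L` distorts the norms of matrices of rank at most `k` by factors between `a` and `b`. -/
def RankBound {q d : ℕ} (L : MatMap q d) (k : ℕ) (a b : ℝ) : Prop :=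
  ∀ X : MatSp q, (mat X).rank ≤ k → a * ‖X‖ ≤ ‖L X‖ ∧ ‖L X‖ ≤ b * ‖X‖

theorem rip_of_ripConst_le {q d k : ℕ} {L : MatMap q d} {δ : ℝ} (h : ripConst k L ≤ δ)
    (X : MatSp q) (hX : (mat X).rank ≤ k) :
    (1 - δ) * ‖X‖ ^ 2 ≤ ‖L X‖ ^ 2 ∧ ‖L X‖ ^ 2 ≤ (1 + δ) * ‖X‖ ^ 2 := by
  set S := {δ : ℝ | ∀ X : MatSp q, (mat X).rank ≤ k →
    (1 - δ) * ‖X‖ ^ 2 ≤ ‖L X‖ ^ 2 ∧ ‖L X‖ ^ 2 ≤ (1 + δ) * ‖X‖ ^ 2} with hS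
  have hne : S.Nonempty := by
    refine ⟨1 + ‖L‖ ^ 2, fun X _ => ⟨?_, ?_⟩⟩
    · have : 0 ≤ ‖L‖ ^ 2 * ‖X‖ ^ 2 := by positivity
      nlinarith [sq_nonneg ‖L X‖]
    · have h1 := pow_le_pow_left₀ (norm_nonneg _) (L.le_opNorm X) 2
      nlinarith [sq_nonneg ‖X‖]
  have key : ∀ η > δ, (1 - η) * ‖X‖ ^ 2 ≤ ‖L X‖ ^ 2 ∧ ‖L X‖ ^ 2 ≤ (1 + η) * ‖X‖ ^ 2 := by
    intro η hη
    obtain ⟨δ', hδ', hlt⟩ := exists_lt_of_csInf_lt hne (lt_of_le_of_lt h hη)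
    obtain ⟨h1, h2⟩ := hδ' X hX
    constructor <;> nlinarith [sq_nonneg ‖X‖]
  constructor
  · have : Tendsto (fun η : ℝ => (1 - η) * ‖X‖ ^ 2) (𝓝[>] δ) (𝓝 ((1 - δ) * ‖X‖ ^ 2)) :=
      (Continuous.tendsto (by fun_prop) δ).mono_left nhdsWithin_le_nhds
    exact le_of_tendsto this (eventually_nhdsWithin_of_forall fun η hη => (key η hη).1)
  · have : Tendsto (fun η : ℝ => (1 + η) * ‖X‖ ^ 2) (𝓝[>] δ) (𝓝 ((1 + δ) * ‖X‖ ^ 2)) :=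
      (Continuous.tendsto (by fun_prop) δ).mono_left nhdsWithin_le_nhds
    exact ge_of_tendsto this (eventually_nhdsWithin_of_forall fun η hη => (key η hη).2)

theorem rankBound_of_ripConst_le {q d k : ℕ} {L : MatMap q d} (h : ripConst k L ≤ 1 / 20) :
    RankBound L k (974 / 1000) (1025 / 1000) := by
  intro X hX
  obtain ⟨h1, h2⟩ := rip_of_ripConst_le h X hX
  constructor
  · refine (sq_le_sq₀ (by positivity) (norm_nonneg _)).1 ?_
    nlinarith [sq_nonneg ‖X‖]
  · refine (sq_le_sq₀ (norm_nonneg _) (by positivity)).1 ?_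
    nlinarith [sq_nonneg ‖X‖]

theorem RankBound.perturb {q d k : ℕ} {L : MatMap q d} {a b e : ℝ} (h : RankBound L k a b)
    {E : MatOp q} (he : ∀ Z, ‖E Z‖ ≤ e * ‖Z‖) :
    RankBound (L ∘L (ContinuousLinearMap.id ℝ (MatSp q) + E)) k (a - ‖L‖ * e) (b + ‖L‖ * e) := by
  intro X hX
  obtain ⟨h1, h2⟩ := h X hX
  have h3 : ‖L (E X)‖ ≤ ‖L‖ * e * ‖X‖ := by
    calc _ ≤ ‖L‖ * ‖E X‖ := L.le_opNorm _
      _ ≤ ‖L‖ * (e * ‖X‖) := by gcongr; exact he X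
      _ = _ := by ring
  have h4 : (L ∘L (ContinuousLinearMap.id ℝ (MatSp q) + E)) X = L X + L (E X) := by simp
  rw [h4]
  have h5 := norm_add_le (L X) (L (E X))
  have h6 := norm_sub_le (L X + L (E X)) (L (E X))
  rw [add_sub_cancel_right] at h6
  constructor <;> linarith

theorem RankBound.mono {q d k k' : ℕ} {L : MatMap q d} {a b a' b' : ℝ} (h : RankBound L k a b)
    (hk : k' ≤ k) (ha : a' ≤ a) (hb : b ≤ b') : RankBound L k' a' b' := fun X hX =>
  ⟨(mul_le_mul_of_nonneg_right ha (norm_nonneg X)).trans (h X (hX.trans hk)).1,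
    (h X (hX.trans hk)).2.trans (mul_le_mul_of_nonneg_right hb (norm_nonneg X))⟩

theorem exists_orthogonal_correction {V H : Type*} [NormedAddCommGroup V] [InnerProductSpace ℝ V]
    [NormedAddCommGroup H] [InnerProductSpace ℝ H] [FiniteDimensional ℝ H]
    (S : Submodule ℝ V) (Φ : V →ₗ[ℝ] H) (h : H) :
    ∃ s ∈ S, ∀ z ∈ S, inner ℝ (Φ s + h) (Φ z) = 0 := by
  have hp : (S.map Φ).starProjection (-h) ∈ S.map Φ := Submodule.starProjection_apply_mem _ _
  obtain ⟨s, hs, hs'⟩ := hp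
  refine ⟨s, hs, fun z hz => ?_⟩
  have h1 := Submodule.sub_starProjection_mem_orthogonal (K := S.map Φ) (-h)
  rw [← hs'] at h1
  have h2 := (Submodule.mem_orthogonal' _ _).1 h1 (Φ z) ⟨z, hz, rfl⟩
  have h3 : Φ s + h = -(-h - Φ s) := by abel
  rw [h3, inner_neg_left, h2, neg_zero]

theorem inner_eq_zero_of_norm_le {H : Type*} [NormedAddCommGroup H] [InnerProductSpace ℝ H]
    (w u v : H) (h : ∀ t : ℝ, ‖w‖ ≤ ‖w - t • u - t ^ 2 • v‖) : inner ℝ w u = 0 := by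
  set f : ℝ → ℝ := fun t => -2 * t * inner ℝ w u + t ^ 2 * (‖u‖ ^ 2 - 2 * inner ℝ w v) +
    2 * t ^ 3 * inner ℝ u v + t ^ 4 * ‖v‖ ^ 2 with hf
  have hf0 : ∀ t, 0 ≤ f t := by
    intro t
    have h1 := pow_le_pow_left₀ (norm_nonneg _) (h t) 2
    have h2 : ‖w - t • u - t ^ 2 • v‖ ^ 2 = ‖w‖ ^ 2 + f t := by
      rw [norm_sub_sq_real, norm_sub_sq_real, inner_sub_left, inner_smul_right, inner_smul_right,
        inner_smul_right, inner_smul_left, norm_smul, norm_smul, mul_pow, mul_pow,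
        Real.norm_eq_abs, Real.norm_eq_abs, sq_abs, sq_abs, hf]
      simp only [conj_trivial]
      ring
    linarith
  have hd : HasDerivAt f (-2 * inner ℝ w u) 0 := by
    have h1 : HasDerivAt (fun t : ℝ => t) 1 0 := hasDerivAt_id 0
    have := ((((h1.const_mul (-2)).mul_const (inner ℝ w u)).add
      ((h1.pow 2).mul_const (‖u‖ ^ 2 - 2 * inner ℝ w v))).add
      (((h1.pow 3).const_mul 2).mul_const (inner ℝ u v))).add ((h1.pow 4).mul_const (‖v‖ ^ 2))
    have h2 := this.congr_deriv (g' := -2 * inner ℝ w u) (by norm_num)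
    refine h2.congr_of_eventuallyEq (Filter.Eventually.of_forall fun t => ?_)
    simp only [hf, Pi.add_apply, Pi.pow_apply]
  have hmin : IsLocalMin f 0 := Filter.Eventually.of_forall fun t => by
    have : f 0 = 0 := by simp [hf]
    rw [this]
    exact hf0 t
  have := hmin.hasDerivAt_eq_zero hd
  linarith

theorem SolvesRankProblem.stationary {q d r : ℕ} {K : MatMap q d} {y : EuclideanSpace ℝ (Fin d)}
    {Y : MatSp q} (h : SolvesRankProblem r K y Y) {Z : MatSp q} (hZ : Z ∈ tangentSpace Y) :
    inner ℝ (y - K Y) (K Z) = 0 := by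
  obtain ⟨A, B, hAB⟩ := mem_tangentSpace.1 hZ
  apply inner_eq_zero_of_norm_le _ _ (K (ofMat (B * mat Y * A)))
  intro t
  have h1 : mat (Y + t • Z + t ^ 2 • ofMat (B * mat Y * A)) =
      (1 + t • B) * mat Y * (1 + t • A) := by
    rw [mat_add, mat_add, mat_smul, mat_smul, mat_ofMat, hAB]
    simp only [Matrix.add_mul, Matrix.mul_add, Matrix.one_mul, Matrix.mul_one, Matrix.smul_mul,
      Matrix.mul_smul, smul_smul, smul_add, pow_two]
    abel
  have h2 := h.2 (Y + t • Z + t ^ 2 • ofMat (B * mat Y * A)) (by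
    rw [h1]
    exact ((Matrix.rank_mul_le_left _ _).trans (Matrix.rank_mul_le_right _ _)).trans h.1)
  rw [map_add, map_add, map_smul, map_smul] at h2
  have h3 : y - (K Y + t • K Z + t ^ 2 • K (ofMat (B * mat Y * A))) =
      y - K Y - t • K Z - t ^ 2 • K (ofMat (B * mat Y * A)) := by abel
  rwa [h3] at h2

theorem id_add_comp_apply {q d : ℕ} (L : MatMap q d) (E : MatOp q) (Z : MatSp q) :
    (L ∘L (ContinuousLinearMap.id ℝ (MatSp q) + E)) Z = L Z + L (E Z) := by simp

/-- The minimizer is near the true matrix. -/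
theorem SolvesRankProblem.near {q d r : ℕ} {L : MatMap q d} {E : MatOp q} {e x : ℝ}
    (he : ∀ Z, ‖E Z‖ ≤ e * ‖Z‖) (he0 : 0 ≤ e)
    (hK : RankBound (L ∘L (ContinuousLinearMap.id ℝ (MatSp q) + E)) (4 * r) (97 / 100) (103 / 100))
    {X Y : MatSp q} (hX : (mat X).rank = r) (hXx : ‖X‖ ≤ x)
    (hY : SolvesRankProblem r (L ∘L (ContinuousLinearMap.id ℝ (MatSp q) + E)) (L X) Y) :
    ‖L X - (L ∘L (ContinuousLinearMap.id ℝ (MatSp q) + E)) Y‖ ≤ ‖L‖ * e * x ∧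
      ‖Y - X‖ ≤ 21 / 10 * (‖L‖ * e * x) := by
  set K := L ∘L (ContinuousLinearMap.id ℝ (MatSp q) + E) with hKdef
  have h1 : ‖L X - K X‖ ≤ ‖L‖ * e * x := by
    rw [hKdef, id_add_comp_apply, sub_add_cancel_left, norm_neg]
    calc _ ≤ ‖L‖ * ‖E X‖ := L.le_opNorm _
      _ ≤ ‖L‖ * (e * x) := by gcongr; exact (he X).trans (by gcongr)
      _ = _ := by ring
  have h2 := (hY.2 X hX.le).trans h1
  refine ⟨h2, ?_⟩
  have h3 := (hK (Y - X) (by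
    rw [mat_sub]
    have := rank_sub_le (mat Y) (mat X)
    have := hY.1
    omega)).1
  have h4 : K (Y - X) = (L X - K X) - (L X - K Y) := by rw [map_sub]; abel
  have h5 := norm_sub_le (L X - K X) (L X - K Y)
  rw [← h4] at h5
  have : 0 ≤ ‖L‖ * e * x := (norm_nonneg _).trans h1
  linarith

theorem second_order_arith {ρ x g η z Q w : ℝ} (hρ : 0 ≤ ρ) (hx : 0 ≤ x) (hg0 : 0 ≤ g)
    (hη0 : 0 ≤ η) (hz : 0 ≤ z) (hρx : 1 ≤ ρ * x) (hηg : η ≤ 21 / 10 * (g * x))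
    (hQ : Q ≤ 2 * 1 ^ 2 * ρ * η ^ 2) (hw : w ≤ z + Q)
    (h : (97 / 100) ^ 2 * z ^ 2 ≤ g * x * (103 / 100 * (2 * ρ * η * z)) +
      g * η * (103 / 100 * z) + (103 / 100 * η + g * x) * (g * z) +
      (103 / 100 * (2 * ρ * η ^ 2)) * (103 / 100 * z)) : w ≤ 30 * ρ * (g * x) ^ 2 := by
  have b7 : (97 / 100) ^ 2 * z ≤ g * x * (103 / 100 * (2 * ρ * η)) + g * η * (103 / 100) +
      (103 / 100 * η + g * x) * g + (103 / 100 * (2 * ρ * η ^ 2)) * (103 / 100) := by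
    rcases eq_or_lt_of_le hz with h0 | h0
    · rw [← h0, mul_zero]; positivity
    · refine le_of_mul_le_mul_right ?_ h0
      linarith
  have hgx : 0 ≤ g * x := by positivity
  have c1 : g * x * (ρ * η) ≤ g * x * (ρ * (21 / 10 * (g * x))) := by gcongr
  have c2 : g * η ≤ 21 / 10 * (ρ * (g * x) ^ 2) := by
    calc g * η ≤ g * (21 / 10 * (g * x)) := by gcongr
      _ = 21 / 10 * (1 * g ^ 2 * x) := by ring
      _ ≤ 21 / 10 * ((ρ * x) * g ^ 2 * x) := by gcongr
      _ = _ := by ring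
  have c3 : g * x * g ≤ ρ * (g * x) ^ 2 := by
    calc g * x * g = 1 * g ^ 2 * x := by ring
      _ ≤ (ρ * x) * g ^ 2 * x := by gcongr
      _ = _ := by ring
  have c4 : ρ * η ^ 2 ≤ ρ * (21 / 10 * (g * x)) ^ 2 := by gcongr
  have c5 : 0 ≤ ρ * (g * x) ^ 2 := by positivity
  linarith

/-- The minimizer agrees with its first-order approximation up to a quadratic error. -/
theorem SolvesRankProblem.second_order {q d r : ℕ} {L : MatMap q d} {E : MatOp q} {e x ρ : ℝ}
    (he : ∀ Z, ‖E Z‖ ≤ e * ‖Z‖) (he0 : 0 ≤ e)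
    (hL : RankBound L (4 * r) (97 / 100) (103 / 100))
    (hK : RankBound (L ∘L (ContinuousLinearMap.id ℝ (MatSp q) + E)) (4 * r) (97 / 100) (103 / 100))
    {X Y D : MatSp q} (hX : (mat X).rank = r) (hXx : ‖X‖ ≤ x) {J : Matrix (Fin q) (Fin q) ℝ}
    (hJ : IsGInv X J ρ 1) (hρx : 1 ≤ ρ * x)
    (hY : SolvesRankProblem r (L ∘L (ContinuousLinearMap.id ℝ (MatSp q) + E)) (L X) Y)
    (hD : D ∈ tangentSpace X)
    (hDorth : ∀ Z ∈ tangentSpace X, inner ℝ (L D + L (E X)) (L Z) = 0) :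
    ‖Y - X - D‖ ≤ 30 * ρ * (‖L‖ * e * x) ^ 2 := by
  obtain ⟨hn1, hn2⟩ := hY.near he he0 hK hX hXx
  obtain ⟨hρ, -⟩ := hJ.nonneg
  have hx : 0 ≤ x := (norm_nonneg _).trans hXx
  obtain ⟨Q, hQ1, hQ2, hQ3⟩ := hJ.curvature (hY.1.trans hX.ge)
  set g := ‖L‖ * e with hg
  have hg0 : 0 ≤ g := by positivity
  set η := ‖Y - X‖ with hη
  have hη0 : 0 ≤ η := norm_nonneg _
  have hΔrank : (mat (Y - X)).rank ≤ 2 * r := by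
    rw [mat_sub]
    have := rank_sub_le (mat Y) (mat X)
    have := hY.1
    omega
  set Z := Y - X - Q - D with hZdef
  have hZ : Z ∈ tangentSpace X := Submodule.sub_mem _ hQ1 hD
  have hZrank : (mat Z).rank ≤ 4 * r := (rank_le_of_mem_tangentSpace hZ).trans (by omega)
  obtain ⟨A, B, hAB, hA, hB⟩ := hJ.exists_coeff hZ
  set Z' := ofMat (mat Y * A + B * mat Y) with hZ'def
  have hZ' : Z' ∈ tangentSpace Y := mem_tangentSpace.2 ⟨A, B, rfl⟩
  have hmd : mat (Z' - Z) = mat (Y - X) * A + B * mat (Y - X) := by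
    rw [mat_sub, hZ'def, mat_ofMat, hAB, mat_sub, Matrix.sub_mul, Matrix.mul_sub]
    abel
  have hdr : (mat (Z' - Z)).rank ≤ 4 * r := by
    rw [hmd]
    have h1 := Matrix.rank_mul_le_left (mat (Y - X)) A
    have h2 := Matrix.rank_mul_le_right B (mat (Y - X))
    have h3 := rank_add_le (mat (Y - X) * A) (B * mat (Y - X))
    omega
  have hdn : ‖Z' - Z‖ ≤ 2 * ρ * η * ‖Z‖ := by
    rw [← ofMat_mat (Z' - Z), hmd, ofMat_add]
    calc _ ≤ ‖ofMat (mat (Y - X) * A)‖ + ‖ofMat (B * mat (Y - X))‖ := norm_add_le _ _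
      _ ≤ η * (ρ * ‖Z‖) + (1 * ρ * ‖Z‖) * η := by
          gcongr
          · exact (norm_ofMat_mul_le' _ _).trans (by rw [ofMat_mat]; gcongr)
          · exact (norm_ofMat_mul_le _ _).trans (by rw [ofMat_mat]; gcongr)
      _ = _ := by ring
  set K := L ∘L (ContinuousLinearMap.id ℝ (MatSp q) + E) with hKdef
  have hLE : ∀ W, ‖L (E W)‖ ≤ g * ‖W‖ := fun W => by
    calc _ ≤ ‖L‖ * ‖E W‖ := L.le_opNorm _
      _ ≤ ‖L‖ * (e * ‖W‖) := by gcongr; exact he W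
      _ = _ := by rw [hg]; ring
  have hKap : ∀ W, K W = L W + L (E W) := fun W => by rw [hKdef, id_add_comp_apply]
  have hstat := hY.stationary hZ'
  have hexp : inner ℝ (L Z) (L Z) = inner ℝ (L X - K Y) (K (Z' - Z)) - inner ℝ (L (E (Y - X))) (K Z)
      - inner ℝ (L (Y - X) + L (E X)) (L (E Z)) - inner ℝ (L Q) (L Z) := by
    have h0 := hDorth Z hZ
    have h1 : L Z = L (Y - X) + L (E X) - L Q - (L D + L (E X)) := by
      rw [hZdef, map_sub, map_sub]; abel
    have h2 : L X - K Y = -(L (Y - X) + L (E X)) - L (E (Y - X)) := by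
      rw [hKap]; simp only [map_sub]; abel
    have h3 : inner ℝ (L X - K Y) (K (Z' - Z)) = -inner ℝ (L X - K Y) (K Z) := by
      rw [map_sub, inner_sub_right, hstat, zero_sub]
    rw [h3, h2]
    have h4 : inner ℝ (L Z) (L Z) = inner ℝ (L (Y - X) + L (E X)) (L Z) - inner ℝ (L Q) (L Z) := by
      nth_rewrite 1 [h1]
      rw [inner_sub_left, inner_sub_left, h0, sub_zero]
    rw [h4, hKap Z]
    generalize L (Y - X) + L (E X) = u
    generalize L (E (Y - X)) = v
    simp only [inner_sub_left, inner_add_right, inner_neg_left]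
    ring
  have b1 : inner ℝ (L X - K Y) (K (Z' - Z)) ≤ g * x * (103 / 100 * (2 * ρ * η * ‖Z‖)) :=
    (real_inner_le_norm _ _).trans (by
      gcongr
      exact (hK _ hdr).2.trans (by gcongr))
  have b2 : -inner ℝ (L (E (Y - X))) (K Z) ≤ g * η * (103 / 100 * ‖Z‖) :=
    (neg_le_abs _).trans ((abs_real_inner_le_norm _ _).trans (by
      gcongr
      · exact hLE _
      · exact (hK _ hZrank).2))
  have b3 : -inner ℝ (L (Y - X) + L (E X)) (L (E Z)) ≤
      (103 / 100 * η + g * x) * (g * ‖Z‖) :=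
    (neg_le_abs _).trans ((abs_real_inner_le_norm _ _).trans (by
      gcongr
      · refine (norm_add_le _ _).trans (add_le_add (hL _ (hΔrank.trans (by omega))).2 ?_)
        exact (hLE X).trans (by gcongr)
      · exact hLE _))
  have b4 : -inner ℝ (L Q) (L Z) ≤
      (103 / 100 * (2 * ρ * η ^ 2)) * (103 / 100 * ‖Z‖) :=
    (neg_le_abs _).trans ((abs_real_inner_le_norm _ _).trans (by
      gcongr
      · refine (hL Q (hQ3.trans (by omega))).2.trans ?_
        gcongr
        simpa using hQ2
      · exact (hL _ hZrank).2))
  have b5 : (97 / 100) ^ 2 * ‖Z‖ ^ 2 ≤ inner ℝ (L Z) (L Z) := by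
    rw [real_inner_self_eq_norm_sq, ← mul_pow]
    exact pow_le_pow_left₀ (by positivity) (hL Z hZrank).1 2
  have hfin : ‖Y - X - D‖ ≤ ‖Z‖ + ‖Q‖ := by
    have : Y - X - D = Z + Q := by rw [hZdef]; abel
    rw [this]
    exact norm_add_le _ _
  exact second_order_arith hρ hx hg0 hη0 (norm_nonneg Z) hρx hn2 hQ2 hfin
    (by rw [hexp] at b5; linarith)

end

section

/-! ### Hilbert-Schmidt sums -/

/-- The squared Hilbert-Schmidt norm of a linear map defined on matrices. -/
noncomputable def hsSq {q : ℕ} {ι : Type*} [Fintype ι] (T : MatSp q →L[ℝ] EuclideanSpace ℝ ι) : ℝ :=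
  ∑ p, ‖T (EuclideanSpace.single p 1)‖ ^ 2

theorem euNorm_nonneg {q : ℕ} (E : MatOp q) : 0 ≤ euNorm E := norm_nonneg _

theorem hsSq_eq_euNorm_sq {q : ℕ} (E : MatOp q) : hsSq E = euNorm E ^ 2 := (euNorm_sq E).symm

theorem euNorm_add_le {q : ℕ} (E F : MatOp q) : euNorm (E + F) ≤ euNorm E + euNorm F := by
  unfold euNorm
  rw [map_add]
  exact norm_add_le _ _

theorem inner_opVec {q : ℕ} (E F : MatOp q) :
    inner ℝ (opVec q E) (opVec q F) =
      ∑ p, inner ℝ (E (EuclideanSpace.single p 1)) (F (EuclideanSpace.single p 1)) := by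
  rw [PiLp.inner_apply, Fintype.sum_prod_type, Finset.sum_comm]
  simp only [opVec_apply, PiLp.inner_apply]

theorem hsSq_comp_le {q : ℕ} {ι κ : Type*} [Fintype ι] [Fintype κ]
    (A : EuclideanSpace ℝ ι →L[ℝ] EuclideanSpace ℝ κ) (T : MatSp q →L[ℝ] EuclideanSpace ℝ ι) :
    hsSq (A ∘L T) ≤ ‖A‖ ^ 2 * hsSq T := by
  unfold hsSq
  rw [Finset.mul_sum]
  refine Finset.sum_le_sum fun p _ => ?_
  rw [← mul_pow]
  gcongr
  exact A.le_opNorm _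

theorem apply_eq_inner_adjoint {V ι : Type*} [NormedAddCommGroup V] [InnerProductSpace ℝ V]
    [CompleteSpace V] [Fintype ι] [DecidableEq ι] (T : V →L[ℝ] EuclideanSpace ℝ ι) (x : V)
    (c : ι) :
    T x c = inner ℝ x (ContinuousLinearMap.adjoint T (EuclideanSpace.single c 1)) := by
  rw [ContinuousLinearMap.adjoint_inner_right, EuclideanSpace.inner_single_right]
  simp

theorem norm_sq_apply_eq_sum {V ι : Type*} [NormedAddCommGroup V] [InnerProductSpace ℝ V]
    [CompleteSpace V] [Fintype ι] [DecidableEq ι] (T : V →L[ℝ] EuclideanSpace ℝ ι) (x : V) :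
    ‖T x‖ ^ 2 =
      ∑ c, inner ℝ x (ContinuousLinearMap.adjoint T (EuclideanSpace.single c 1)) ^ 2 := by
  rw [EuclideanSpace.norm_sq_eq]
  simp only [Real.norm_eq_abs, sq_abs, apply_eq_inner_adjoint]

theorem sum_inner_single_sq {ι : Type*} [Fintype ι] [DecidableEq ι] (v : EuclideanSpace ℝ ι) :
    ∑ p, inner ℝ (EuclideanSpace.single p (1 : ℝ)) v ^ 2 = ‖v‖ ^ 2 := by
  rw [EuclideanSpace.norm_sq_eq]
  simp [EuclideanSpace.inner_single_left]

theorem hsSq_eq_sum_adjoint {q : ℕ} {ι : Type*} [Fintype ι] [DecidableEq ι]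
    (T : MatSp q →L[ℝ] EuclideanSpace ℝ ι) :
    hsSq T = ∑ c, ‖ContinuousLinearMap.adjoint T (EuclideanSpace.single c 1)‖ ^ 2 := by
  unfold hsSq
  simp only [norm_sq_apply_eq_sum T]
  rw [Finset.sum_comm]
  simp only [sum_inner_single_sq]

theorem euNorm_adjoint {q : ℕ} (E : MatOp q) :
    euNorm (ContinuousLinearMap.adjoint E) = euNorm E := by
  rw [← sq_eq_sq₀ (euNorm_nonneg _) (euNorm_nonneg _), ← hsSq_eq_euNorm_sq, ← hsSq_eq_euNorm_sq,
    hsSq_eq_sum_adjoint E]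
  rfl

theorem euNorm_comp_le {q : ℕ} (A T : MatOp q) : euNorm (A ∘L T) ≤ ‖A‖ * euNorm T := by
  rw [← sq_le_sq₀ (euNorm_nonneg _) (mul_nonneg (norm_nonneg _) (euNorm_nonneg _)), mul_pow,
    ← hsSq_eq_euNorm_sq, ← hsSq_eq_euNorm_sq]
  exact hsSq_comp_le A T

theorem euNorm_comp_le' {q : ℕ} (T A : MatOp q) : euNorm (T ∘L A) ≤ euNorm T * ‖A‖ := by
  rw [← euNorm_adjoint, ContinuousLinearMap.adjoint_comp, mul_comm, ← euNorm_adjoint T,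
    ← (ContinuousLinearMap.adjoint (𝕜 := ℝ) (E := MatSp q) (F := MatSp q)).norm_map A]
  exact euNorm_comp_le _ _

theorem norm_apply_le_euNorm {q : ℕ} (E : MatOp q) (Z : MatSp q) :
    ‖E Z‖ ≤ euNorm E * ‖Z‖ := by
  rw [← sq_le_sq₀ (norm_nonneg _) (mul_nonneg (euNorm_nonneg _) (norm_nonneg _)), mul_pow,
    ← hsSq_eq_euNorm_sq, hsSq_eq_sum_adjoint, norm_sq_apply_eq_sum, Finset.sum_mul]
  refine Finset.sum_le_sum fun c _ => ?_
  rw [← mul_pow, mul_comm, ← sq_abs]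
  exact pow_le_pow_left₀ (abs_nonneg _) (abs_real_inner_le_norm _ _) 2

/-! ### Families of matrices and the normal equations -/

theorem frame_lower {q n : ℕ} {ι : Type*} [Fintype ι] [DecidableEq ι] {X : Fin n → MatSp q} {c : ℝ}
    (h : ∀ V, c * ‖V‖ ^ 2 ≤ ∑ j, inner ℝ (X j) V ^ 2) (T : MatSp q →L[ℝ] EuclideanSpace ℝ ι) :
    c * hsSq T ≤ ∑ j, ‖T (X j)‖ ^ 2 := by
  simp only [norm_sq_apply_eq_sum T, hsSq_eq_sum_adjoint]
  rw [Finset.sum_comm, Finset.mul_sum]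
  exact Finset.sum_le_sum fun c _ => h _

theorem frame_upper {q n : ℕ} {ι : Type*} [Fintype ι] [DecidableEq ι] {X : Fin n → MatSp q} {c : ℝ}
    (h : ∀ V, ∑ j, inner ℝ (X j) V ^ 2 ≤ c * ‖V‖ ^ 2) (T : MatSp q →L[ℝ] EuclideanSpace ℝ ι) :
    ∑ j, ‖T (X j)‖ ^ 2 ≤ c * hsSq T := by
  simp only [norm_sq_apply_eq_sum T, hsSq_eq_sum_adjoint]
  rw [Finset.sum_comm, Finset.mul_sum]
  exact Finset.sum_le_sum fun c _ => h _

/-- The normal equations of the least-squares problem with data `y` and regressors `X`. -/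
def NormalEq {q n : ℕ} {ι : Type*} [Fintype ι] (y : Fin n → EuclideanSpace ℝ ι)
    (X : Fin n → MatSp q) (K : MatSp q →L[ℝ] EuclideanSpace ℝ ι) : Prop :=
  ∀ V, ∑ j, inner ℝ (X j) V • (y j - K (X j)) = 0

theorem NormalEq.sum_inner {q n : ℕ} {ι : Type*} [Fintype ι] [DecidableEq ι]
    {y : Fin n → EuclideanSpace ℝ ι} {X : Fin n → MatSp q}
    {K : MatSp q →L[ℝ] EuclideanSpace ℝ ι} (h : NormalEq y X K)
    (G : MatSp q →L[ℝ] EuclideanSpace ℝ ι) : ∑ j, inner ℝ (G (X j)) (y j - K (X j)) = 0 := by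
  have h1 : ∀ j, inner ℝ (G (X j)) (y j - K (X j)) = ∑ c, (inner ℝ (X j)
      (ContinuousLinearMap.adjoint G (EuclideanSpace.single c 1)) • (y j - K (X j))) c := by
    intro j
    rw [PiLp.inner_apply]
    refine Finset.sum_congr rfl fun c _ => ?_
    rw [PiLp.smul_apply, ← apply_eq_inner_adjoint]
    simp [mul_comm]
  simp only [h1]
  rw [Finset.sum_comm]
  refine Finset.sum_eq_zero fun c _ => ?_
  have := congrArg (fun z : EuclideanSpace ℝ ι => z c)
    (h (ContinuousLinearMap.adjoint G (EuclideanSpace.single c 1)))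
  simpa using this

theorem exists_preimage_frame {q n : ℕ} {X : Fin n → MatSp q} {c : ℝ} (hc : 0 < c)
    (h : ∀ V, c * ‖V‖ ^ 2 ≤ ∑ j, inner ℝ (X j) V ^ 2) :
    ∃ S : MatOp q, ∀ V, ∑ j, inner ℝ (X j) (S V) • X j = V := by
  set T : MatSp q →ₗ[ℝ] MatSp q :=
    { toFun := fun V => ∑ j, inner ℝ (X j) V • X j
      map_add' := fun V W => by simp [inner_add_right, add_smul, Finset.sum_add_distrib]
      map_smul' := fun a V => by simp [inner_smul_right, mul_smul, Finset.smul_sum] } with hT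
  have hinj : Function.Injective T := by
    rw [← LinearMap.ker_eq_bot, LinearMap.ker_eq_bot']
    intro V hV
    have h1 : inner ℝ (T V) V = ∑ j, inner ℝ (X j) V ^ 2 := by
      rw [hT]
      simp only [LinearMap.coe_mk, AddHom.coe_mk, sum_inner, inner_smul_left]
      exact Finset.sum_congr rfl fun j _ => by simp [pow_two]
    rw [hV, inner_zero_left] at h1
    have h2 := h V
    rw [← h1] at h2
    have h3 : ‖V‖ ^ 2 ≤ 0 := by
      by_contra hne
      have := mul_pos hc (not_le.1 hne)
      linarith
    exact norm_eq_zero.1 (pow_eq_zero_iff (two_ne_zero)|>.1 (le_antisymm h3 (by positivity)))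
  let e := LinearEquiv.ofInjectiveEndo T hinj
  refine ⟨LinearMap.toContinuousLinearMap (e.symm : MatSp q →ₗ[ℝ] MatSp q), fun V => ?_⟩
  change T (e.symm V) = V
  exact e.apply_symm_apply V

theorem exists_normalEq {q n : ℕ} {ι : Type*} [Fintype ι] {X : Fin n → MatSp q} {c : ℝ}
    (hc : 0 < c) (h : ∀ V, c * ‖V‖ ^ 2 ≤ ∑ j, inner ℝ (X j) V ^ 2)
    (y : Fin n → EuclideanSpace ℝ ι) : ∃ K, NormalEq y X K := by
  obtain ⟨S, hS⟩ := exists_preimage_frame hc h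
  refine ⟨(∑ j, (innerSL ℝ (X j)).smulRight (y j)) ∘L S, fun V => ?_⟩
  set K := (∑ j, (innerSL ℝ (X j)).smulRight (y j)) ∘L S with hK
  have hKV : ∀ V, K V = ∑ j, inner ℝ (X j) (S V) • y j := fun V => by
    rw [hK, ContinuousLinearMap.comp_apply, sum_apply]
    rfl
  have hSsymm : ∀ U V, inner ℝ U (S V) = inner ℝ (S U) V := by
    intro U V
    conv_lhs => rw [← hS U]
    conv_rhs => rw [← hS V]
    rw [sum_inner, inner_sum]
    refine Finset.sum_congr rfl fun j _ => ?_
    rw [inner_smul_left, inner_smul_right, real_inner_comm (X j) (S U)]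
    simp [mul_comm]
  have h2 : S (∑ j, inner ℝ (X j) V • X j) = V := by
    apply ext_inner_left ℝ
    intro U
    rw [hSsymm, inner_sum]
    conv_rhs => rw [← hS U, sum_inner]
    refine Finset.sum_congr rfl fun j _ => ?_
    rw [inner_smul_left, inner_smul_right, real_inner_comm (X j) (S U)]
    simp [mul_comm]
  have h1 : ∑ j, inner ℝ (X j) V • K (X j) = K (∑ j, inner ℝ (X j) V • X j) := by
    simp [map_sum]
  simp only [smul_sub, Finset.sum_sub_distrib]
  rw [h1, hKV, h2, sub_self]

theorem NormalEq.unique {q n : ℕ} {ι : Type*} [Fintype ι] {X : Fin n → MatSp q} {c : ℝ}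
    (hc : 0 < c) (h : ∀ V, c * ‖V‖ ^ 2 ≤ ∑ j, inner ℝ (X j) V ^ 2)
    {y : Fin n → EuclideanSpace ℝ ι} {K K' : MatSp q →L[ℝ] EuclideanSpace ℝ ι}
    (hK : NormalEq y X K) (hK' : NormalEq y X K') : K = K' := by
  obtain ⟨S, hS⟩ := exists_preimage_frame hc h
  ext1 V
  have h1 := hK (S V)
  have h2 := hK' (S V)
  simp only [smul_sub, Finset.sum_sub_distrib] at h1 h2
  have h3 : ∀ G : MatSp q →L[ℝ] EuclideanSpace ℝ ι,
      ∑ j, inner ℝ (X j) (S V) • G (X j) = G V := fun G => by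
    conv_rhs => rw [← hS V]
    simp [map_sum]
  rw [h3, sub_eq_zero] at h1 h2
  rw [← h1, ← h2]

theorem eq_zero_of_forall_quadratic {b c : ℝ} (hb : 0 ≤ b)
    (h : ∀ t : ℝ, 0 ≤ t * c + t ^ 2 * b) : c = 0 := by
  have h1 := h (-c / (b + 1))
  have h2 : -c / (b + 1) * c + (-c / (b + 1)) ^ 2 * b = -(c ^ 2 / (b + 1) ^ 2) := by
    field_simp
    ring
  rw [h2] at h1
  by_contra hne
  have : 0 < c ^ 2 / (b + 1) ^ 2 := by positivity
  linarith

theorem IsLeastSquares.normalEq {q d n : ℕ} {y : Fin n → EuclideanSpace ℝ (Fin d)}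
    {X : Fin n → MatSp q} {K : MatMap q d} (h : IsLeastSquares y X K) : NormalEq y X K := by
  intro V
  set u := ∑ j, inner ℝ (X j) V • (y j - K (X j)) with hu
  set G : MatMap q d := (innerSL ℝ V).smulRight u with hG
  have hGX : ∀ j, G (X j) = inner ℝ (X j) V • u := fun j => by
    rw [hG, ContinuousLinearMap.smulRight_apply, innerSL_apply_apply, real_inner_comm]
  set b := ∑ j, ‖G (X j)‖ ^ 2 with hb
  have h1 : ∀ t : ℝ, 0 ≤ t * (-2 * ‖u‖ ^ 2) + t ^ 2 * b := by
    intro t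
    have h2 := h (K + t • G)
    have h3 : ∑ j, ‖y j - (K + t • G) (X j)‖ ^ 2 = ∑ j, ‖y j - K (X j)‖ ^ 2 -
        2 * t * ∑ j, inner ℝ (y j - K (X j)) (G (X j)) + t ^ 2 * b := by
      rw [hb, Finset.mul_sum, Finset.mul_sum, ← Finset.sum_sub_distrib, ← Finset.sum_add_distrib]
      refine Finset.sum_congr rfl fun j _ => ?_
      rw [add_apply, smul_apply, ← sub_sub,
        norm_sub_sq_real, inner_smul_right, norm_smul, mul_pow, Real.norm_eq_abs, sq_abs]
      ring
    have h4 : ∑ j, inner ℝ (y j - K (X j)) (G (X j)) = ‖u‖ ^ 2 := by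
      rw [← real_inner_self_eq_norm_sq]
      conv_rhs => rw [hu, sum_inner]
      refine Finset.sum_congr rfl fun j _ => ?_
      rw [hGX, inner_smul_left, inner_smul_right]
      rfl
    rw [h3, h4] at h2
    linarith
  have hb0 : 0 ≤ b := Finset.sum_nonneg fun _ _ => by positivity
  have h6 := eq_zero_of_forall_quadratic hb0 h1
  have h7 : ‖u‖ ^ 2 = 0 := by linarith
  exact norm_eq_zero.1 (pow_eq_zero_iff two_ne_zero |>.1 h7)

theorem NormalEq.isLeastSquares {q d n : ℕ} {y : Fin n → EuclideanSpace ℝ (Fin d)}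
    {X : Fin n → MatSp q} {K : MatMap q d} (h : NormalEq y X K) : IsLeastSquares y X K := by
  intro K'
  have h1 := h.sum_inner (K - K')
  have h2 : ∑ j, ‖y j - K' (X j)‖ ^ 2 = ∑ j, ‖y j - K (X j)‖ ^ 2 +
      ∑ j, ‖(K - K') (X j)‖ ^ 2 + 2 * ∑ j, inner ℝ ((K - K') (X j)) (y j - K (X j)) := by
    rw [Finset.mul_sum, ← Finset.sum_add_distrib, ← Finset.sum_add_distrib]
    refine Finset.sum_congr rfl fun j _ => ?_
    have : y j - K' (X j) = (K - K') (X j) + (y j - K (X j)) := by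
      rw [sub_apply]; abel
    rw [this, norm_add_sq_real]
    ring
  rw [h2, h1]
  have : 0 ≤ ∑ j, ‖(K - K') (X j)‖ ^ 2 := Finset.sum_nonneg fun _ _ => by positivity
  linarith

end

section

/-! ### The spectrum of the covariance -/

theorem norm_sub_center_le {q : ℕ} {T : MatOp q}
    (hT : (T : MatSp q →ₗ[ℝ] MatSp q).IsSymmetric) (V : MatSp q) :
    ‖T V - ((lambdaMax T + lambdaMin T) / 2) • V‖ ≤ (lambdaMax T - lambdaMin T) / 2 * ‖V‖ := by
  set S := {μ : ℝ | Module.End.HasEigenvalue (T : MatSp q →ₗ[ℝ] MatSp q) μ} with hS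
  have hbound : ∀ μ ∈ S, |μ| ≤ ‖T‖ := by
    intro μ hμ
    obtain ⟨v, hv⟩ := Module.End.HasEigenvalue.exists_hasEigenvector hμ
    have h1 : T v = μ • v := hv.apply_eq_smul
    have h2 := T.le_opNorm v
    rw [h1, norm_smul, Real.norm_eq_abs] at h2
    exact le_of_mul_le_mul_right h2 (norm_pos_iff.2 hv.2)
  have hba : BddAbove S := ⟨‖T‖, fun μ hμ => (abs_le.1 (hbound μ hμ)).2⟩
  have hbb : BddBelow S := ⟨-‖T‖, fun μ hμ => (abs_le.1 (hbound μ hμ)).1⟩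
  set b := hT.eigenvectorBasis rfl with hb
  have hmem : ∀ i, hT.eigenvalues rfl i ∈ S := fun i => hT.hasEigenvalue_eigenvalues rfl i
  have hle : ∀ i, |hT.eigenvalues rfl i - (lambdaMax T + lambdaMin T) / 2| ≤
      (lambdaMax T - lambdaMin T) / 2 := by
    intro i
    have h1 : hT.eigenvalues rfl i ≤ lambdaMax T := le_csSup hba (hmem i)
    have h2 : lambdaMin T ≤ hT.eigenvalues rfl i := csInf_le hbb (hmem i)
    rw [abs_le]
    constructor <;> linarith
  set c := (lambdaMax T + lambdaMin T) / 2
  set δ := (lambdaMax T - lambdaMin T) / 2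
  have hrepr : ∀ i, b.repr (T V - c • V) i = (hT.eigenvalues rfl i - c) * b.repr V i := by
    intro i
    rw [map_sub, map_smul, PiLp.sub_apply, PiLp.smul_apply, sub_mul]
    congr 1
    exact hT.eigenvectorBasis_apply_self_apply rfl V i
  have hsq : ‖T V - c • V‖ ^ 2 ≤ δ ^ 2 * ‖V‖ ^ 2 := by
    rw [← b.repr.norm_map, ← b.repr.norm_map V, EuclideanSpace.norm_sq_eq,
      EuclideanSpace.norm_sq_eq, Finset.mul_sum]
    refine Finset.sum_le_sum fun i _ => ?_
    rw [hrepr, norm_mul, mul_pow]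
    gcongr
    exact hle i
  rcases eq_or_lt_of_le (norm_nonneg V) with h0 | h0
  · have : V = 0 := norm_eq_zero.1 h0.symm
    simp [this]
  · have hδ : 0 ≤ δ := by
      have : Nontrivial (MatSp q) := ⟨V, 0, fun h => by simp [h] at h0⟩
      have hpos : 0 < Module.finrank ℝ (MatSp q) := Module.finrank_pos
      exact (abs_nonneg _).trans (hle ⟨0, hpos⟩)
    rw [← mul_pow] at hsq
    exact (sq_le_sq₀ (norm_nonneg _) (by positivity)).1 hsq

theorem covariance_apply {q n : ℕ} (X : Fin n → MatSp q) (V : MatSp q) :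
    covariance X V = (n : ℝ)⁻¹ • ∑ j, inner ℝ (X j) V • X j := by
  rw [covariance, smul_apply, sum_apply]
  rfl

theorem covariance_isSymmetric {q n : ℕ} (X : Fin n → MatSp q) :
    ((covariance X : MatOp q) : MatSp q →ₗ[ℝ] MatSp q).IsSymmetric := by
  intro U V
  change inner ℝ (covariance X U) V = inner ℝ U (covariance X V)
  rw [covariance_apply, covariance_apply, inner_smul_left, inner_smul_right, sum_inner, inner_sum]
  congr 1
  refine Finset.sum_congr rfl fun j _ => ?_
  rw [inner_smul_left, inner_smul_right, real_inner_comm (X j) U]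
  simp [mul_comm]

theorem covariance_sub_le {q n : ℕ} (X : Fin n → MatSp q) (V : MatSp q) :
    ‖covariance X V - bigLambda X • V‖ ≤ bigDelta X * ‖V‖ :=
  norm_sub_center_le (covariance_isSymmetric X) V

theorem sum_inner_sq_eq {q n : ℕ} (hn : 0 < n) (X : Fin n → MatSp q) (V : MatSp q) :
    ∑ j, inner ℝ (X j) V ^ 2 = n * inner ℝ (covariance X V) V := by
  rw [covariance_apply, inner_smul_left, sum_inner, conj_trivial, ← mul_assoc,
    mul_inv_cancel₀ (by positivity), one_mul]
  refine Finset.sum_congr rfl fun j _ => ?_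
  rw [inner_smul_left, pow_two]
  rfl

theorem sum_inner_sq_bounds {q n : ℕ} (hn : 0 < n) (X : Fin n → MatSp q) (V : MatSp q) :
    n * (bigLambda X - bigDelta X) * ‖V‖ ^ 2 ≤ ∑ j, inner ℝ (X j) V ^ 2 ∧
      ∑ j, inner ℝ (X j) V ^ 2 ≤ n * (bigLambda X + bigDelta X) * ‖V‖ ^ 2 := by
  have h1 : |inner ℝ (covariance X V - bigLambda X • V) V| ≤ bigDelta X * ‖V‖ * ‖V‖ :=
    (abs_real_inner_le_norm _ _).trans (by gcongr; exact covariance_sub_le X V)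
  rw [inner_sub_left, inner_smul_left, real_inner_self_eq_norm_sq, conj_trivial, abs_le] at h1
  rw [sum_inner_sq_eq hn, mul_assoc, mul_assoc]
  constructor
  · gcongr
    linarith
  · gcongr
    linarith

/-! ### Perturbation of least-squares solutions -/

theorem sum_inner_le {n : ℕ} {H : Type*} [NormedAddCommGroup H] [InnerProductSpace ℝ H]
    (a b : Fin n → H) (α β : ℝ) (hα : 0 ≤ α) (hβ : 0 ≤ β) (ha : ∑ j, ‖a j‖ ^ 2 ≤ α ^ 2)
    (hb : ∑ j, ‖b j‖ ^ 2 ≤ β ^ 2) : |∑ j, inner ℝ (a j) (b j)| ≤ α * β := by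
  have h := abs_real_inner_le_norm (WithLp.toLp 2 a : PiLp 2 fun _ : Fin n => H) (WithLp.toLp 2 b)
  rw [PiLp.inner_apply] at h
  refine h.trans ?_
  gcongr
  · rw [← sq_le_sq₀ (norm_nonneg _) hα, PiLp.norm_sq_eq_of_L2]
    exact ha
  · rw [← sq_le_sq₀ (norm_nonneg _) hβ, PiLp.norm_sq_eq_of_L2]
    exact hb

theorem sum_norm_sq_le {n : ℕ} {H : Type*} [NormedAddCommGroup H] {a : Fin n → H} {α : ℝ}
    (ha : ∀ j, ‖a j‖ ≤ α) : ∑ j, ‖a j‖ ^ 2 ≤ (√(n : ℝ) * α) ^ 2 := by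
  calc ∑ j, ‖a j‖ ^ 2 ≤ ∑ _j : Fin n, α ^ 2 :=
        Finset.sum_le_sum fun j _ => pow_le_pow_left₀ (norm_nonneg _) (ha j) 2
    _ = _ := by
        rw [Finset.sum_const, Finset.card_univ, Fintype.card_fin, nsmul_eq_mul, mul_pow,
          Real.sq_sqrt (Nat.cast_nonneg n)]

theorem frame_perturb {q n : ℕ} {X Y : Fin n → MatSp q} {c η : ℝ}
    (hX : ∀ V, n * c ^ 2 * ‖V‖ ^ 2 ≤ ∑ j, inner ℝ (X j) V ^ 2) (hη : ∀ j, ‖Y j - X j‖ ≤ η)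
    (hη0 : 0 ≤ η) (hc : η ≤ c) (V : MatSp q) :
    n * (c - η) ^ 2 * ‖V‖ ^ 2 ≤ ∑ j, inner ℝ (Y j) V ^ 2 := by
  set v : (Fin n → MatSp q) → EuclideanSpace ℝ (Fin n) :=
    fun Z => WithLp.toLp 2 fun j => inner ℝ (Z j) V with hv
  have hvn : ∀ Z, ‖v Z‖ ^ 2 = ∑ j, inner ℝ (Z j) V ^ 2 := fun Z => by
    rw [EuclideanSpace.norm_sq_eq]
    simp [hv]
  have h1 : ‖v (Y - X)‖ ≤ √(n : ℝ) * η * ‖V‖ := by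
    rw [← sq_le_sq₀ (norm_nonneg _) (by positivity), hvn, mul_pow]
    calc _ ≤ ∑ j, ‖Y j - X j‖ ^ 2 * ‖V‖ ^ 2 := Finset.sum_le_sum fun j _ => by
          rw [← mul_pow, ← sq_abs]
          exact pow_le_pow_left₀ (abs_nonneg _) (abs_real_inner_le_norm (Y j - X j) V) 2
      _ = (∑ j, ‖Y j - X j‖ ^ 2) * ‖V‖ ^ 2 := by rw [Finset.sum_mul]
      _ ≤ _ := by gcongr; exact sum_norm_sq_le (a := fun j => Y j - X j) hη
  have h2 : √(n : ℝ) * c * ‖V‖ ≤ ‖v X‖ := by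
    rw [← sq_le_sq₀ (mul_nonneg (mul_nonneg (Real.sqrt_nonneg _) (hη0.trans hc)) (norm_nonneg _))
      (norm_nonneg _), hvn, mul_pow, mul_pow, Real.sq_sqrt (Nat.cast_nonneg n)]
    exact hX V
  have h3 : v (Y - X) = v Y - v X := by
    ext j
    simp [hv, inner_sub_left]
  have h4 : ‖v X‖ - ‖v (Y - X)‖ ≤ ‖v Y‖ := by
    have := norm_sub_le (v Y) (v (Y - X))
    rw [h3, sub_sub_cancel] at this
    rw [h3]
    linarith
  rw [← hvn]
  calc n * (c - η) ^ 2 * ‖V‖ ^ 2 = (√(n : ℝ) * (c - η) * ‖V‖) ^ 2 := by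
        rw [mul_pow, mul_pow, Real.sq_sqrt (Nat.cast_nonneg n)]
    _ ≤ ‖v Y‖ ^ 2 :=
        pow_le_pow_left₀ (mul_nonneg (mul_nonneg (Real.sqrt_nonneg _) (sub_nonneg.2 hc))
          (norm_nonneg V)) (by linarith) 2

theorem euNorm_le_of_frame {q n : ℕ} (hn : 0 < n) {X : Fin n → MatSp q} {c u : ℝ} (hc : 0 < c)
    (hX : ∀ V, n * c ^ 2 * ‖V‖ ^ 2 ≤ ∑ j, inner ℝ (X j) V ^ 2) (K : MatOp q) (hu : 0 ≤ u)
    (h : ∑ j, ‖K (X j)‖ ^ 2 ≤ (√(n : ℝ) * u) ^ 2) : euNorm K ≤ u / c := by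
  have h1 := (frame_lower hX K).trans h
  rw [hsSq_eq_euNorm_sq, mul_pow, Real.sq_sqrt (Nat.cast_nonneg n), mul_assoc] at h1
  have hn' : (0 : ℝ) < n := by exact_mod_cast hn
  have h2 := le_of_mul_le_mul_left h1 hn'
  rw [← mul_pow, sq_le_sq₀ (mul_nonneg hc.le (euNorm_nonneg _)) hu] at h2
  rw [le_div_iff₀ hc]
  linarith

theorem NormalEq.sum_norm_sq {q n : ℕ} {ι : Type*} [Fintype ι] [DecidableEq ι]
    {y : Fin n → EuclideanSpace ℝ ι} {X : Fin n → MatSp q}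
    {K : MatSp q →L[ℝ] EuclideanSpace ℝ ι} (h : NormalEq y X K) :
    ∑ j, ‖y j‖ ^ 2 = ∑ j, ‖y j - K (X j)‖ ^ 2 + ∑ j, ‖K (X j)‖ ^ 2 := by
  have h1 := h.sum_inner K
  have h2 : ∑ j, ‖y j‖ ^ 2 = ∑ j, ‖y j - K (X j)‖ ^ 2 + ∑ j, ‖K (X j)‖ ^ 2 +
      2 * ∑ j, inner ℝ (K (X j)) (y j - K (X j)) := by
    rw [Finset.mul_sum, ← Finset.sum_add_distrib, ← Finset.sum_add_distrib]
    refine Finset.sum_congr rfl fun j _ => ?_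
    have : y j = (y j - K (X j)) + K (X j) := by abel
    conv_lhs => rw [this, norm_add_sq_real, real_inner_comm]
    ring
  rw [h2, h1]
  ring

theorem NormalEq.euNorm_le {q n : ℕ} (hn : 0 < n) {X y : Fin n → MatSp q} {c u : ℝ} (hc : 0 < c)
    (hX : ∀ V, n * c ^ 2 * ‖V‖ ^ 2 ≤ ∑ j, inner ℝ (X j) V ^ 2) {K : MatOp q}
    (h : NormalEq y X K) (hu : 0 ≤ u) (hy : ∑ j, ‖y j‖ ^ 2 ≤ (√(n : ℝ) * u) ^ 2) :
    euNorm K ≤ u / c := by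
  refine euNorm_le_of_frame hn hc hX K hu (le_trans ?_ hy)
  rw [h.sum_norm_sq]
  have : 0 ≤ ∑ j, ‖y j - K (X j)‖ ^ 2 := Finset.sum_nonneg fun _ _ => by positivity
  linarith

theorem normalEq_perturbation {q n : ℕ} (hn : 0 < n) {X Y D : Fin n → MatSp q} {F Fh : MatOp q}
    {c η δ τ : ℝ} (hc : 0 < c)
    (hX : ∀ V, n * c ^ 2 * ‖V‖ ^ 2 ≤ ∑ j, inner ℝ (X j) V ^ 2)
    (hη0 : 0 ≤ η) (hδ0 : 0 ≤ δ) (hτ0 : 0 ≤ τ)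
    (hη : ∀ j, ‖Y j - X j‖ ≤ η) (hηc : η ≤ c / 10) (hδ : ∀ j, ‖D j‖ ≤ δ)
    (hτ : ∀ j, ‖Y j - X j - D j‖ ≤ τ) (hF : NormalEq (fun j => -D j) X F)
    (hFh : NormalEq (fun j => -(Y j - X j)) Y Fh) :
    euNorm (Fh - F) ≤ (τ + 22 / 10 * (δ * η / c)) / (9 / 10 * c) := by
  have hY : ∀ V, n * (9 / 10 * c) ^ 2 * ‖V‖ ^ 2 ≤ ∑ j, inner ℝ (Y j) V ^ 2 := fun V => by
    refine le_trans ?_ (frame_perturb hX hη hη0 (by linarith) V)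
    gcongr
    linarith
  have hFn : euNorm F ≤ δ / c := hF.euNorm_le hn hc hX hδ0 (by
    simp only [norm_neg]
    exact sum_norm_sq_le hδ)
  set m := √(n : ℝ) with hm
  have hm0 : 0 < m := Real.sqrt_pos.2 (by exact_mod_cast hn)
  set G := Fh - F with hG
  set u := √(∑ j, ‖G (Y j)‖ ^ 2) with hu
  have hu2 : u ^ 2 = ∑ j, ‖G (Y j)‖ ^ 2 := Real.sq_sqrt (Finset.sum_nonneg fun _ _ => by positivity)
  have hu0 : 0 ≤ u := Real.sqrt_nonneg _
  have hGu : euNorm G ≤ (u / m) / (9 / 10 * c) :=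
    euNorm_le_of_frame hn (by positivity) hY G (by positivity) (by
      rw [← hm, mul_div_cancel₀ _ hm0.ne', hu2])
  have e1 : ∑ j, ‖G (Y j)‖ ^ 2 =
      -∑ j, inner ℝ (G (Y j)) ((Y j - X j - D j) + F (Y j - X j)) +
        ∑ j, inner ℝ (G (Y j - X j)) (-D j - F (X j)) := by
    have h1 := hFh.sum_inner G
    have h2 := hF.sum_inner G
    have h3 : ∑ j, ‖G (Y j)‖ ^ 2 =
        -∑ j, inner ℝ (G (Y j)) ((Y j - X j - D j) + F (Y j - X j)) +
        ∑ j, inner ℝ (G (Y j - X j)) (-D j - F (X j)) +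
        ∑ j, inner ℝ (G (X j)) (-D j - F (X j)) -
        ∑ j, inner ℝ (G (Y j)) (-(Y j - X j) - Fh (Y j)) := by
      rw [← Finset.sum_neg_distrib, ← Finset.sum_add_distrib, ← Finset.sum_add_distrib,
        ← Finset.sum_sub_distrib]
      refine Finset.sum_congr rfl fun j _ => ?_
      rw [← real_inner_self_eq_norm_sq]
      have h4 : G (Y j) = Fh (Y j) - F (Y j) := by rw [hG, sub_apply]
      have h5 : inner ℝ (G (Y j)) (G (Y j)) = inner ℝ (G (Y j)) (Fh (Y j) - F (Y j)) := by
        rw [← h4]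
      rw [h5]
      simp only [map_sub, inner_sub_left, inner_sub_right, inner_add_right, inner_neg_right]
      ring
    rw [h3, h1, h2]
    ring
  have e2 : -∑ j, inner ℝ (G (Y j)) ((Y j - X j - D j) + F (Y j - X j)) ≤
      u * (m * (τ + δ / c * η)) :=
    (neg_le_abs _).trans (sum_inner_le _ _ _ _ hu0 (by positivity) hu2.ge (sum_norm_sq_le fun j =>
      (norm_add_le _ _).trans (add_le_add (hτ j) ((norm_apply_le_euNorm F _).trans (by
        gcongr
        exact hη j)))))
  have e3 : ∑ j, inner ℝ (G (Y j - X j)) (-D j - F (X j)) ≤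
      (m * ((u / m) / (9 / 10 * c) * η)) * (m * δ) := by
    refine (le_abs_self _).trans (sum_inner_le _ _ _ _ (by positivity) (by positivity)
      (sum_norm_sq_le fun j => (norm_apply_le_euNorm G _).trans (by gcongr; exact hη j)) ?_)
    have h1 := hF.sum_norm_sq
    have h2 : 0 ≤ ∑ j, ‖F (X j)‖ ^ 2 := Finset.sum_nonneg fun _ _ => by positivity
    have h3 := sum_norm_sq_le hδ
    simp only [norm_neg] at h1
    linarith
  have e4 : u ^ 2 ≤ u * (m * (τ + 22 / 10 * (δ * η / c))) := by
    rw [hu2, e1]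
    have h1 : (m * ((u / m) / (9 / 10 * c) * η)) * (m * δ) = u * (m * (10 / 9 * (δ * η / c))) := by
      field_simp
    have h2 : u * (m * (τ + δ / c * η)) = u * (m * (τ + (δ * η / c))) := by ring
    have h3 : 0 ≤ u * (m * (δ * η / c)) := by positivity
    rw [h1] at e3
    rw [h2] at e2
    nlinarith
  have e5 : u ≤ m * (τ + 22 / 10 * (δ * η / c)) := by
    rcases eq_or_lt_of_le hu0 with h | h
    · rw [← h]; positivity
    · rw [pow_two] at e4
      exact le_of_mul_le_mul_left e4 h
  refine hGu.trans ?_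
  gcongr
  rw [div_le_iff₀ hm0]
  linarith

end

section

/-! ### The linearized update modulo the tangent space of the rank-preservers -/

theorem comp_boxTimes {q : ℕ} (A : MatOp q) (X Y : MatSp q) :
    A ∘L boxTimes X Y = boxTimes (A X) Y := by
  ext1 Z
  change A (inner ℝ Y Z • X) = inner ℝ Y Z • A X
  rw [map_smul]

theorem inner_opVec_boxTimes {q : ℕ} (H : MatOp q) (X Y : MatSp q) :
    inner ℝ (opVec q H) (opVec q (boxTimes X Y)) = inner ℝ (H Y) X := by
  have hY : Y = ∑ p, Y p • EuclideanSpace.single p (1 : ℝ) := by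
    ext p
    simp [Pi.single_apply]
  rw [inner_opVec]
  conv_rhs => rw [hY, map_sum, sum_inner]
  refine Finset.sum_congr rfl fun p _ => ?_
  change inner ℝ (H _) (inner ℝ Y (EuclideanSpace.single p 1) • X) = _
  rw [inner_smul_right, map_smul, inner_smul_left, EuclideanSpace.inner_single_right]
  simp

theorem inner_superOp {q n : ℕ} (X : Fin n → MatSp q) (H : MatOp q) :
    inner ℝ (opVec q H) (superOp X (opVec q H)) =
      (n : ℝ)⁻¹ * ∑ j, ‖(tangentSpace (X j)).starProjection (H (X j))‖ ^ 2 := by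
  have h1 : superOp X (opVec q H) = (n : ℝ)⁻¹ • ∑ j, opVec q
        ((tangentSpace (X j)).starProjection ∘L (opVec q).symm (opVec q H) ∘L
          boxTimes (X j) (X j)) := rfl
  rw [h1, inner_smul_right, inner_sum]
  congr 1
  refine Finset.sum_congr rfl fun j _ => ?_
  rw [LinearEquiv.symm_apply_apply, comp_boxTimes, comp_boxTimes, inner_opVec_boxTimes,
    ← real_inner_self_eq_norm_sq, Submodule.inner_starProjection_left_eq_right,
    Submodule.starProjection_eq_self_iff.2 (Submodule.starProjection_apply_mem _ _)]

theorem sum_tangent_le {q n : ℕ} (hn : 0 < n) (X : Fin n → MatSp q) {H : MatOp q}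
    (hH : opVec q H ∈ (tangentRankPreservers q)ᗮ) :
    ∑ j, ‖(tangentSpace (X j)).starProjection (H (X j))‖ ^ 2 ≤
      n * bigOmega X * euNorm H ^ 2 := by
  have h1 := inner_superOp X H
  have h2 : inner ℝ (opVec q H) (superOp X (opVec q H)) =
      inner ℝ (opVec q H)
        (((tangentRankPreservers q)ᗮ.starProjection ∘L superOp X) (opVec q H)) := by
    rw [ContinuousLinearMap.comp_apply, ← Submodule.inner_starProjection_left_eq_right,
      Submodule.starProjection_eq_self_iff.2 hH]
  have h3 := (real_inner_le_norm _ _).trans (mul_le_mul_of_nonneg_left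
    (((tangentRankPreservers q)ᗮ.starProjection ∘L superOp X).le_opNorm (opVec q H))
    (norm_nonneg (opVec q H)))
  rw [← h2, h1, inv_mul_le_iff₀ (by positivity)] at h3
  refine h3.trans (le_of_eq ?_)
  change (n : ℝ) * (euNorm H * (bigOmega X * euNorm H)) = _
  ring

theorem bigOmega_nonneg {q n : ℕ} (X : Fin n → MatSp q) : 0 ≤ bigOmega X := norm_nonneg _

/-- The operator can be changed by a tangent vector so that its image under `L` becomes
orthogonal to the image of the tangent space. -/
theorem exists_tangent_correction {q d : ℕ} (L : MatMap q d) (E : MatOp q) :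
    ∃ w : MatOp q, opVec q w ∈ tangentRankPreservers q ∧
      opVec q (ContinuousLinearMap.adjoint L ∘L L ∘L (E + w)) ∈ (tangentRankPreservers q)ᗮ ∧
      hsSq (L ∘L (E + w)) ≤ (‖L‖ * euNorm E) ^ 2 := by
  set Φ : OpSp q →ₗ[ℝ] PiLp 2 (fun _ : Fin q × Fin q => EuclideanSpace ℝ (Fin d)) :=
    { toFun := fun F => WithLp.toLp 2 fun p => L ((opVec q).symm F (EuclideanSpace.single p 1))
      map_add' := fun F G => by
        ext1 p
        simp
      map_smul' := fun c F => by
        ext1 p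
        simp } with hΦ
  obtain ⟨s, hs, hz⟩ := exists_orthogonal_correction (tangentRankPreservers q) Φ (Φ (opVec q E))
  have hap : ∀ (F : MatOp q) p, Φ (opVec q F) p = L (F (EuclideanSpace.single p 1)) := by
    intro F p
    simp [hΦ]
  set w := (opVec q).symm s with hw
  have hws : opVec q w = s := (opVec q).apply_symm_apply s
  have hsum : Φ s + Φ (opVec q E) = Φ (opVec q (E + w)) := by
    rw [← hws, ← map_add, ← map_add, add_comm]
  rw [hsum] at hz
  have hhs : ∀ F : MatOp q, hsSq (L ∘L F) = ‖Φ (opVec q F)‖ ^ 2 := by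
    intro F
    rw [PiLp.norm_sq_eq_of_L2]
    simp only [hap]
    rfl
  refine ⟨w, hws ▸ hs, ?_, ?_⟩
  · rw [Submodule.mem_orthogonal]
    intro u hu
    have h1 := hz u hu
    rw [← (opVec q).apply_symm_apply u] at h1 ⊢
    rw [real_inner_comm, PiLp.inner_apply] at h1
    rw [inner_opVec, ← h1]
    refine Finset.sum_congr rfl fun p _ => ?_
    rw [hap, hap, ContinuousLinearMap.comp_apply, ContinuousLinearMap.adjoint_inner_right]
    rfl
  · have h1 := hz s hs
    have h2 : ‖Φ (opVec q (E + w))‖ ^ 2 =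
        inner ℝ (Φ (opVec q (E + w))) (Φ (opVec q E)) := by
      rw [← real_inner_self_eq_norm_sq]
      nth_rewrite 2 [← hsum]
      rw [inner_add_right, h1, zero_add]
    have h3 : ‖Φ (opVec q (E + w))‖ ≤ ‖Φ (opVec q E)‖ := by
      have h4 := real_inner_le_norm (Φ (opVec q (E + w))) (Φ (opVec q E))
      rw [← h2, pow_two] at h4
      rcases eq_or_lt_of_le (norm_nonneg (Φ (opVec q (E + w)))) with h | h
      · rw [← h]; exact norm_nonneg _
      · exact le_of_mul_le_mul_left h4 h
    rw [hhs, mul_pow, ← hsSq_eq_euNorm_sq]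
    refine le_trans ?_ (hsSq_comp_le L E)
    rw [hhs]
    exact pow_le_pow_left₀ (norm_nonneg _) h3 2

set_option maxHeartbeats 1000000 in
theorem exists_linearized_update {q d n r : ℕ} (hn : 0 < n) {X : Fin n → MatSp q} {L : MatMap q d}
    (E : MatOp q) (hL : RankBound L (4 * r) (97 / 100) (103 / 100))
    (hX : ∀ j, (mat (X j)).rank = r) (hΛ : 0 < bigLambda X)
    (hΔ0 : 0 ≤ bigDelta X) (hΔ : bigDelta X ≤ bigLambda X / 100) :
    ∃ (w Ft : MatOp q) (Dt : Fin n → MatSp q), opVec q w ∈ tangentRankPreservers q ∧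
      (∀ j, Dt j ∈ tangentSpace (X j)) ∧
      (∀ j, ∀ Z ∈ tangentSpace (X j), inner ℝ (L (Dt j) + L ((E + w) (X j))) (L Z) = 0) ∧
      NormalEq (fun j => -Dt j) X Ft ∧
      ‖(tangentRankPreservers q)ᗮ.starProjection (opVec q Ft)‖ ≤
        (2 * ‖L‖ ^ 2 * (bigOmega X / bigLambda X) + 2 * ‖L‖ * (bigDelta X / bigLambda X)) *
          euNorm E := by
  obtain ⟨w, hw, horth, hhs⟩ := exists_tangent_correction L E
  set Λ := bigLambda X
  set Δ := bigDelta X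
  set e := euNorm E
  set l := ‖L‖
  set E1 := E + w
  set H1 : MatOp q := ContinuousLinearMap.adjoint L ∘L L ∘L E1 with hH1
  have hn' : (0 : ℝ) < n := by exact_mod_cast hn
  have he : 0 ≤ e := euNorm_nonneg _
  have hl : 0 ≤ l := norm_nonneg _
  have hH1n : euNorm H1 ≤ l * (l * e) := by
    rw [← sq_le_sq₀ (euNorm_nonneg _) (by positivity), ← hsSq_eq_euNorm_sq, mul_pow]
    refine (hsSq_comp_le (ContinuousLinearMap.adjoint L) (L ∘L E1)).trans ?_
    rw [LinearIsometryEquiv.norm_map]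
    gcongr
  have hDex : ∀ j, ∃ D ∈ tangentSpace (X j), ∀ Z ∈ tangentSpace (X j),
      inner ℝ (L D + L (E1 (X j))) (L Z) = 0 := fun j =>
    exists_orthogonal_correction (tangentSpace (X j)) (L : MatSp q →ₗ[ℝ] _) (L (E1 (X j)))
  choose Dt hDt hDo using hDex
  have hDrank : ∀ j, (mat (Dt j)).rank ≤ 4 * r := fun j =>
    (rank_le_of_mem_tangentSpace (hDt j)).trans (by rw [hX]; omega)
  have hD2 : ∀ j, (97 / 100) ^ 2 * ‖Dt j‖ ^ 2 ≤ -inner ℝ (L (E1 (X j))) (L (Dt j)) := by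
    intro j
    have h1 := hDo j _ (hDt j)
    rw [inner_add_left, real_inner_self_eq_norm_sq] at h1
    have h2 := pow_le_pow_left₀ (by positivity) (hL _ (hDrank j)).1 2
    rw [mul_pow] at h2
    linarith
  have hDa : ∀ j, ‖Dt j‖ ≤ 11 / 10 * ‖(tangentSpace (X j)).starProjection (H1 (X j))‖ := by
    intro j
    have h1 : inner ℝ (L (E1 (X j))) (L (Dt j)) =
        inner ℝ ((tangentSpace (X j)).starProjection (H1 (X j))) (Dt j) := by
      rw [Submodule.inner_starProjection_left_eq_right,
        Submodule.starProjection_eq_self_iff.2 (hDt j)]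
      change _ = inner ℝ (ContinuousLinearMap.adjoint L (L (E1 (X j)))) (Dt j)
      rw [ContinuousLinearMap.adjoint_inner_left]
    have h2 : (97 / 100) ^ 2 * ‖Dt j‖ ^ 2 ≤
        ‖(tangentSpace (X j)).starProjection (H1 (X j))‖ * ‖Dt j‖ := by
      refine (hD2 j).trans ((neg_le_abs _).trans ?_)
      rw [h1]
      exact abs_real_inner_le_norm _ _
    rcases eq_or_lt_of_le (norm_nonneg (Dt j)) with h | h
    · rw [← h]; positivity
    · have h3 : (97 / 100) ^ 2 * ‖Dt j‖ ≤ ‖(tangentSpace (X j)).starProjection (H1 (X j))‖ :=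
        le_of_mul_le_mul_right (by linarith) h
      nlinarith [norm_nonneg ((tangentSpace (X j)).starProjection (H1 (X j)))]
  have hDb : ∀ j, ‖Dt j‖ ^ 2 ≤ (11 / 10) * ‖(L ∘L E1) (X j)‖ ^ 2 := by
    intro j
    have h2 := (hD2 j).trans ((neg_le_abs _).trans (abs_real_inner_le_norm _ _))
    have h3 := (hL _ (hDrank j)).1
    have h1 := hDo j _ (hDt j)
    rw [inner_add_left, real_inner_self_eq_norm_sq] at h1
    have h4 : ‖L (Dt j)‖ ^ 2 ≤ ‖L (E1 (X j))‖ * ‖L (Dt j)‖ := by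
      have := (neg_le_abs _).trans (abs_real_inner_le_norm (L (E1 (X j))) (L (Dt j)))
      linarith
    have h5 : ‖L (Dt j)‖ ≤ ‖L (E1 (X j))‖ := by
      rcases eq_or_lt_of_le (norm_nonneg (L (Dt j))) with h | h
      · rw [← h]; positivity
      · rw [pow_two] at h4
        exact le_of_mul_le_mul_right h4 h
    have h6 := pow_le_pow_left₀ (by positivity) (h3.trans h5) 2
    change _ ≤ 11 / 10 * ‖L (E1 (X j))‖ ^ 2
    nlinarith [sq_nonneg ‖Dt j‖]
  have hlow : ∀ V, n * (√(Λ - Δ)) ^ 2 * ‖V‖ ^ 2 ≤ ∑ j, inner ℝ (X j) V ^ 2 := fun V => by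
    rw [Real.sq_sqrt (by linarith)]
    exact (sum_inner_sq_bounds hn X V).1
  have hc : 0 < √(Λ - Δ) := Real.sqrt_pos.2 (by linarith)
  obtain ⟨Ft, hFt⟩ := exists_normalEq (c := n * (√(Λ - Δ)) ^ 2) (by positivity) hlow
    (fun j => -Dt j)
  refine ⟨w, Ft, Dt, hw, hDt, hDo, hFt, ?_⟩
  have hFtn : euNorm Ft ≤ 2 * l * e := by
    have h1 : euNorm Ft ≤ (√(Λ - Δ) * (2 * l * e)) / √(Λ - Δ) := by
      refine hFt.euNorm_le hn hc hlow (by positivity) ?_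
      simp only [norm_neg]
      calc ∑ j, ‖Dt j‖ ^ 2 ≤ ∑ j, 11 / 10 * ‖(L ∘L E1) (X j)‖ ^ 2 :=
            Finset.sum_le_sum fun j _ => hDb j
        _ = 11 / 10 * ∑ j, ‖(L ∘L E1) (X j)‖ ^ 2 := by rw [Finset.mul_sum]
        _ ≤ 11 / 10 * (n * (Λ + Δ) * (l * e) ^ 2) := by
            gcongr
            refine (frame_upper (fun V => (sum_inner_sq_bounds hn X V).2) (L ∘L E1)).trans ?_
            gcongr
        _ ≤ n * ((Λ - Δ) * (2 * l * e) ^ 2) := by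
            have : 0 ≤ n * (l * e) ^ 2 := by positivity
            nlinarith
        _ = _ := by
            rw [mul_pow (√(n : ℝ)), mul_pow (√(Λ - Δ)), Real.sq_sqrt (Nat.cast_nonneg n),
              Real.sq_sqrt (by linarith)]
    rwa [mul_div_cancel_left₀ _ hc.ne'] at h1
  set f := (tangentRankPreservers q)ᗮ.starProjection (opVec q Ft) with hf
  have hfm : f ∈ (tangentRankPreservers q)ᗮ := Submodule.starProjection_apply_mem _ _
  set H := (opVec q).symm f with hH
  have hHf : opVec q H = f := (opVec q).apply_symm_apply f
  have hHn : euNorm H = ‖f‖ := by rw [euNorm, hHf]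
  have hff : ‖f‖ ^ 2 = inner ℝ f (opVec q Ft) := by
    rw [← real_inner_self_eq_norm_sq]
    nth_rewrite 2 [hf]
    rw [← Submodule.inner_starProjection_left_eq_right, Submodule.starProjection_eq_self_iff.2 hfm]
  set R : MatOp q := ContinuousLinearMap.id ℝ (MatSp q) - Λ⁻¹ • covariance X with hR
  have hRn : ‖R‖ ≤ Δ / Λ := by
    refine ContinuousLinearMap.opNorm_le_bound _ (by positivity) fun V => ?_
    have h1 : R V = -(Λ⁻¹ • (covariance X V - Λ • V)) := by
      rw [hR, smul_sub, smul_smul, inv_mul_cancel₀ hΛ.ne']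
      simp
    rw [h1, norm_neg, norm_smul, Real.norm_eq_abs, abs_of_pos (by positivity)]
    calc _ ≤ Λ⁻¹ * (Δ * ‖V‖) := by gcongr; exact covariance_sub_le X V
      _ = _ := by ring
  have hsplit : Ft = -((Λ⁻¹ * (n : ℝ)⁻¹) • ∑ j, boxTimes (Dt j) (X j)) + Ft ∘L R := by
    ext1 V
    have h1 := hFt V
    simp only [smul_sub, smul_neg, Finset.sum_sub_distrib, Finset.sum_neg_distrib] at h1
    have h2 : Ft (covariance X V) = -((n : ℝ)⁻¹ • ∑ j, inner ℝ (X j) V • Dt j) := by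
      rw [covariance_apply, map_smul, map_sum]
      simp only [map_smul]
      rw [← smul_neg, ← sub_eq_zero, ← smul_sub, ← neg_eq_zero, ← smul_neg, neg_sub, h1, smul_zero]
    have h3 : R V = V - Λ⁻¹ • covariance X V := by simp [hR]
    have h4 : (∑ j, boxTimes (Dt j) (X j)) V = ∑ j, inner ℝ (X j) V • Dt j := by
      rw [sum_apply]; rfl
    rw [add_apply, neg_apply, smul_apply, h4, ContinuousLinearMap.comp_apply, h3, map_sub,
      map_smul, h2, mul_smul]
    simp
  have hA : inner ℝ f (opVec q (-((Λ⁻¹ * (n : ℝ)⁻¹) • ∑ j, boxTimes (Dt j) (X j)))) ≤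
      2 * l ^ 2 * (bigOmega X / Λ) * e * ‖f‖ := by
    have hΩ := bigOmega_nonneg X
    have h0 : |∑ j, inner ℝ ((tangentSpace (X j)).starProjection (H (X j))) (Dt j)| ≤
        √(n * bigOmega X) * ‖f‖ * (11 / 10 * (√(n * bigOmega X) * (l * (l * e)))) := by
      refine sum_inner_le _ _ _ _ (by positivity) (by positivity) ?_ ?_
      · rw [mul_pow, Real.sq_sqrt (by positivity), ← hHn]
        exact sum_tangent_le hn X (hHf.symm ▸ hfm)
      · calc ∑ j, ‖Dt j‖ ^ 2 ≤
              ∑ j, (11 / 10) ^ 2 * ‖(tangentSpace (X j)).starProjection (H1 (X j))‖ ^ 2 :=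
              Finset.sum_le_sum fun j _ => by
                rw [← mul_pow]
                exact pow_le_pow_left₀ (norm_nonneg _) (hDa j) 2
          _ = (11 / 10) ^ 2 * ∑ j, ‖(tangentSpace (X j)).starProjection (H1 (X j))‖ ^ 2 := by
              rw [Finset.mul_sum]
          _ ≤ (11 / 10) ^ 2 * (n * bigOmega X * (l * (l * e)) ^ 2) := by
              gcongr
              refine (sum_tangent_le hn X horth).trans ?_
              gcongr
              exact euNorm_nonneg _
          _ = _ := by
              rw [mul_pow (11 / 10), mul_pow (√_), Real.sq_sqrt (by positivity)]
    have h1 : inner ℝ f (opVec q (-((Λ⁻¹ * (n : ℝ)⁻¹) • ∑ j, boxTimes (Dt j) (X j)))) =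
        -(Λ⁻¹ * (n : ℝ)⁻¹ *
          ∑ j, inner ℝ ((tangentSpace (X j)).starProjection (H (X j))) (Dt j)) := by
      rw [map_neg, map_smul, map_sum, inner_neg_right, inner_smul_right, inner_sum, ← hHf]
      congr 2
      refine Finset.sum_congr rfl fun j _ => ?_
      rw [inner_opVec_boxTimes, Submodule.inner_starProjection_left_eq_right,
        Submodule.starProjection_eq_self_iff.2 (hDt j)]
    rw [h1, ← mul_neg]
    calc _ ≤ Λ⁻¹ * (n : ℝ)⁻¹ * (√(n * bigOmega X) * ‖f‖ *
          (11 / 10 * (√(n * bigOmega X) * (l * (l * e))))) := by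
          gcongr
          exact (neg_le_abs _).trans h0
      _ = Λ⁻¹ * (n : ℝ)⁻¹ * (√(n * bigOmega X) ^ 2) * (11 / 10 * (l * (l * e))) * ‖f‖ := by ring
      _ = 11 / 10 * (l ^ 2 * (bigOmega X / Λ) * e * ‖f‖) := by
          rw [Real.sq_sqrt (by positivity)]
          field_simp
      _ ≤ 2 * (l ^ 2 * (bigOmega X / Λ) * e * ‖f‖) := by
          gcongr
          norm_num
      _ = _ := by ring
  have hB : inner ℝ f (opVec q (Ft ∘L R)) ≤ 2 * l * (Δ / Λ) * e * ‖f‖ := by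
    refine (real_inner_le_norm _ _).trans ?_
    have h1 : ‖opVec q (Ft ∘L R)‖ ≤ 2 * l * e * (Δ / Λ) :=
      (euNorm_comp_le' Ft R).trans (by gcongr)
    calc _ ≤ ‖f‖ * (2 * l * e * (Δ / Λ)) := by gcongr
      _ = _ := by ring
  have hfin : ‖f‖ ^ 2 ≤ ((2 * l ^ 2 * (bigOmega X / Λ) + 2 * l * (Δ / Λ)) * e) * ‖f‖ := by
    rw [hff, hsplit, map_add, inner_add_right]
    linarith
  rcases eq_or_lt_of_le (norm_nonneg f) with h | h
  · rw [← h]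
    have := bigOmega_nonneg X
    positivity
  · rw [pow_two] at hfin
    exact le_of_mul_le_mul_right hfin h

end

section
open scoped Matrix.Norms.L2Operator

/-! ### Two-sided multiplications -/

theorem mat_twoSided {q : ℕ} (A B : Matrix (Fin q) (Fin q) ℝ) (Z : MatSp q) :
    mat (twoSided A B Z) = A * mat Z + mat Z * B := rfl

/-- The operator `Z ↦ A Z B`. -/
noncomputable def sandwich {q : ℕ} (A B : Matrix (Fin q) (Fin q) ℝ) : MatOp q :=
  twoSided A 0 ∘L twoSided 0 B

theorem mat_sandwich {q : ℕ} (A B : Matrix (Fin q) (Fin q) ℝ) (Z : MatSp q) :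
    mat (sandwich A B Z) = A * mat Z * B := by
  rw [sandwich, ContinuousLinearMap.comp_apply, mat_twoSided, mat_twoSided]
  simp [Matrix.mul_assoc]

theorem norm_sandwich_le {q : ℕ} (A B : Matrix (Fin q) (Fin q) ℝ) :
    ‖sandwich A B‖ ≤ ‖A‖ * ‖B‖ := by
  refine ContinuousLinearMap.opNorm_le_bound _ (by positivity) fun Z => ?_
  rw [← ofMat_mat (sandwich A B Z), mat_sandwich]
  calc _ ≤ ‖A‖ * ‖ofMat (mat Z)‖ * ‖B‖ := norm_ofMat_mul_mul_le _ _ _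
    _ = _ := by rw [ofMat_mat]; ring

theorem twoSided_single {q : ℕ} (A B : Matrix (Fin q) (Fin q) ℝ) (c d i j : Fin q) :
    twoSided A B (EuclideanSpace.single (c, d) 1) (i, j) =
      (if d = j then A i c else 0) + if i = c then B d j else 0 := by
  change (A * mat (EuclideanSpace.single (c, d) 1) + mat (EuclideanSpace.single (c, d) 1) * B) i j
    = _
  rw [Matrix.add_apply, Matrix.mul_apply, Matrix.mul_apply]
  simp only [mat_apply, PiLp.single_apply, Prod.mk.injEq]
  congr 1
  · rw [Finset.sum_eq_single c]
    · simp [eq_comm]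
    · intro k _ hk; simp [hk]
    · simp
  · rw [Finset.sum_eq_single d]
    · simp
    · intro k _ hk; simp [hk]
    · simp

theorem euNorm_twoSided_sq {q : ℕ} (A B : Matrix (Fin q) (Fin q) ℝ) :
    euNorm (twoSided A B) ^ 2 = q * ‖ofMat A‖ ^ 2 + q * ‖ofMat B‖ ^ 2 +
      2 * (A.trace * B.trace) := by
  have h1 : euNorm (twoSided A B) ^ 2 = ∑ c, ∑ d, ∑ i, ∑ j,
      ((if d = j then A i c ^ 2 else 0) + (if i = c then B d j ^ 2 else 0) +
        2 * (if d = j then (if i = c then A i c * B d j else 0) else 0)) := by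
    rw [euNorm_sq, Fintype.sum_prod_type]
    refine Finset.sum_congr rfl fun c _ => Finset.sum_congr rfl fun d _ => ?_
    rw [EuclideanSpace.norm_sq_eq, Fintype.sum_prod_type]
    refine Finset.sum_congr rfl fun i _ => Finset.sum_congr rfl fun j _ => ?_
    rw [twoSided_single, Real.norm_eq_abs, sq_abs]
    split_ifs <;> ring
  rw [h1, norm_sq_eq_sum_entries, norm_sq_eq_sum_entries]
  simp only [Finset.sum_add_distrib, ← Finset.mul_sum, Finset.sum_ite_eq, Finset.mem_univ, if_true,
    mat_ofMat]
  congr 1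
  · congr 1
    · simp only [Finset.sum_const, Finset.card_univ, Fintype.card_fin, nsmul_eq_mul]
      rw [← Finset.mul_sum, Finset.sum_comm]
    · have : ∀ c d : Fin q, ∑ i, ∑ j, (if i = c then B d j ^ 2 else 0) = ∑ j, B d j ^ 2 := by
        intro c d
        rw [Finset.sum_eq_single c]
        · simp
        · intro i _ hi; simp [hi]
        · simp
      simp only [this, Finset.sum_const, Finset.card_univ, Fintype.card_fin, nsmul_eq_mul]
  · congr 1
    rw [Matrix.trace, Matrix.trace, Finset.sum_mul_sum]
    refine Finset.sum_congr rfl fun c _ => Finset.sum_congr rfl fun d _ => ?_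
    simp

theorem mem_tangentRankPreservers {q : ℕ} {F : OpSp q} :
    F ∈ tangentRankPreservers q ↔
      ∃ A B : Matrix (Fin q) (Fin q) ℝ, F = opVec q (twoSided A B) := by
  constructor
  · intro h
    induction h using Submodule.span_induction with
    | mem F h => exact h
    | zero =>
      refine ⟨0, 0, ?_⟩
      rw [eq_comm, LinearEquiv.map_eq_zero_iff]
      ext1 Z
      apply mat_injective
      rw [mat_twoSided]
      simp [mat_zero]
    | add F G _ _ hF hG =>
      obtain ⟨A, B, rfl⟩ := hF
      obtain ⟨A', B', rfl⟩ := hG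
      refine ⟨A + A', B + B', ?_⟩
      rw [← map_add]
      congr 1
      ext1 Z
      apply mat_injective
      rw [add_apply, mat_add, mat_twoSided, mat_twoSided, mat_twoSided, Matrix.add_mul,
        Matrix.mul_add]
      abel
    | smul c F _ hF =>
      obtain ⟨A, B, rfl⟩ := hF
      refine ⟨c • A, c • B, ?_⟩
      rw [← map_smul]
      congr 1
      ext1 Z
      apply mat_injective
      rw [smul_apply, mat_smul, mat_twoSided, mat_twoSided, Matrix.smul_mul, Matrix.mul_smul,
        smul_add]
  · rintro ⟨A, B, rfl⟩
    exact Submodule.subset_span ⟨A, B, rfl⟩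

theorem exists_traceless {q : ℕ} (hq : 0 < q) (A B : Matrix (Fin q) (Fin q) ℝ) :
    ∃ A' B' : Matrix (Fin q) (Fin q) ℝ, twoSided A B = twoSided A' B' ∧ B'.trace = 0 := by
  refine ⟨A + (B.trace / q) • (1 : Matrix (Fin q) (Fin q) ℝ),
    B - (B.trace / q) • (1 : Matrix (Fin q) (Fin q) ℝ), ?_, ?_⟩
  · ext1 Z
    apply mat_injective
    rw [mat_twoSided, mat_twoSided, Matrix.add_mul, Matrix.mul_sub]
    simp
  · have : (q : ℝ) ≠ 0 := by positivity
    rw [Matrix.trace_sub, Matrix.trace_smul, Matrix.trace_one, Fintype.card_fin, smul_eq_mul,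
      div_mul_cancel₀ _ this, sub_self]

theorem isRankPreserver_sandwich {q : ℕ} {A B A' B' : Matrix (Fin q) (Fin q) ℝ}
    (hA : A' * A = 1) (hB : B * B' = 1) : IsRankPreserver (sandwich A B) := by
  intro X
  rw [mat_sandwich]
  apply le_antisymm
  · exact (Matrix.rank_mul_le_left _ _).trans (Matrix.rank_mul_le_right _ _)
  · have : mat X = A' * (A * mat X * B) * B' := by
      calc mat X = (A' * A) * mat X * (B * B') := by rw [hA, hB, Matrix.one_mul, Matrix.mul_one]
        _ = _ := by simp only [Matrix.mul_assoc]
    conv_lhs => rw [this]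
    exact (Matrix.rank_mul_le_left _ _).trans (Matrix.rank_mul_le_right _ _)

theorem IsRankPreserver.comp {q : ℕ} {M N : MatOp q} (hM : IsRankPreserver M)
    (hN : IsRankPreserver N) : IsRankPreserver (M ∘L N) := fun X => by
  rw [ContinuousLinearMap.comp_apply, hM, hN]

theorem isRankPreserver_id {q : ℕ} : IsRankPreserver (ContinuousLinearMap.id ℝ (MatSp q)) :=
  fun _ => rfl

/-- An operator near the identity factors through a rank-preserver, and the remaining factor is
controlled by the component orthogonal to the tangent space of the rank-preservers. -/
theorem exists_factorization {q : ℕ} (hq : 0 < q) (F : MatOp q) {h : ℝ} (hF : euNorm F ≤ h)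
    (hh : h ≤ 1 / 10) :
    ∃ E' N : MatOp q, IsRankPreserver N ∧
      ContinuousLinearMap.id ℝ (MatSp q) + F = (ContinuousLinearMap.id ℝ (MatSp q) + E') ∘L N ∧
      euNorm E' ≤ (‖(tangentRankPreservers q)ᗮ.starProjection (opVec q F)‖ + h ^ 2) *
        (1 + 5 * h) := by
  have hh0 : 0 ≤ h := (euNorm_nonneg F).trans hF
  set W := tangentRankPreservers q
  obtain ⟨A₀, B₀, hAB₀⟩ := mem_tangentRankPreservers.1
    (Submodule.starProjection_apply_mem W (opVec q F))
  obtain ⟨A, B, hAB, htr⟩ := exists_traceless hq A₀ B₀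
  rw [hAB] at hAB₀
  have hwn : euNorm (twoSided A B) ≤ h := by
    rw [euNorm, ← hAB₀]
    exact (W.norm_starProjection_apply_le _).trans hF
  have hq1 : (1 : ℝ) ≤ q := by exact_mod_cast hq
  have hsq := pow_le_pow_left₀ (euNorm_nonneg _) hwn 2
  rw [euNorm_twoSided_sq, htr, mul_zero, mul_zero, add_zero] at hsq
  have hqA : q * ‖ofMat A‖ ^ 2 ≤ h ^ 2 := by nlinarith [sq_nonneg ‖ofMat B‖]
  have hA : ‖A‖ ≤ h := by
    refine (l2norm_le_frobenius A).trans ?_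
    rw [← sq_le_sq₀ (norm_nonneg _) hh0]
    nlinarith [sq_nonneg ‖ofMat A‖]
  have hB : ‖B‖ ≤ h := by
    refine (l2norm_le_frobenius B).trans ?_
    rw [← sq_le_sq₀ (norm_nonneg _) hh0]
    nlinarith [sq_nonneg ‖ofMat A‖, sq_nonneg ‖ofMat B‖]
  obtain ⟨GA, hGA1, hGA2, hGA3⟩ := exists_inverse_one_add A h (by linarith) hA
  obtain ⟨GB, hGB1, hGB2, hGB3⟩ := exists_inverse_one_add B h (by linarith) hB
  set N := sandwich (1 + A) (1 + B) with hN
  set N' := sandwich GA GB with hN'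
  have hNN' : N ∘L N' = ContinuousLinearMap.id ℝ (MatSp q) := by
    ext1 Z
    apply mat_injective
    rw [ContinuousLinearMap.comp_apply, mat_sandwich, mat_sandwich]
    calc _ = ((1 + A) * GA) * mat Z * (GB * (1 + B)) := by simp only [Matrix.mul_assoc]
      _ = mat Z := by rw [hGA2, hGB1, Matrix.one_mul, Matrix.mul_one]
  have hN'N : N' ∘L N = ContinuousLinearMap.id ℝ (MatSp q) := by
    ext1 Z
    apply mat_injective
    rw [ContinuousLinearMap.comp_apply, mat_sandwich, mat_sandwich]
    calc _ = (GA * (1 + A)) * mat Z * ((1 + B) * GB) := by simp only [Matrix.mul_assoc]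
      _ = mat Z := by rw [hGA1, hGB2, Matrix.one_mul, Matrix.mul_one]
  have hNexp : N = ContinuousLinearMap.id ℝ (MatSp q) + twoSided A B + sandwich A B := by
    ext1 Z
    apply mat_injective
    rw [hN, mat_sandwich, add_apply, add_apply, mat_add, mat_add, mat_twoSided, mat_sandwich]
    simp only [Matrix.add_mul, Matrix.mul_add, Matrix.one_mul, Matrix.mul_one,
      ContinuousLinearMap.id_apply]
    abel
  set P := F - twoSided A B - sandwich A B with hP
  refine ⟨P ∘L N', N, isRankPreserver_sandwich hGA1 hGB2, ?_, ?_⟩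
  · rw [ContinuousLinearMap.add_comp, ContinuousLinearMap.comp_assoc, hN'N,
      ContinuousLinearMap.id_comp, ContinuousLinearMap.comp_id, hNexp, hP]
    abel
  · have h1 : euNorm (F - twoSided A B) = ‖Wᗮ.starProjection (opVec q F)‖ := by
      rw [euNorm, map_sub, ← hAB₀, Submodule.starProjection_orthogonal_val]
    have h2 : euNorm (sandwich A B) ≤ h ^ 2 := by
      have h3 : euNorm (twoSided A 0) ≤ h := by
        rw [← sq_le_sq₀ (euNorm_nonneg _) hh0, euNorm_twoSided_sq]
        have : ofMat (0 : Matrix (Fin q) (Fin q) ℝ) = 0 := rfl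
        simpa [this] using hqA
      have h4 : ‖twoSided 0 B‖ ≤ h := by
        refine ContinuousLinearMap.opNorm_le_bound _ hh0 fun Z => ?_
        rw [← ofMat_mat (twoSided 0 B Z), mat_twoSided, Matrix.zero_mul, zero_add, mul_comm]
        refine (norm_ofMat_mul_le' _ _).trans ?_
        rw [ofMat_mat]
        gcongr
      calc _ ≤ euNorm (twoSided A 0) * ‖twoSided 0 B‖ := euNorm_comp_le' _ _
        _ ≤ h * h := by gcongr
        _ = _ := by ring
    have h5 : euNorm P ≤ ‖Wᗮ.starProjection (opVec q F)‖ + h ^ 2 := by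
      rw [hP, sub_eq_add_neg]
      refine (euNorm_add_le _ _).trans ?_
      rw [h1]
      have : euNorm (-sandwich A B) = euNorm (sandwich A B) := by
        rw [euNorm, map_neg, norm_neg]; rfl
      rw [this]
      gcongr
    have h6 : ‖N'‖ ≤ 1 + 5 * h := by
      have hg : ∀ G : Matrix (Fin q) (Fin q) ℝ, ‖G‖ * (1 - h) ≤ 1 → ‖G‖ ≤ 1 + 2 * h := by
        intro G hG
        by_contra hlt
        have := mul_lt_mul_of_pos_right (not_le.1 hlt) (show 0 < 1 - h by linarith)
        nlinarith
      calc ‖N'‖ ≤ ‖GA‖ * ‖GB‖ := norm_sandwich_le _ _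
        _ ≤ (1 + 2 * h) * (1 + 2 * h) := by
            gcongr
            · exact hg GA hGA3
            · exact hg GB hGB3
        _ ≤ _ := by nlinarith
    exact (euNorm_comp_le' P N').trans (by gcongr)

/-! ### Rank-preservers are invertible -/

theorem eq_zero_of_rank_eq_zero {q : ℕ} {A : Matrix (Fin q) (Fin q) ℝ} (h : A.rank = 0) :
    A = 0 := by
  have h1 : A.mulVecLin = 0 := LinearMap.range_eq_bot.1 (Submodule.finrank_eq_zero.1 h)
  ext i j
  have h2 : A.mulVec (Pi.single j 1) = 0 := congrArg (fun T => T (Pi.single j 1)) h1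
  have h3 := congrFun h2 i
  simpa using h3

theorem IsRankPreserver.exists_inverse {q : ℕ} {M : MatOp q} (hM : IsRankPreserver M) :
    ∃ M' : MatOp q, IsRankPreserver M' ∧ M ∘L M' = ContinuousLinearMap.id ℝ (MatSp q) ∧
      M' ∘L M = ContinuousLinearMap.id ℝ (MatSp q) := by
  have hinj : Function.Injective (M : MatSp q →ₗ[ℝ] MatSp q) := by
    rw [← LinearMap.ker_eq_bot, LinearMap.ker_eq_bot']
    intro X hX
    have h1 := hM X
    have h2 : M X = 0 := hX
    rw [h2, mat_zero, Matrix.rank_zero] at h1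
    apply mat_injective
    rw [mat_zero]
    exact eq_zero_of_rank_eq_zero h1.symm
  let e := LinearEquiv.ofInjectiveEndo (M : MatSp q →ₗ[ℝ] MatSp q) hinj
  have h1 : ∀ X, M (e.symm X) = X := fun X => e.apply_symm_apply X
  have h2 : ∀ X, e.symm (M X) = X := fun X => e.symm_apply_apply X
  refine ⟨LinearMap.toContinuousLinearMap (e.symm : MatSp q →ₗ[ℝ] MatSp q), ?_, ?_, ?_⟩
  · intro X
    rw [← hM]
    exact congrArg (fun Y => (mat Y).rank) (h1 X)
  · ext1 X
    exact h1 X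
  · ext1 X
    exact h2 X

theorem SolvesRankProblem.comp {q d r : ℕ} {K : MatMap q d} {M : MatOp q} {X : MatSp q}
    {y : EuclideanSpace ℝ (Fin d)} (hM : IsRankPreserver M)
    (h : SolvesRankProblem r (K ∘L M) y X) : SolvesRankProblem r K y (M X) := by
  obtain ⟨M', hM', h1, h2⟩ := hM.exists_inverse
  refine ⟨(hM X).trans_le h.1, fun Y hY => ?_⟩
  have h3 := h.2 (M' Y) ((hM' Y).trans_le hY)
  have h4 : M (M' Y) = Y := congrArg (fun T : MatOp q => T Y) h1
  rwa [ContinuousLinearMap.comp_apply, ContinuousLinearMap.comp_apply, h4] at h3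

end

section

/-! ### One step of the algorithm -/

/-- The properties of the true map and of the true matrices on which the analysis depends. -/
structure GoodData {q d n : ℕ} (r : ℕ) (L : MatMap q d) (X : Fin n → MatSp q) (s : ℝ) :
    Prop where
  n_pos : 0 < n
  r_pos : 0 < r
  q_ge : 2 ≤ q
  s_pos : 0 < s
  rank_eq : ∀ j, (mat (X j)).rank = r
  pinv : ∀ j, ∃ J, IsPinv (X j) J (2 / s)
  norm_le : ∀ j, ‖X j‖ ≤ s * √(r : ℝ)
  bound : RankBound L (4 * r) (974 / 1000) (1025 / 1000)
  norm_ge : 97 / 100 ≤ ‖L‖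
  lambda_pos : 0 < bigLambda X
  delta_nonneg : 0 ≤ bigDelta X
  delta_le : bigDelta X ≤ bigLambda X / 100
  frame : ∀ V, n * (49 / 100 * (s * √(r : ℝ)) / q) ^ 2 * ‖V‖ ^ 2 ≤ ∑ j, inner ℝ (X j) V ^ 2

theorem frame_comp {q n : ℕ} {X : Fin n → MatSp q} {c : ℝ} (hc : 0 < c)
    {M M' : MatOp q} (hM : M' ∘L M = ContinuousLinearMap.id ℝ (MatSp q))
    (h : ∀ V, c * ‖V‖ ^ 2 ≤ ∑ j, inner ℝ (M (X j)) V ^ 2) :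
    ∃ c' > 0, ∀ V, c' * ‖V‖ ^ 2 ≤ ∑ j, inner ℝ (X j) V ^ 2 := by
  refine ⟨c / (‖M‖ ^ 2 + 1), by positivity, fun V => ?_⟩
  set V' := ContinuousLinearMap.adjoint M' V with hV'
  have h1 : ContinuousLinearMap.adjoint M V' = V := by
    rw [hV', ← ContinuousLinearMap.comp_apply, ← ContinuousLinearMap.adjoint_comp, hM,
      ContinuousLinearMap.adjoint_id, ContinuousLinearMap.id_apply]
  have h2 : ‖V‖ ≤ ‖M‖ * ‖V'‖ := by
    conv_lhs => rw [← h1]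
    refine (ContinuousLinearMap.le_opNorm _ _).trans ?_
    rw [LinearIsometryEquiv.norm_map]
  have h3 : ∑ j, inner ℝ (X j) V ^ 2 = ∑ j, inner ℝ (M (X j)) V' ^ 2 := by
    refine Finset.sum_congr rfl fun j _ => ?_
    rw [← ContinuousLinearMap.adjoint_inner_right, h1]
  rw [h3]
  refine le_trans ?_ (h V')
  rw [div_mul_eq_mul_div, div_le_iff₀ (by positivity), mul_assoc]
  gcongr
  have h4 := pow_le_pow_left₀ (norm_nonneg _) h2 2
  nlinarith [sq_nonneg ‖V'‖]

theorem NormalEq.lift {q d n : ℕ} {L : MatMap q d} {X Xh : Fin n → MatSp q} {M M' F : MatOp q}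
    (hM : M' ∘L M = ContinuousLinearMap.id ℝ (MatSp q))
    (h : NormalEq (fun j => -(M (Xh j) - X j)) (fun j => M (Xh j)) F) :
    NormalEq (fun j => L (X j)) Xh (L ∘L (ContinuousLinearMap.id ℝ (MatSp q) + F) ∘L M) := by
  intro V
  have h1 := congrArg L (h (ContinuousLinearMap.adjoint M' V))
  rw [map_sum, map_zero] at h1
  rw [← h1]
  refine Finset.sum_congr rfl fun j _ => ?_
  have h2 : M' (M (Xh j)) = Xh j := congrArg (fun T : MatOp q => T (Xh j)) hM
  rw [ContinuousLinearMap.adjoint_inner_right, h2, map_smul]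
  congr 1
  simp only [ContinuousLinearMap.comp_apply, add_apply, ContinuousLinearMap.id_apply, map_add,
    map_sub, map_neg]
  abel

/-- The outcome of the least-squares step. -/
structure UpdateResult {q d n : ℕ} (r : ℕ) (L : MatMap q d) (X : Fin n → MatSp q) (E M : MatOp q)
    (Xh : Fin n → MatSp q) (Fh : MatOp q) : Prop where
  isLeastSquares : IsLeastSquares (fun j => L (X j)) Xh
    (L ∘L (ContinuousLinearMap.id ℝ (MatSp q) + Fh) ∘L M)
  unique : ∀ K, IsLeastSquares (fun j => L (X j)) Xh K →
    K = L ∘L (ContinuousLinearMap.id ℝ (MatSp q) + Fh) ∘L M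
  euNorm_le : euNorm Fh ≤ 5 * q * (‖L‖ * euNorm E)
  factor : ∃ E' N : MatOp q, IsRankPreserver N ∧ ContinuousLinearMap.id ℝ (MatSp q) + Fh =
    (ContinuousLinearMap.id ℝ (MatSp q) + E') ∘L N ∧
    euNorm E' ≤ (2 * ‖L‖ ^ 2 * (bigOmega X / bigLambda X) +
      2 * ‖L‖ * (bigDelta X / bigLambda X)) * euNorm E +
      150 * r * q ^ 2 * (‖L‖ * euNorm E) ^ 2

theorem step_arith1 {a x r q c η δ τ s : ℝ} (hs : 0 < s) (hr : 1 ≤ r) (hq : 2 ≤ q)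
    (hx : x = s * √r) (hc : c = 49 / 100 * x / q) (hη : η = 21 / 10 * (a * x))
    (hδ : δ = 104 / 100 * (a * x)) (hτ : τ = 30 * (2 / s) * (a * x) ^ 2) :
    (τ + 22 / 10 * (δ * η / c)) / (9 / 10 * c) ≤ 91 * r * q ^ 2 * a ^ 2 := by
  have hsr : √r ≤ r := by
    rw [Real.sqrt_le_left (by linarith)]
    nlinarith
  have hr0 : 0 < √r := Real.sqrt_pos.2 (by linarith)
  have hx0 : 0 < x := by rw [hx]; positivity
  have e1 : τ = 60 * √r * (a ^ 2 * x) := by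
    rw [hτ, hx]
    field_simp
    ring
  have e2 : δ * η / c = 104 / 100 * (21 / 10) * (100 / 49) * q * (a ^ 2 * x) := by
    rw [hδ, hη, hc]
    field_simp
  rw [e1, e2, hc]
  have e3 : (60 * √r * (a ^ 2 * x) +
      22 / 10 * (104 / 100 * (21 / 10) * (100 / 49) * q * (a ^ 2 * x))) /
      (9 / 10 * (49 / 100 * x / q)) = (1000 / 441) * q * a ^ 2 *
        (60 * √r + 22 / 10 * (104 / 100 * (21 / 10) * (100 / 49) * q)) := by
    field_simp
    ring
  rw [e3]
  have h1 : (1000 / 441) * (60 * √r + 22 / 10 * (104 / 100 * (21 / 10) * (100 / 49) * q)) ≤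
      91 * (r * q) := by nlinarith
  calc _ = q * a ^ 2 *
        ((1000 / 441) * (60 * √r + 22 / 10 * (104 / 100 * (21 / 10) * (100 / 49) * q))) := by ring
    _ ≤ q * a ^ 2 * (91 * (r * q)) := by gcongr
    _ = _ := by ring

theorem step_arith2 {g e l r q p a h y : ℝ} (hr : 1 ≤ r) (hq : 2 ≤ q) (he : 0 ≤ e)
    (hl : 97 / 100 ≤ l) (ha : a = l * e) (hsmall : q * a ≤ 1 / 1000) (hg : g ≤ 1)
    (hh : h = 5 * q * a) (hp : p ≤ g * e + 91 * r * q ^ 2 * a ^ 2)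
    (hy : y ≤ (p + h ^ 2) * (1 + 5 * h)) : y ≤ g * e + 150 * r * q ^ 2 * a ^ 2 := by
  have ha0 : 0 ≤ a := by rw [ha]; positivity
  have hqa : 0 ≤ q * a := by positivity
  have h1 : p + h ^ 2 ≤ g * e + 116 * (r * (q * a) ^ 2) := by
    rw [hh]
    have : (q * a) ^ 2 ≤ r * (q * a) ^ 2 := le_mul_of_one_le_left (sq_nonneg _) hr
    nlinarith
  have h2 : y ≤ (g * e + 116 * (r * (q * a) ^ 2)) * (1 + 5 * h) :=
    hy.trans (by
      gcongr
      rw [hh]; positivity)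
  have h3 : g * e * (5 * h) ≤ 13 * (r * (q * a) ^ 2) := by
    have e1 : g * e ≤ e := by nlinarith
    have e2 : e ≤ 100 / 97 * a := by rw [ha]; nlinarith
    calc g * e * (5 * h) ≤ 100 / 97 * a * (5 * h) :=
          mul_le_mul_of_nonneg_right (e1.trans e2) (by rw [hh]; positivity)
      _ = 2500 / 97 * (1 * (q * a ^ 2)) := by rw [hh]; ring
      _ ≤ 2500 / 97 * (q / 2 * (q * a ^ 2)) := by gcongr; linarith
      _ = 1250 / 97 * (1 * (q * a) ^ 2) := by ring
      _ ≤ 13 * (r * (q * a) ^ 2) := by gcongr; norm_num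
  have h4 : 116 * (r * (q * a) ^ 2) * (5 * h) ≤ 116 * (r * (q * a) ^ 2) * (1 / 40) := by
    gcongr
    rw [hh]; linarith
  have h5 : 0 ≤ r * (q * a) ^ 2 := by positivity
  nlinarith

theorem GoodData.near {q d n r : ℕ} {L : MatMap q d} {X : Fin n → MatSp q} {s : ℝ}
    (G : GoodData r L X s) {E : MatOp q} (hE : q * (‖L‖ * euNorm E) ≤ 1 / 1000) :
    RankBound L (4 * r) (97 / 100) (103 / 100) ∧
    RankBound (L ∘L (ContinuousLinearMap.id ℝ (MatSp q) + E)) (4 * r) (973 / 1000)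
      (1026 / 1000) := by
  have hq : (2 : ℝ) ≤ q := by exact_mod_cast G.q_ge
  have h0 : 0 ≤ ‖L‖ * euNorm E := mul_nonneg (norm_nonneg _) (euNorm_nonneg _)
  have h1 : ‖L‖ * euNorm E ≤ 1 / 1000 := by nlinarith
  exact ⟨G.bound.mono le_rfl (by norm_num) (by norm_num),
    (G.bound.perturb (norm_apply_le_euNorm E)).mono le_rfl (by linarith) (by linarith)⟩

set_option maxHeartbeats 1000000 in
theorem GoodData.exists_update {q d n r : ℕ} {L : MatMap q d} {X : Fin n → MatSp q} {s : ℝ}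
    (G : GoodData r L X s) {E M : MatOp q} (hM : IsRankPreserver M)
    (hE : q * (‖L‖ * euNorm E) ≤ 1 / 1000)
    (hγ : 2 * ‖L‖ ^ 2 * (bigOmega X / bigLambda X) +
      2 * ‖L‖ * (bigDelta X / bigLambda X) ≤ 1) {Xh : Fin n → MatSp q}
    (hXh : ∀ j, SolvesRankProblem r (L ∘L (ContinuousLinearMap.id ℝ (MatSp q) + E) ∘L M)
      (L (X j)) (Xh j)) : ∃ Fh, UpdateResult r L X E M Xh Fh := by
  obtain ⟨hL, hK'⟩ := G.near hE
  have hK := hK'.mono (le_refl (4 * r)) (show (97 / 100 : ℝ) ≤ _ by norm_num)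
    (show _ ≤ (103 / 100 : ℝ) by norm_num)
  obtain ⟨M', hM', hMM', hM'M⟩ := hM.exists_inverse
  have hq : (2 : ℝ) ≤ q := by exact_mod_cast G.q_ge
  have hr : (1 : ℝ) ≤ r := by exact_mod_cast G.r_pos
  have hs := G.s_pos
  have hn := G.n_pos
  have hn' : (0 : ℝ) < n := by exact_mod_cast hn
  set Y : Fin n → MatSp q := fun j => M (Xh j) with hYdef
  set e := euNorm E with he
  have he0 : 0 ≤ e := euNorm_nonneg _
  set l := ‖L‖ with hl
  set x := s * √(r : ℝ) with hx
  have hsr : 1 ≤ √(r : ℝ) := Real.one_le_sqrt.2 hr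
  have hx0 : 0 < x := by positivity
  set a := l * e with ha
  have ha0 : 0 ≤ a := mul_nonneg (norm_nonneg _) he0
  set c := 49 / 100 * x / q with hc
  have hc0 : 0 < c := by positivity
  have hYs : ∀ j, SolvesRankProblem r (L ∘L (ContinuousLinearMap.id ℝ (MatSp q) + E)) (L (X j))
      (Y j) := fun j => (hXh j).comp hM
  have hEb := norm_apply_le_euNorm E
  set η := 21 / 10 * (a * x) with hη
  have hYX : ∀ j, ‖Y j - X j‖ ≤ η := fun j =>
    ((hYs j).near hEb he0 hK (G.rank_eq j) (G.norm_le j)).2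
  have hη0 : 0 ≤ η := by positivity
  have hηc : η ≤ c / 10 := by
    rw [hη, hc, div_div, le_div_iff₀ (by positivity)]
    nlinarith
  have hYframe : ∀ V, n * (9 / 10 * c) ^ 2 * ‖V‖ ^ 2 ≤ ∑ j, inner ℝ (Y j) V ^ 2 := fun V => by
    refine le_trans ?_ (frame_perturb G.frame hYX hη0 (by linarith) V)
    gcongr
    linarith
  obtain ⟨Fh, hFh⟩ := exists_normalEq (c := n * (9 / 10 * c) ^ 2) (by positivity) hYframe
    (fun j => -(Y j - X j))
  have hlift : NormalEq (fun j => L (X j)) Xh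
    (L ∘L (ContinuousLinearMap.id ℝ (MatSp q) + Fh) ∘L M) := hFh.lift hM'M
  have hFhn : euNorm Fh ≤ 5 * q * a := by
    have h1 : euNorm Fh ≤ η / (9 / 10 * c) := hFh.euNorm_le hn (by positivity) hYframe hη0 (by
      simp only [norm_neg]
      exact sum_norm_sq_le (a := fun j => Y j - X j) hYX)
    refine h1.trans ?_
    rw [div_le_iff₀ (by positivity), hη, hc]
    have h2 : 5 * (q : ℝ) * a * (9 / 10 * (49 / 100 * x / q)) = 441 / 200 * (a * x) := by
      field_simp
      ring
    rw [h2]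
    have : 0 ≤ a * x := by positivity
    linarith
  refine ⟨Fh, hlift.isLeastSquares, fun K hKls => ?_, hFhn, ?_⟩
  · obtain ⟨c', hc', hframe⟩ := frame_comp (c := n * (9 / 10 * c) ^ 2) (by positivity) hM'M hYframe
    exact hKls.normalEq.unique hc' hframe hlift
  · obtain ⟨w, Ft, Dt, hw, hDt, hDo, hFt, hrate⟩ := exists_linearized_update hn E hL G.rank_eq
      G.lambda_pos G.delta_nonneg G.delta_le
    obtain ⟨A, B, hAB⟩ := mem_tangentRankPreservers.1 hw
    have hwAB : w = twoSided A B := (opVec q).injective hAB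
    set D : Fin n → MatSp q := fun j => Dt j + w (X j) with hD
    have hDm : ∀ j, D j ∈ tangentSpace (X j) := fun j =>
      Submodule.add_mem _ (hDt j) (mem_tangentSpace.2 ⟨B, A, by
        rw [hwAB, mat_twoSided, add_comm]⟩)
    have hDorth : ∀ j, ∀ Z ∈ tangentSpace (X j), inner ℝ (L (D j) + L (E (X j))) (L Z) = 0 := by
      intro j Z hZ
      rw [← hDo j Z hZ, hD, add_apply, map_add, map_add, add_right_comm, add_assoc]
    have hLE : ∀ j, ‖L (E (X j))‖ ≤ a * x := fun j =>
      calc _ ≤ l * ‖E (X j)‖ := L.le_opNorm _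
        _ ≤ l * (e * x) := by
            gcongr
            exact (hEb _).trans (by gcongr; exact G.norm_le j)
        _ = _ := by rw [ha]; ring
    have hDn : ∀ j, ‖D j‖ ≤ 104 / 100 * (a * x) := by
      intro j
      have h1 := hDorth j _ (hDm j)
      rw [inner_add_left, real_inner_self_eq_norm_sq] at h1
      have h2 := (neg_le_abs _).trans (abs_real_inner_le_norm (L (E (X j))) (L (D j)))
      have h3 : ‖L (D j)‖ ≤ a * x := by
        refine le_trans ?_ (hLE j)
        rcases eq_or_lt_of_le (norm_nonneg (L (D j))) with h | h
        · rw [← h]; positivity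
        · have h4 : ‖L (D j)‖ * ‖L (D j)‖ ≤ ‖L (E (X j))‖ * ‖L (D j)‖ := by
            rw [← pow_two]; linarith
          exact le_of_mul_le_mul_right h4 h
      have h5 := (G.bound (D j) ((rank_le_of_mem_tangentSpace (hDm j)).trans (by
        rw [G.rank_eq]; omega))).1
      have : 0 ≤ a * x := by positivity
      linarith
    set F := Ft - w with hF
    have hFeq : NormalEq (fun j => -D j) X F := by
      intro V
      rw [← hFt V]
      refine Finset.sum_congr rfl fun j _ => ?_
      congr 1
      rw [hF, sub_apply]
      simp only [hD]
      abel
    set τ := 30 * (2 / s) * (a * x) ^ 2 with hτ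
    have hρx : 1 ≤ 2 / s * x := by
      have : 2 / s * x = 2 * √(r : ℝ) := by rw [hx]; field_simp
      rw [this]; linarith
    have hτj : ∀ j, ‖Y j - X j - D j‖ ≤ τ := fun j => by
      obtain ⟨J, hJ⟩ := G.pinv j
      exact (hYs j).second_order hEb he0 hL hK (G.rank_eq j) (G.norm_le j) hJ.isGInv hρx (hDm j)
        (hDorth j)
    have hdiff : euNorm (Fh - F) ≤ 91 * r * q ^ 2 * a ^ 2 :=
      (normalEq_perturbation hn hc0 G.frame hη0 (by positivity) (by positivity) hYX hηc hDn hτj hFeq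
        hFh).trans (step_arith1 hs hr hq hx hc hη rfl hτ)
    obtain ⟨E', N, hN, hfac, hE'⟩ := exists_factorization (by linarith [G.q_ge]) Fh hFhn
      (by linarith)
    refine ⟨E', N, hN, hfac, ?_⟩
    have hγ0 : 0 ≤ 2 * l ^ 2 * (bigOmega X / bigLambda X) +
        2 * l * (bigDelta X / bigLambda X) := by
      have h1 := bigOmega_nonneg X
      have h2 := G.delta_nonneg
      have h3 := G.lambda_pos
      positivity
    refine step_arith2 hr hq he0 G.norm_ge ha hE hγ rfl ?_ hE'
    have h1 : opVec q Fh = opVec q Ft - opVec q w + opVec q (Fh - F) := by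
      rw [hF]; simp only [map_sub]; abel
    have h2 : (tangentRankPreservers q)ᗮ.starProjection (opVec q w) = 0 := by
      rw [Submodule.starProjection_orthogonal_val, Submodule.starProjection_eq_self_iff.2 hw,
        sub_self]
    rw [h1, map_add, map_sub, h2, sub_zero]
    refine (norm_add_le _ _).trans (add_le_add hrate ?_)
    exact ((tangentRankPreservers q)ᗮ.norm_starProjection_apply_le _).trans hdiff

end

section
open scoped Matrix.Norms.L2Operator

/-! ### Dyads, Gram matrices and transposition -/

/-- The rank-one matrix `x y'`. -/
noncomputable def dyad {q : ℕ} (x y : EuclideanSpace ℝ (Fin q)) : MatSp q :=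
  WithLp.toLp 2 fun p => x p.1 * y p.2

theorem dyad_apply {q : ℕ} (x y : EuclideanSpace ℝ (Fin q)) (p : Fin q × Fin q) :
    dyad x y p = x p.1 * y p.2 := rfl

theorem norm_sq_dyad {q : ℕ} (x y : EuclideanSpace ℝ (Fin q)) :
    ‖dyad x y‖ ^ 2 = ‖x‖ ^ 2 * ‖y‖ ^ 2 := by
  rw [norm_sq_eq_sum_entries, EuclideanSpace.norm_sq_eq, EuclideanSpace.norm_sq_eq,
    Finset.sum_mul_sum]
  refine Finset.sum_congr rfl fun a _ => Finset.sum_congr rfl fun b _ => ?_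
  rw [mat_apply, dyad_apply, mul_pow, Real.norm_eq_abs, Real.norm_eq_abs, sq_abs, sq_abs]

theorem mat_dyad {q : ℕ} (x y : EuclideanSpace ℝ (Fin q)) :
    mat (dyad x y) = Matrix.vecMulVec x.ofLp y.ofLp := rfl

theorem rank_dyad_le {q : ℕ} (x y : EuclideanSpace ℝ (Fin q)) : (mat (dyad x y)).rank ≤ 1 := by
  rw [mat_dyad]
  exact Matrix.rank_vecMulVec_le _ _

theorem dyad_single {q : ℕ} (a b : Fin q) :
    dyad (EuclideanSpace.single a 1) (EuclideanSpace.single b 1) =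
      EuclideanSpace.single (a, b) 1 := by
  ext p
  rw [dyad_apply]
  simp only [PiLp.single_apply, Prod.ext_iff]
  by_cases h1 : p.1 = a <;> by_cases h2 : p.2 = b <;> simp [h1, h2]

theorem mat_sandwich_dyad {q : ℕ} (A B : Matrix (Fin q) (Fin q) ℝ)
    (x y : EuclideanSpace ℝ (Fin q)) : sandwich A B (dyad x y) =
      dyad (Matrix.toEuclideanLin A x) (Matrix.toEuclideanLin B.transpose y) := by
  apply mat_injective
  rw [mat_sandwich, mat_dyad, mat_dyad, Matrix.mul_vecMulVec, Matrix.vecMulVec_mul]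
  congr 1
  exact (Matrix.mulVec_transpose B y.ofLp).symm

/-- The linear map `x ↦ L (x y')`. -/
noncomputable def dyadLeft {q d : ℕ} (L : MatMap q d) (y : EuclideanSpace ℝ (Fin q)) :
    EuclideanSpace ℝ (Fin q) →L[ℝ] EuclideanSpace ℝ (Fin d) :=
  LinearMap.toContinuousLinearMap
    { toFun := fun x => L (dyad x y)
      map_add' := fun u v => by
        rw [← map_add]
        congr 1
        ext p
        simp [dyad_apply, add_mul]
      map_smul' := fun c u => by
        rw [RingHom.id_apply, ← map_smul]
        congr 1
        ext p
        simp [dyad_apply, mul_assoc] }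

theorem dyadLeft_apply {q d : ℕ} (L : MatMap q d) (x y : EuclideanSpace ℝ (Fin q)) :
    dyadLeft L y x = L (dyad x y) := rfl

/-- The transposition of matrices. -/
noncomputable def transposeOp (q : ℕ) : MatOp q :=
  LinearMap.toContinuousLinearMap
    { toFun := fun Z => ofMat (mat Z).transpose
      map_add' := fun _ _ => rfl
      map_smul' := fun _ _ => rfl }

theorem mat_transposeOp {q : ℕ} (Z : MatSp q) :
    mat (transposeOp q Z) = (mat Z).transpose := rfl

theorem norm_transposeOp {q : ℕ} (Z : MatSp q) : ‖transposeOp q Z‖ = ‖Z‖ :=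
  norm_ofMat_transpose (mat Z)

theorem transposeOp_dyad {q : ℕ} (x y : EuclideanSpace ℝ (Fin q)) :
    transposeOp q (dyad x y) = dyad y x := by
  ext p
  change x p.2 * y p.1 = y p.1 * x p.2
  ring

theorem isRankPreserver_transposeOp {q : ℕ} : IsRankPreserver (transposeOp q) := fun X => by
  rw [mat_transposeOp, Matrix.rank_transpose]

theorem component_comp_transposeOp {q d : ℕ} (L : MatMap q d) (i : Fin d) :
    component (L ∘L transposeOp q) i = (component L i).transpose := by
  ext a b
  change L (transposeOp q (EuclideanSpace.single (a, b) 1)) i = _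
  rw [← dyad_single, transposeOp_dyad, dyad_single]
  rfl

theorem rowGram_comp_transposeOp {q d : ℕ} (L : MatMap q d) :
    rowGram (L ∘L transposeOp q) = colGram L := by
  simp only [rowGram, colGram, component_comp_transposeOp, Matrix.transpose_transpose]

theorem colGram_comp_transposeOp {q d : ℕ} (L : MatMap q d) :
    colGram (L ∘L transposeOp q) = rowGram L := by
  simp only [rowGram, colGram, component_comp_transposeOp, Matrix.transpose_transpose]

theorem map_ext_component {q d : ℕ} {L L' : MatMap q d}
    (h : ∀ i, component L i = component L' i) : L = L' := by
  ext X i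
  rw [map_apply_eq_sum_component, map_apply_eq_sum_component, h]

theorem component_comp_sandwich {q d : ℕ} (L : MatMap q d) (A B : Matrix (Fin q) (Fin q) ℝ)
    (i : Fin d) : component (L ∘L sandwich A B) i = A.transpose * component L i * B.transpose := by
  ext a b
  change L (sandwich A B (EuclideanSpace.single (a, b) 1)) i = _
  rw [map_apply_eq_sum_component, mat_sandwich]
  have h : ∀ c d', (A * mat (EuclideanSpace.single (a, b) 1) * B) c d' = A c a * B b d' := by
    intro c d'
    rw [Matrix.mul_apply, Finset.sum_eq_single b]
    · rw [Matrix.mul_apply, Finset.sum_eq_single a]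
      · simp
      · intro k _ hk; simp [hk]
      · simp
    · intro k _ hk
      rw [Matrix.mul_apply, Finset.sum_eq_zero, zero_mul]
      intro k' _
      simp [hk]
    · simp
  simp only [h, Matrix.mul_apply, Matrix.transpose_apply, Finset.sum_mul]
  rw [Finset.sum_comm]
  exact Finset.sum_congr rfl fun c _ => Finset.sum_congr rfl fun d' _ => by ring

/-- The quadratic form of `rowGram L`. -/
noncomputable def rowQuad {q d : ℕ} (L : MatMap q d) (x : EuclideanSpace ℝ (Fin q)) : ℝ :=
  ∑ b, ‖L (dyad x (EuclideanSpace.single b 1))‖ ^ 2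

/-- The quadratic form of `colGram L`. -/
noncomputable def colQuad {q d : ℕ} (L : MatMap q d) (y : EuclideanSpace ℝ (Fin q)) : ℝ :=
  ∑ a, ‖L (dyad (EuclideanSpace.single a 1) y)‖ ^ 2

theorem rowQuad_comp_transposeOp {q d : ℕ} (L : MatMap q d) (x : EuclideanSpace ℝ (Fin q)) :
    rowQuad (L ∘L transposeOp q) x = colQuad L x := by
  simp only [rowQuad, colQuad, ContinuousLinearMap.comp_apply, transposeOp_dyad]

theorem colQuad_comp_transposeOp {q d : ℕ} (L : MatMap q d) (x : EuclideanSpace ℝ (Fin q)) :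
    colQuad (L ∘L transposeOp q) x = rowQuad L x := by
  simp only [rowQuad, colQuad, ContinuousLinearMap.comp_apply, transposeOp_dyad]

theorem rowQuad_eq {q d : ℕ} (L : MatMap q d) (x : EuclideanSpace ℝ (Fin q)) :
    rowQuad L x = x.ofLp ⬝ᵥ (rowGram L).mulVec x.ofLp := by
  have h1 : ∀ b i, L (dyad x (EuclideanSpace.single b 1)) i =
      ((component L i).transpose.mulVec x.ofLp) b := by
    intro b i
    rw [map_apply_eq_sum_component, Matrix.mulVec, dotProduct]
    refine Finset.sum_congr rfl fun a _ => ?_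
    rw [Finset.sum_eq_single b]
    · simp [dyad_apply]
    · intro k _ hk; simp [dyad_apply, hk]
    · simp
  have h2 : ∀ i, x.ofLp ⬝ᵥ (component L i * (component L i).transpose).mulVec x.ofLp =
      ∑ b, ((component L i).transpose.mulVec x.ofLp) b ^ 2 := by
    intro i
    rw [← Matrix.mulVec_mulVec, Matrix.dotProduct_mulVec, ← Matrix.mulVec_transpose, dotProduct]
    exact Finset.sum_congr rfl fun b _ => by ring
  rw [rowGram, Matrix.sum_mulVec, dotProduct_sum]
  simp only [h2]
  rw [Finset.sum_comm, rowQuad]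
  refine Finset.sum_congr rfl fun b _ => ?_
  rw [EuclideanSpace.norm_sq_eq]
  exact Finset.sum_congr rfl fun i _ => by rw [h1, Real.norm_eq_abs, sq_abs]

theorem rowGram_isSymm {q d : ℕ} (L : MatMap q d) : (rowGram L).transpose = rowGram L := by
  simp [rowGram, Matrix.transpose_sum, Matrix.transpose_mul]

theorem rowQuad_of_rowGram {q d : ℕ} {L : MatMap q d}
    (h : rowGram L = (q : ℝ) • (1 : Matrix (Fin q) (Fin q) ℝ)) (x : EuclideanSpace ℝ (Fin q)) :
    rowQuad L x = q * ‖x‖ ^ 2 := by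
  rw [rowQuad_eq, h, Matrix.smul_mulVec, Matrix.one_mulVec, dotProduct_smul,
    EuclideanSpace.norm_sq_eq, smul_eq_mul, dotProduct]
  congr 1
  exact Finset.sum_congr rfl fun a _ => by rw [Real.norm_eq_abs, sq_abs]; ring

theorem colQuad_of_colGram {q d : ℕ} {L : MatMap q d}
    (h : colGram L = (q : ℝ) • (1 : Matrix (Fin q) (Fin q) ℝ)) (x : EuclideanSpace ℝ (Fin q)) :
    colQuad L x = q * ‖x‖ ^ 2 := by
  rw [← rowQuad_comp_transposeOp]
  exact rowQuad_of_rowGram (by rw [rowGram_comp_transposeOp, h]) x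

theorem rowGram_of_rowQuad {q d : ℕ} {L : MatMap q d}
    (h : ∀ x : EuclideanSpace ℝ (Fin q), rowQuad L x = q * ‖x‖ ^ 2) :
    rowGram L = (q : ℝ) • (1 : Matrix (Fin q) (Fin q) ℝ) := by
  set S := rowGram L - (q : ℝ) • (1 : Matrix (Fin q) (Fin q) ℝ) with hS
  have hsymm : S.transpose = S := by
    rw [hS, Matrix.transpose_sub, rowGram_isSymm, Matrix.transpose_smul, Matrix.transpose_one]
  have hq : ∀ x : Fin q → ℝ, x ⬝ᵥ S.mulVec x = 0 := by
    intro x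
    have h1 := h (WithLp.toLp 2 x)
    rw [rowQuad_eq, EuclideanSpace.norm_sq_eq] at h1
    rw [hS, Matrix.sub_mulVec, dotProduct_sub, Matrix.smul_mulVec, Matrix.one_mulVec,
      dotProduct_smul]
    change x ⬝ᵥ (rowGram L).mulVec x = _ at h1
    rw [h1, smul_eq_mul, ← mul_sub]
    apply mul_eq_zero_of_right
    rw [dotProduct, ← Finset.sum_sub_distrib]
    exact Finset.sum_eq_zero fun a _ => by rw [Real.norm_eq_abs, sq_abs]; ring
  have hz : S = 0 := by
    ext a b
    have h1 := hq (Pi.single a 1 + Pi.single b 1)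
    have h2 := hq (Pi.single a 1)
    have h3 := hq (Pi.single b 1)
    have h4 : S b a = S a b := congrFun (congrFun hsymm a) b
    rw [Matrix.mulVec_add, add_dotProduct, dotProduct_add, dotProduct_add, h2, h3] at h1
    simp only [Matrix.mulVec_single_one, single_dotProduct, one_mul, Matrix.col_apply] at h1
    rw [h4] at h1
    rw [Matrix.zero_apply]
    linarith
  exact sub_eq_zero.1 hz

theorem sum_norm_sq_orthonormalBasis {q d : ℕ}
    (T : EuclideanSpace ℝ (Fin q) →L[ℝ] EuclideanSpace ℝ (Fin d))
    (u : OrthonormalBasis (Fin q) ℝ (EuclideanSpace ℝ (Fin q))) :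
    ∑ a, ‖T (u a)‖ ^ 2 = ∑ a, ‖T (EuclideanSpace.single a 1)‖ ^ 2 := by
  simp only [norm_sq_apply_eq_sum T]
  rw [Finset.sum_comm]
  conv_rhs => rw [Finset.sum_comm]
  refine Finset.sum_congr rfl fun c _ => ?_
  rw [sum_inner_single_sq]
  have := u.sum_sq_norm_inner_right (ContinuousLinearMap.adjoint T (EuclideanSpace.single c 1))
  simpa using this

theorem colQuad_eq_sum {q d : ℕ} (L : MatMap q d) (y : EuclideanSpace ℝ (Fin q))
    (u : OrthonormalBasis (Fin q) ℝ (EuclideanSpace ℝ (Fin q))) :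
    colQuad L y = ∑ a, ‖L (dyad (u a) y)‖ ^ 2 :=
  (sum_norm_sq_orthonormalBasis (dyadLeft L y) u).symm

theorem norm_le_of_hs {q d : ℕ} (L : MatMap q d) {c : ℝ} (hc : 0 ≤ c) (h : hsSq L ≤ c ^ 2) :
    ‖L‖ ≤ c := by
  refine ContinuousLinearMap.opNorm_le_bound _ hc fun Z => ?_
  rw [← sq_le_sq₀ (norm_nonneg _) (by positivity), mul_pow]
  refine le_trans ?_ (mul_le_mul_of_nonneg_right h (sq_nonneg _))
  rw [hsSq_eq_sum_adjoint, norm_sq_apply_eq_sum, Finset.sum_mul]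
  refine Finset.sum_le_sum fun c _ => ?_
  rw [← mul_pow, mul_comm, ← sq_abs]
  exact pow_le_pow_left₀ (abs_nonneg _) (abs_real_inner_le_norm _ _) 2

theorem hsSq_eq_sum_rowQuad {q d : ℕ} (L : MatMap q d) :
    hsSq L = ∑ a, rowQuad L (EuclideanSpace.single a 1) := by
  rw [hsSq, Fintype.sum_prod_type]
  simp only [rowQuad, dyad_single]

theorem hsSq_eq_sum_colQuad {q d : ℕ} (L : MatMap q d) :
    hsSq L = ∑ a, colQuad L (EuclideanSpace.single a 1) := by
  rw [hsSq, Fintype.sum_prod_type, Finset.sum_comm]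
  simp only [colQuad, dyad_single]

theorem hsSq_of_colGram {q d : ℕ} {L : MatMap q d}
    (h : colGram L = (q : ℝ) • (1 : Matrix (Fin q) (Fin q) ℝ)) : hsSq L = (q : ℝ) ^ 2 := by
  rw [hsSq_eq_sum_colQuad]
  simp only [colQuad_of_colGram h]
  simp [pow_two]

end

section
open scoped Matrix.Norms.L2Operator

/-! ### One scaling step of Operator Sinkhorn -/

/-- A lower bound for `L` on dyads. -/
def DyadLower {q d : ℕ} (L : MatMap q d) (m : ℝ) : Prop :=
  ∀ x y : EuclideanSpace ℝ (Fin q), m * (‖x‖ ^ 2 * ‖y‖ ^ 2) ≤ ‖L (dyad x y)‖ ^ 2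

/-- An upper bound for `L` on dyads. -/
def DyadUpper {q d : ℕ} (L : MatMap q d) (m : ℝ) : Prop :=
  ∀ x y : EuclideanSpace ℝ (Fin q), ‖L (dyad x y)‖ ^ 2 ≤ m * (‖x‖ ^ 2 * ‖y‖ ^ 2)

theorem DyadLower.comp_transposeOp {q d : ℕ} {L : MatMap q d} {m : ℝ} (h : DyadLower L m) :
    DyadLower (L ∘L transposeOp q) m := fun x y => by
  rw [ContinuousLinearMap.comp_apply, transposeOp_dyad, mul_comm (‖x‖ ^ 2)]
  exact h y x

theorem DyadUpper.comp_transposeOp {q d : ℕ} {L : MatMap q d} {m : ℝ} (h : DyadUpper L m) :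
    DyadUpper (L ∘L transposeOp q) m := fun x y => by
  rw [ContinuousLinearMap.comp_apply, transposeOp_dyad, mul_comm (‖x‖ ^ 2)]
  exact h y x

theorem dyadUpper_norm {q d : ℕ} (L : MatMap q d) : DyadUpper L (‖L‖ ^ 2) := fun x y => by
  rw [← norm_sq_dyad, ← mul_pow]
  exact pow_le_pow_left₀ (norm_nonneg _) (L.le_opNorm _) 2

theorem comp_transposeOp_comp_transposeOp {q d : ℕ} (L : MatMap q d) :
    (L ∘L transposeOp q) ∘L transposeOp q = L := rfl

theorem sandwich_comp_sandwich {q : ℕ} (A B A' B' : Matrix (Fin q) (Fin q) ℝ) :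
    sandwich A B ∘L sandwich A' B' = sandwich (A * A') (B' * B) := by
  ext1 Z
  apply mat_injective
  rw [ContinuousLinearMap.comp_apply, mat_sandwich, mat_sandwich, mat_sandwich]
  simp only [Matrix.mul_assoc]

theorem sandwich_one_one {q : ℕ} :
    sandwich (1 : Matrix (Fin q) (Fin q) ℝ) 1 = ContinuousLinearMap.id ℝ (MatSp q) := by
  ext1 Z
  apply mat_injective
  rw [mat_sandwich, Matrix.one_mul, Matrix.mul_one]
  rfl

theorem comp_sandwich_comp_transposeOp {q d : ℕ} (L : MatMap q d)
    (A B : Matrix (Fin q) (Fin q) ℝ) : (L ∘L sandwich A B) ∘L transposeOp q =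
      (L ∘L transposeOp q) ∘L sandwich B.transpose A.transpose := by
  ext1 Z
  simp only [ContinuousLinearMap.comp_apply]
  congr 1
  apply mat_injective
  rw [mat_sandwich, mat_transposeOp, mat_transposeOp, mat_sandwich, Matrix.transpose_mul,
    Matrix.transpose_mul, Matrix.transpose_transpose, Matrix.transpose_transpose, Matrix.mul_assoc]

theorem IsInvSqrt.transpose_eq {q : ℕ} {R P : Matrix (Fin q) (Fin q) ℝ} (h : IsInvSqrt R P) :
    P.transpose = P := by
  have := h.1.1.eq
  rwa [Matrix.conjTranspose_eq_transpose_of_trivial] at this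

theorem rowScaling_eq {q d : ℕ} {L H : MatMap q d} {P : Matrix (Fin q) (Fin q) ℝ}
    (hP : IsInvSqrt (rowGram L) P)
    (hH : ∀ i, component H i = √(q : ℝ) • (P * component L i)) :
    H = L ∘L sandwich (√(q : ℝ) • P) 1 := by
  refine map_ext_component fun i => ?_
  rw [hH, component_comp_sandwich, Matrix.transpose_smul, hP.transpose_eq, Matrix.transpose_one,
    Matrix.mul_one, Matrix.smul_mul]

theorem rowScaling_rowGram {q d : ℕ} {L H : MatMap q d} {P : Matrix (Fin q) (Fin q) ℝ}
    (hP : IsInvSqrt (rowGram L) P)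
    (hH : ∀ i, component H i = √(q : ℝ) • (P * component L i)) :
    rowGram H = (q : ℝ) • (1 : Matrix (Fin q) (Fin q) ℝ) := by
  have h : ∀ i, component H i * (component H i).transpose =
      (q : ℝ) • (P * (component L i * (component L i).transpose) * P) := by
    intro i
    rw [hH, Matrix.transpose_smul, Matrix.transpose_mul, hP.transpose_eq, Matrix.smul_mul,
      Matrix.mul_smul, smul_smul, Real.mul_self_sqrt (Nat.cast_nonneg q)]
    simp only [Matrix.mul_assoc]
  rw [rowGram]
  simp only [h]
  rw [← Finset.smul_sum, ← Finset.sum_mul, ← Finset.mul_sum]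
  congr 1
  exact hP.2

theorem smul_dyad_left {q : ℕ} (c : ℝ) (x y : EuclideanSpace ℝ (Fin q)) :
    dyad (c • x) y = c • dyad x y := by
  ext p
  simp [dyad_apply, mul_assoc]

theorem norm_sq_smul {V : Type*} [NormedAddCommGroup V] [NormedSpace ℝ V] (c : ℝ) (v : V) :
    ‖c • v‖ ^ 2 = c ^ 2 * ‖v‖ ^ 2 := by
  rw [norm_smul, mul_pow, Real.norm_eq_abs, sq_abs]

/-- Row scaling of a map with normalized columns contracts the condition number of the Gram
matrices. -/
theorem rowScaling_colQuad {q d : ℕ} (hq : 0 < q) {L H : MatMap q d}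
    {P : Matrix (Fin q) (Fin q) ℝ} (hP : IsInvSqrt (rowGram L) P)
    (hH : ∀ i, component H i = √(q : ℝ) • (P * component L i))
    (hL : colGram L = (q : ℝ) • (1 : Matrix (Fin q) (Fin q) ℝ)) {m α ρ : ℝ} (hm0 : 0 ≤ m)
    (hm : DyadLower L m) (hα : 0 < α) (hρ : 0 ≤ ρ)
    (hlow : ∀ x, α * (q * ‖x‖ ^ 2) ≤ rowQuad L x)
    (hup : ∀ x, rowQuad L x ≤ α * (1 + ρ) * (q * ‖x‖ ^ 2)) :
    m ≤ 1 ∧ (∃ α' : ℝ, 0 < α' ∧ (∀ y, α' * (q * ‖y‖ ^ 2) ≤ colQuad H y) ∧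
      ∀ y, colQuad H y ≤ α' * (1 + (1 - m) * ρ) * (q * ‖y‖ ^ 2)) ∧ ‖H - L‖ ≤ q * ρ := by
  have hq0 : (0 : ℝ) < q := by exact_mod_cast hq
  set u := hP.1.1.eigenvectorBasis with hu
  set e := hP.1.1.eigenvalues with he
  have hepos : ∀ a, 0 < e a := fun a => hP.1.eigenvalues_pos a
  set t : Fin q → ℝ := fun a => √(q : ℝ) * e a with ht
  have htpos : ∀ a, 0 < t a := fun a => mul_pos (Real.sqrt_pos.2 hq0) (hepos a)
  have hHu : ∀ a y, H (dyad (u a) y) = t a • L (dyad (u a) y) := by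
    intro a y
    rw [rowScaling_eq hP hH, ContinuousLinearMap.comp_apply, mat_sandwich_dyad, ← map_smul,
      ← smul_dyad_left]
    have h1 : Matrix.toEuclideanLin (√(q : ℝ) • P) (u a) = t a • u a := by
      have h2 : Matrix.toEuclideanLin P (u a) = e a • u a := by
        have := hP.1.1.mulVec_eigenvectorBasis a
        ext c
        exact congrFun this c
      rw [map_smul, LinearMap.smul_apply, h2, smul_smul]
    have h3 : Matrix.toEuclideanLin (Matrix.transpose (1 : Matrix (Fin q) (Fin q) ℝ)) y = y := by
      ext c
      simp [Matrix.toEuclideanLin]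
    rw [h1, h3]
  have hun : ∀ a, ‖u a‖ = 1 := fun a => u.norm_eq_one a
  have hrow : ∀ a, t a ^ 2 * rowQuad L (u a) = q := by
    intro a
    have h1 := rowQuad_of_rowGram (rowScaling_rowGram hP hH) (u a)
    rw [hun, one_pow, mul_one] at h1
    rw [← h1, rowQuad, rowQuad, Finset.mul_sum]
    refine Finset.sum_congr rfl fun b _ => ?_
    rw [hHu, norm_sq_smul]
  have hα' : 0 < α * (1 + ρ) := by positivity
  have hθ1 : ∀ a, t a ^ 2 * α ≤ 1 := by
    intro a
    have h1 := hlow (u a)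
    rw [hun, one_pow, mul_one] at h1
    have h2 := mul_le_mul_of_nonneg_left h1 (sq_nonneg (t a))
    rw [hrow, ← mul_assoc] at h2
    exact le_of_mul_le_mul_right (by linarith) hq0
  have hθ0 : ∀ a, 1 ≤ t a ^ 2 * (α * (1 + ρ)) := by
    intro a
    have h1 := hup (u a)
    rw [hun, one_pow, mul_one] at h1
    have h2 := mul_le_mul_of_nonneg_left h1 (sq_nonneg (t a))
    rw [hrow, ← mul_assoc] at h2
    exact le_of_mul_le_mul_right (by linarith) hq0
  have hcard : ∑ _a : Fin q, (1 : ℝ) = q := by simp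
  have hcolL := fun y => colQuad_of_colGram hL y
  have hsumL : ∀ y, ∑ a, ‖L (dyad (u a) y)‖ ^ 2 = q * ‖y‖ ^ 2 := fun y => by
    rw [← colQuad_eq_sum, hcolL]
  have hm1 : m ≤ 1 := by
    have a0 : Fin q := ⟨0, hq⟩
    have h1 : ∑ a, m * (‖u a‖ ^ 2 * ‖u a0‖ ^ 2) ≤ ∑ a, ‖L (dyad (u a) (u a0))‖ ^ 2 :=
      Finset.sum_le_sum fun a _ => hm _ _
    rw [hsumL] at h1
    simp only [hun, one_pow, mul_one, Finset.sum_const, Finset.card_univ, Fintype.card_fin,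
      nsmul_eq_mul] at h1
    nlinarith
  set c := (α * (1 + ρ))⁻¹ with hc
  have hcpos : 0 < c := inv_pos.2 hα'
  have hc1 : c * (α * (1 + ρ)) = 1 := inv_mul_cancel₀ hα'.ne'
  have hct : ∀ a, c ≤ t a ^ 2 := fun a =>
    le_of_mul_le_mul_right (by rw [hc1]; exact hθ0 a) hα'
  have htc : ∀ a, t a ^ 2 ≤ c * (1 + ρ) := fun a => by
    refine le_of_mul_le_mul_right ?_ hα
    calc t a ^ 2 * α ≤ 1 := hθ1 a
      _ = c * (1 + ρ) * α := by linear_combination -hc1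
  have hcolH : ∀ y, colQuad H y = ∑ a, t a ^ 2 * ‖L (dyad (u a) y)‖ ^ 2 := by
    intro y
    rw [colQuad_eq_sum H y u]
    refine Finset.sum_congr rfl fun a _ => ?_
    rw [hHu, norm_sq_smul]
  have hm' : ∀ a y, m * ‖y‖ ^ 2 ≤ ‖L (dyad (u a) y)‖ ^ 2 := fun a y => by
    have := hm (u a) y
    rwa [hun, one_pow, one_mul] at this
  refine ⟨hm1, ⟨m * (∑ a, t a ^ 2) / q + (1 - m) * c, ?_, ?_, ?_⟩, ?_⟩
  · have h1 : (q : ℝ) * c ≤ ∑ a, t a ^ 2 := by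
      rw [← hcard, Finset.sum_mul]
      exact Finset.sum_le_sum fun a _ => by rw [one_mul]; exact hct a
    have h2 : c ≤ (∑ a, t a ^ 2) / q := by rw [le_div_iff₀ hq0]; linarith
    rw [mul_div_assoc]
    nlinarith
  · intro y
    have h1 : ∑ a, c * (‖L (dyad (u a) y)‖ ^ 2 - m * ‖y‖ ^ 2) ≤
        ∑ a, t a ^ 2 * (‖L (dyad (u a) y)‖ ^ 2 - m * ‖y‖ ^ 2) :=
      Finset.sum_le_sum fun a _ => mul_le_mul_of_nonneg_right (hct a) (by linarith [hm' a y])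
    simp only [mul_sub, Finset.sum_sub_distrib, ← Finset.mul_sum, ← Finset.sum_mul, hsumL] at h1
    rw [← hcolH, Finset.sum_const, Finset.card_univ, Fintype.card_fin, nsmul_eq_mul] at h1
    have h2 : (m * (∑ a, t a ^ 2) / q + (1 - m) * c) * (q * ‖y‖ ^ 2) =
      (∑ a, t a ^ 2) * (m * ‖y‖ ^ 2) + (1 - m) * c * (q * ‖y‖ ^ 2) := by
      field_simp
    rw [h2]
    linarith
  · intro y
    have h1 : ∑ a, t a ^ 2 * (‖L (dyad (u a) y)‖ ^ 2 - m * ‖y‖ ^ 2) ≤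
        ∑ a, c * (1 + ρ) * (‖L (dyad (u a) y)‖ ^ 2 - m * ‖y‖ ^ 2) :=
      Finset.sum_le_sum fun a _ => mul_le_mul_of_nonneg_right (htc a) (by linarith [hm' a y])
    simp only [mul_sub, Finset.sum_sub_distrib, ← Finset.mul_sum, ← Finset.sum_mul, hsumL] at h1
    rw [← hcolH, Finset.sum_const, Finset.card_univ, Fintype.card_fin, nsmul_eq_mul] at h1
    have h3 : (q : ℝ) * c ≤ ∑ a, t a ^ 2 := by
      rw [← hcard, Finset.sum_mul]
      exact Finset.sum_le_sum fun a _ => by rw [one_mul]; exact hct a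
    have h4 : c ≤ (∑ a, t a ^ 2) / q := by rw [le_div_iff₀ hq0]; linarith
    have h2 : (m * (∑ a, t a ^ 2) / q + (1 - m) * c) * (q * ‖y‖ ^ 2) =
      (∑ a, t a ^ 2) * (m * ‖y‖ ^ 2) + (1 - m) * c * (q * ‖y‖ ^ 2) := by
      field_simp
    have h5 : c ≤ m * (∑ a, t a ^ 2) / q + (1 - m) * c := by
      rw [mul_div_assoc]
      nlinarith
    have h6 : 0 ≤ (1 - m) * ρ * (q * ‖y‖ ^ 2) :=
      mul_nonneg (mul_nonneg (by linarith) hρ) (by positivity)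
    have h7 := mul_le_mul_of_nonneg_right h5 h6
    rw [mul_add (m * (∑ a, t a ^ 2) / q + (1 - m) * c), mul_one, add_mul, h2]
    linarith
  · have hsum : hsSq L = (q : ℝ) ^ 2 := hsSq_of_colGram hL
    have hα1 : α ≤ 1 := by
      have h1 : ∑ a : Fin q, α * (q * ‖EuclideanSpace.single a (1 : ℝ)‖ ^ 2) ≤ hsSq L := by
        rw [hsSq_eq_sum_rowQuad]
        exact Finset.sum_le_sum fun a _ => hlow _
      rw [hsum] at h1
      simp at h1
      have : 0 < (q : ℝ) * q := by positivity
      nlinarith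
    have hα2 : 1 ≤ α * (1 + ρ) := by
      have h1 : hsSq L ≤ ∑ a : Fin q, α * (1 + ρ) * (q * ‖EuclideanSpace.single a (1 : ℝ)‖ ^ 2) := by
        rw [hsSq_eq_sum_rowQuad]
        exact Finset.sum_le_sum fun a _ => hup _
      rw [hsum] at h1
      simp at h1
      have : 0 < (q : ℝ) * q := by positivity
      nlinarith
    have htd : ∀ a, (t a - 1) ^ 2 ≤ ρ ^ 2 := by
      intro a
      rw [sq_le_sq, abs_of_nonneg hρ, abs_le]
      have h1 := hθ0 a
      have h2 := hθ1 a
      have h3 := htpos a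
      constructor
      · by_contra hlt
        push Not at hlt
        nlinarith [mul_pos h3 h3]
      · by_contra hlt
        push Not at hlt
        nlinarith [mul_pos h3 h3]
    refine norm_le_of_hs _ (by positivity) ?_
    rw [mul_pow, ← hsum, hsSq_eq_sum_colQuad, hsSq_eq_sum_colQuad, Finset.sum_mul]
    refine Finset.sum_le_sum fun b _ => ?_
    rw [colQuad_eq_sum _ _ u, colQuad_eq_sum _ _ u, Finset.sum_mul]
    refine Finset.sum_le_sum fun a _ => ?_
    rw [sub_apply, hHu]
    have h1 : t a • L (dyad (u a) (EuclideanSpace.single b 1)) -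
        L (dyad (u a) (EuclideanSpace.single b 1)) =
        (t a - 1) • L (dyad (u a) (EuclideanSpace.single b 1)) := by rw [sub_smul, one_smul]
    rw [h1, norm_sq_smul, mul_comm]
    exact mul_le_mul_of_nonneg_left (htd a) (sq_nonneg _)

end

section
open scoped Matrix.Norms.L2Operator

/-! ### Convergence of Operator Sinkhorn -/

theorem exists_isInvSqrt {q : ℕ} {R : Matrix (Fin q) (Fin q) ℝ} (hR : R.PosDef) :
    ∃ P, IsInvSqrt R P := by
  have hpos := hR.eigenvalues_pos
  set e := hR.1.eigenvalues with he
  set U : Matrix (Fin q) (Fin q) ℝ := hR.1.eigenvectorUnitary.1 with hU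
  have hUU : star U * U = 1 := Unitary.coe_star_mul_self hR.1.eigenvectorUnitary
  have hUU' : U * star U = 1 := Unitary.coe_mul_star_self hR.1.eigenvectorUnitary
  have hspec : R = U * Matrix.diagonal e * star U := hR.1.spectral_theorem
  set D := Matrix.diagonal (fun a => (√(e a))⁻¹) with hD
  refine ⟨U * D * star U, ?_, ?_⟩
  · have h1 : D.PosDef := Matrix.PosDef.diagonal fun a => inv_pos.2 (Real.sqrt_pos.2 (hpos a))
    have h2 : Function.Injective U.vecMul := by
      intro v w hvw
      have := congrArg (fun z => Matrix.vecMul z (star U)) hvw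
      simpa [Matrix.vecMul_vecMul, hUU'] using this
    exact h1.mul_mul_conjTranspose_same h2
  · have hDD : D * (Matrix.diagonal e * D) = 1 := by
      rw [hD, Matrix.diagonal_mul_diagonal, Matrix.diagonal_mul_diagonal, ← Matrix.diagonal_one]
      congr 1
      ext a
      have h1 := Real.sqrt_pos.2 (hpos a)
      have h2 := Real.mul_self_sqrt (hpos a).le
      field_simp
      nlinarith
    calc U * D * star U * R * (U * D * star U)
        = U * D * (star U * U) * Matrix.diagonal e * (star U * U) * D * star U := by
          rw [hspec]; simp only [Matrix.mul_assoc]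
      _ = U * (D * (Matrix.diagonal e * D)) * star U := by
          rw [hUU]; simp only [Matrix.mul_assoc, Matrix.mul_one]
      _ = 1 := by rw [hDD, Matrix.mul_one, hUU']

theorem DyadLower.rowQuad_ge {q d : ℕ} {L : MatMap q d} {m : ℝ} (h : DyadLower L m)
    (x : EuclideanSpace ℝ (Fin q)) : m * (q * ‖x‖ ^ 2) ≤ rowQuad L x := by
  have : ∑ b : Fin q, m * (‖x‖ ^ 2 * ‖EuclideanSpace.single b (1 : ℝ)‖ ^ 2) ≤ rowQuad L x :=
    Finset.sum_le_sum fun b _ => h _ _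
  simp at this
  linarith

theorem DyadUpper.rowQuad_le {q d : ℕ} {L : MatMap q d} {m : ℝ} (h : DyadUpper L m)
    (x : EuclideanSpace ℝ (Fin q)) : rowQuad L x ≤ m * (q * ‖x‖ ^ 2) := by
  have : rowQuad L x ≤ ∑ b : Fin q, m * (‖x‖ ^ 2 * ‖EuclideanSpace.single b (1 : ℝ)‖ ^ 2) :=
    Finset.sum_le_sum fun b _ => h _ _
  simp at this
  linarith

theorem DyadLower.posDef {q d : ℕ} {L : MatMap q d} {m : ℝ} (h : DyadLower L m) (hm : 0 < m) :
    (rowGram L).PosDef := by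
  refine Matrix.PosDef.of_dotProduct_mulVec_pos ?_ fun x hx => ?_
  · rw [Matrix.IsHermitian, Matrix.conjTranspose_eq_transpose_of_trivial, rowGram_isSymm]
  · have h1 := h.rowQuad_ge (WithLp.toLp 2 x)
    rw [rowQuad_eq] at h1
    have h2 : 0 < ‖WithLp.toLp 2 x‖ := norm_pos_iff.2 (by simpa using hx)
    have h3 : (0 : ℝ) < q := by
      rcases Nat.eq_zero_or_pos q with rfl | h0
      · exact absurd (Subsingleton.elim x 0) hx
      · exact_mod_cast h0
    have h4 : 0 < m * (q * ‖WithLp.toLp 2 x‖ ^ 2) := by positivity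
    simpa using h4.trans_le h1

/-- Existence of the row scaling. -/
theorem exists_rowScaling {q d : ℕ} {L : MatMap q d} {m : ℝ} (h : DyadLower L m) (hm : 0 < m) :
    ∃ (H : MatMap q d) (P : Matrix (Fin q) (Fin q) ℝ), IsInvSqrt (rowGram L) P ∧
      ∀ i, component H i = √(q : ℝ) • (P * component L i) := by
  obtain ⟨P, hP⟩ := exists_isInvSqrt (h.posDef hm)
  refine ⟨L ∘L sandwich (√(q : ℝ) • P) 1, P, hP, fun i => ?_⟩
  rw [component_comp_sandwich, Matrix.transpose_smul, hP.transpose_eq, Matrix.transpose_one,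
    Matrix.mul_one, Matrix.smul_mul]

theorem sum_norm_sq_toEuclideanLin {q : ℕ} (A : Matrix (Fin q) (Fin q) ℝ) :
    ∑ a, ‖Matrix.toEuclideanLin A (EuclideanSpace.single a 1)‖ ^ 2 = ‖ofMat A‖ ^ 2 := by
  rw [norm_sq_eq_sum_entries, Finset.sum_comm]
  refine Finset.sum_congr rfl fun a _ => ?_
  rw [EuclideanSpace.norm_sq_eq]
  refine Finset.sum_congr rfl fun b _ => ?_
  simp [Matrix.toEuclideanLin]

theorem rowScaled_bounds {q d : ℕ} {L : MatMap q d} {μ₁ μ₂ : ℝ} (h₁ : DyadLower L μ₁)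
    (h₂ : DyadUpper L μ₂) {A B : Matrix (Fin q) (Fin q) ℝ}
    (h : rowGram (L ∘L sandwich A B) = (q : ℝ) • (1 : Matrix (Fin q) (Fin q) ℝ))
    (x : EuclideanSpace ℝ (Fin q)) :
    μ₁ * (‖Matrix.toEuclideanLin A x‖ ^ 2 * ‖ofMat B‖ ^ 2) ≤ q * ‖x‖ ^ 2 ∧
      q * ‖x‖ ^ 2 ≤ μ₂ * (‖Matrix.toEuclideanLin A x‖ ^ 2 * ‖ofMat B‖ ^ 2) := by
  rw [← rowQuad_of_rowGram h, rowQuad, ← norm_ofMat_transpose B, ← sum_norm_sq_toEuclideanLin,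
    Finset.mul_sum, Finset.mul_sum, Finset.mul_sum]
  simp only [ContinuousLinearMap.comp_apply, mat_sandwich_dyad]
  exact ⟨Finset.sum_le_sum fun b _ => h₁ _ _, Finset.sum_le_sum fun b _ => h₂ _ _⟩

theorem colScaled_bounds {q d : ℕ} {L : MatMap q d} {μ₁ μ₂ : ℝ} (h₁ : DyadLower L μ₁)
    (h₂ : DyadUpper L μ₂) {A B : Matrix (Fin q) (Fin q) ℝ}
    (h : colGram (L ∘L sandwich A B) = (q : ℝ) • (1 : Matrix (Fin q) (Fin q) ℝ))
    (y : EuclideanSpace ℝ (Fin q)) :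
    μ₁ * (‖Matrix.toEuclideanLin B.transpose y‖ ^ 2 * ‖ofMat A‖ ^ 2) ≤ q * ‖y‖ ^ 2 ∧
      q * ‖y‖ ^ 2 ≤ μ₂ * (‖Matrix.toEuclideanLin B.transpose y‖ ^ 2 * ‖ofMat A‖ ^ 2) := by
  have h3 := rowScaled_bounds h₁.comp_transposeOp h₂.comp_transposeOp (A := B.transpose)
    (B := A.transpose) (by
      rw [← comp_sandwich_comp_transposeOp, rowGram_comp_transposeOp, h]) y
  rwa [norm_ofMat_transpose] at h3

/-- A map obtained from `L` by scaling, whose columns are normalized, and whose row scaling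
factor normalizes the rows for another column factor. -/
def ColScaled {q d : ℕ} (L K : MatMap q d) : Prop :=
  ∃ A B B' : Matrix (Fin q) (Fin q) ℝ, K = L ∘L sandwich A B ∧
    colGram K = (q : ℝ) • (1 : Matrix (Fin q) (Fin q) ℝ) ∧
    rowGram (L ∘L sandwich A B') = (q : ℝ) • (1 : Matrix (Fin q) (Fin q) ℝ)

theorem ColScaled.dyadLower {q d : ℕ} {L K : MatMap q d} (hq : 0 < q) {μ₁ μ₂ : ℝ}
    (h₁ : DyadLower L μ₁) (h₂ : DyadUpper L μ₂) (hμ₁ : 0 < μ₁) (hμ₂ : 0 < μ₂)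
    (hK : ColScaled L K) : DyadLower K (μ₁ ^ 2 / μ₂ ^ 2) := by
  obtain ⟨A, B, B', rfl, hcol, hrow⟩ := hK
  have hq0 : (0 : ℝ) < q := by exact_mod_cast hq
  intro x y
  rw [ContinuousLinearMap.comp_apply, mat_sandwich_dyad]
  refine le_trans ?_ (h₁ _ _)
  have e1 := (rowScaled_bounds h₁ h₂ hrow x).2
  have e2 := (colScaled_bounds h₁ h₂ hcol y).2
  have e3 : μ₁ * (‖ofMat A‖ ^ 2 * ‖ofMat B'‖ ^ 2) ≤ q * q := by
    have := Finset.sum_le_sum fun (a : Fin q) (_ : a ∈ Finset.univ) =>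
      (rowScaled_bounds h₁ h₂ hrow (EuclideanSpace.single a 1)).1
    rw [← Finset.mul_sum, ← Finset.sum_mul, sum_norm_sq_toEuclideanLin] at this
    simpa using this
  set p := ‖Matrix.toEuclideanLin A x‖ ^ 2
  set w := ‖Matrix.toEuclideanLin B.transpose y‖ ^ 2
  set a := ‖ofMat A‖ ^ 2
  set b := ‖ofMat B'‖ ^ 2
  have hp : 0 ≤ p := sq_nonneg _
  have hw : 0 ≤ w := sq_nonneg _
  have ha : 0 ≤ a := sq_nonneg _
  have hb : 0 ≤ b := sq_nonneg _
  have e4 := mul_le_mul e1 e2 (by positivity) (by positivity)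
  have e5 : μ₁ * (q * q) * (‖x‖ ^ 2 * ‖y‖ ^ 2) ≤ μ₂ ^ 2 * (p * w) * (q * q) := by
    calc _ = μ₁ * (q * ‖x‖ ^ 2 * (q * ‖y‖ ^ 2)) := by ring
      _ ≤ μ₁ * (μ₂ * (p * b) * (μ₂ * (w * a))) := by gcongr
      _ = μ₂ ^ 2 * (p * w) * (μ₁ * (a * b)) := by ring
      _ ≤ _ := by gcongr
  have e6 : μ₁ * (‖x‖ ^ 2 * ‖y‖ ^ 2) ≤ μ₂ ^ 2 * (p * w) :=
    le_of_mul_le_mul_right (by linarith) (mul_pos hq0 hq0)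
  rw [div_mul_eq_mul_div, div_le_iff₀ (by positivity)]
  nlinarith

theorem rowScaling_colScaled {q d : ℕ} {L K H : MatMap q d} {P : Matrix (Fin q) (Fin q) ℝ}
    {A B : Matrix (Fin q) (Fin q) ℝ} (hK : K = L ∘L sandwich A B)
    (hP : IsInvSqrt (rowGram K) P)
    (hH : ∀ i, component H i = √(q : ℝ) • (P * component K i)) :
    ∃ A', H = L ∘L sandwich A' B ∧
      rowGram H = (q : ℝ) • (1 : Matrix (Fin q) (Fin q) ℝ) := by
  refine ⟨A * (√(q : ℝ) • P), ?_, rowScaling_rowGram hP hH⟩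
  rw [rowScaling_eq hP hH, hK, ContinuousLinearMap.comp_assoc, sandwich_comp_sandwich,
    Matrix.one_mul]

theorem colScaling_transpose {q d : ℕ} {H K : MatMap q d} {Q : Matrix (Fin q) (Fin q) ℝ}
    (hQ : IsInvSqrt (colGram H) Q)
    (hK : ∀ i, component K i = √(q : ℝ) • (component H i * Q)) :
    IsInvSqrt (rowGram (H ∘L transposeOp q)) Q ∧
      ∀ i, component (K ∘L transposeOp q) i =
        √(q : ℝ) • (Q * component (H ∘L transposeOp q) i) := by
  refine ⟨by rwa [rowGram_comp_transposeOp], fun i => ?_⟩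
  rw [component_comp_transposeOp, component_comp_transposeOp, hK, Matrix.transpose_smul,
    Matrix.transpose_mul, hQ.transpose_eq]

theorem norm_comp_transposeOp {q d : ℕ} (L : MatMap q d) : ‖L ∘L transposeOp q‖ = ‖L‖ := by
  have h : ∀ K : MatMap q d, ‖K ∘L transposeOp q‖ ≤ ‖K‖ := fun K =>
    ContinuousLinearMap.opNorm_le_bound _ (norm_nonneg _) fun Z => by
      rw [ContinuousLinearMap.comp_apply, ← norm_transposeOp Z]
      exact K.le_opNorm _
  exact le_antisymm (h L) (h (L ∘L transposeOp q))

/-- One pass of Operator Sinkhorn makes the columns normalized. -/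
theorem SinkhornStep.colScaled {q d : ℕ} {L K K' : MatMap q d} {A B : Matrix (Fin q) (Fin q) ℝ}
    (hK : K = L ∘L sandwich A B) (h : SinkhornStep K K') : ColScaled L K' := by
  obtain ⟨H, P, Q, hP, hH, hQ, hK'⟩ := h
  obtain ⟨A', hHA, hrow⟩ := rowScaling_colScaled hK hP hH
  obtain ⟨hQ', hK''⟩ := colScaling_transpose hQ hK'
  obtain ⟨B', hKB, hrow'⟩ := rowScaling_colScaled (L := L ∘L transposeOp q)
    (A := B.transpose) (B := A'.transpose) (by rw [hHA, comp_sandwich_comp_transposeOp]) hQ' hK''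
  refine ⟨A', B'.transpose, B, ?_, ?_, by rw [← hHA, hrow]⟩
  · rw [← comp_transposeOp_comp_transposeOp K', hKB, ← comp_transposeOp_comp_transposeOp L,
      comp_sandwich_comp_transposeOp, Matrix.transpose_transpose]
    rfl
  · rw [← rowGram_comp_transposeOp, hrow']

/-- One pass of Operator Sinkhorn contracts the defect of the row normalization. -/
theorem SinkhornStep.contract {q d : ℕ} {L K K' : MatMap q d} (hq : 0 < q) {μ₁ μ₂ : ℝ}
    (h₁ : DyadLower L μ₁) (h₂ : DyadUpper L μ₂) (hμ₁ : 0 < μ₁) (hμ₂ : 0 < μ₂)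
    (hK : ColScaled L K) (h : SinkhornStep K K') {α ρ : ℝ} (hα : 0 < α) (hρ : 0 ≤ ρ)
    (hlow : ∀ x, α * (q * ‖x‖ ^ 2) ≤ rowQuad K x)
    (hup : ∀ x, rowQuad K x ≤ α * (1 + ρ) * (q * ‖x‖ ^ 2)) :
    μ₁ ^ 2 / μ₂ ^ 2 ≤ 1 ∧ (∃ α' : ℝ, 0 < α' ∧ (∀ x, α' * (q * ‖x‖ ^ 2) ≤ rowQuad K' x) ∧
      ∀ x, rowQuad K' x ≤ α' * (1 + (1 - μ₁ ^ 2 / μ₂ ^ 2) ^ 2 * ρ) * (q * ‖x‖ ^ 2)) ∧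
    ‖K' - K‖ ≤ 2 * (q * ρ) ∧ ∃ H : MatMap q d,
      rowGram H = (q : ℝ) • (1 : Matrix (Fin q) (Fin q) ℝ) ∧ ‖H - K‖ ≤ q * ρ := by
  have hm := hK.dyadLower hq h₁ h₂ hμ₁ hμ₂
  have hm0 : 0 < μ₁ ^ 2 / μ₂ ^ 2 := by positivity
  set m := μ₁ ^ 2 / μ₂ ^ 2
  obtain ⟨A, B, B', hKAB, hcol, hrow⟩ := hK
  obtain ⟨H, P, Q, hP, hH, hQ, hK'⟩ := h
  obtain ⟨hm1, ⟨α', hα', hl', hu'⟩, hn'⟩ :=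
    rowScaling_colQuad hq hP hH hcol hm0.le hm hα hρ hlow hup
  obtain ⟨A', hHA, hrowH⟩ := rowScaling_colScaled hKAB hP hH
  obtain ⟨hQ', hK''⟩ := colScaling_transpose hQ hK'
  have hmH : DyadLower (H ∘L transposeOp q) m :=
    ColScaled.dyadLower hq h₁.comp_transposeOp h₂.comp_transposeOp hμ₁ hμ₂
      ⟨B.transpose, A'.transpose, A.transpose, by rw [hHA, comp_sandwich_comp_transposeOp],
        by rw [colGram_comp_transposeOp, hrowH],
        by rw [← comp_sandwich_comp_transposeOp, rowGram_comp_transposeOp, ← hKAB, hcol]⟩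
  have hρ' : 0 ≤ (1 - m) * ρ := mul_nonneg (by linarith) hρ
  obtain ⟨-, ⟨α'', hα'', hl'', hu''⟩, hn''⟩ :=
    rowScaling_colQuad hq hQ' hK'' (by rw [colGram_comp_transposeOp, hrowH]) hm0.le hmH hα' hρ'
      (fun y => by rw [rowQuad_comp_transposeOp]; exact hl' y)
      (fun y => by rw [rowQuad_comp_transposeOp]; exact hu' y)
  have hn3 : ‖K' - H‖ ≤ q * ρ := by
    rw [← norm_comp_transposeOp, ContinuousLinearMap.sub_comp]
    refine hn''.trans ?_
    gcongr
    nlinarith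
  refine ⟨hm1, ⟨α'', hα'', fun x => ?_, fun x => ?_⟩, ?_, H, hrowH, hn'⟩
  · rw [← colQuad_comp_transposeOp]; exact hl'' x
  · rw [← colQuad_comp_transposeOp]
    refine (hu'' x).trans (le_of_eq (by ring))
  · calc ‖K' - K‖ = ‖(K' - H) + (H - K)‖ := by congr 1; abel
      _ ≤ _ := norm_add_le _ _
      _ ≤ _ := by linarith

end

section

/-! ### Limits of rank-preservers and of Operator Sinkhorn -/

theorem exists_dyad_of_rank_le_one {q : ℕ} {X : MatSp q} (h : (mat X).rank ≤ 1) :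
    ∃ x y : EuclideanSpace ℝ (Fin q), X = dyad x y := by
  rw [← rank_toEuclideanLin] at h
  obtain ⟨v, hv⟩ := finrank_le_one_iff.1 h
  choose c hc using fun b : Fin q =>
    hv ⟨Matrix.toEuclideanLin (mat X) (EuclideanSpace.single b 1), LinearMap.mem_range_self _ _⟩
  refine ⟨v, WithLp.toLp 2 c, ?_⟩
  ext p
  have h1 := congrArg (fun z : (Matrix.toEuclideanLin (mat X)).range =>
    (z : EuclideanSpace ℝ (Fin q)) p.1) (hc p.2)
  simp [Matrix.toEuclideanLin] at h1
  rw [dyad_apply, mul_comm]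
  exact h1.symm

theorem isClosed_setOf_rank_le {q : ℕ} (r : ℕ) :
    IsClosed {X : MatSp q | (mat X).rank ≤ r} := by
  let T : MatSp q →ₗ[ℝ] (EuclideanSpace ℝ (Fin q) →L[ℝ] EuclideanSpace ℝ (Fin q)) :=
    (LinearMap.toContinuousLinearMap.toLinearMap ∘ₗ
      (Matrix.toEuclideanLin (m := Fin q) (n := Fin q) (𝕜 := ℝ)).toLinearMap) ∘ₗ
      { toFun := mat, map_add' := fun _ _ => rfl, map_smul' := fun _ _ => rfl }
  have h1 := (isOpen_setOfPred_nat_le_rank (𝕜 := ℝ)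
    (E := EuclideanSpace ℝ (Fin q)) (F := EuclideanSpace ℝ (Fin q)) (r + 1)).preimage
    T.continuous_of_finiteDimensional
  have h2 : {X : MatSp q | (mat X).rank ≤ r} = (T ⁻¹' {f | ((r + 1 : ℕ) : Cardinal) ≤
      (f : EuclideanSpace ℝ (Fin q) →ₗ[ℝ] EuclideanSpace ℝ (Fin q)).rank})ᶜ := by
    ext X
    have h3 : ((T X : EuclideanSpace ℝ (Fin q) →L[ℝ] EuclideanSpace ℝ (Fin q)) :
      EuclideanSpace ℝ (Fin q) →ₗ[ℝ] EuclideanSpace ℝ (Fin q)) =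
        Matrix.toEuclideanLin (mat X) := rfl
    rw [Set.mem_compl_iff, Set.mem_preimage, Set.mem_ofPred_eq, Set.mem_ofPred_eq, h3,
      LinearMap.rank, ← Module.finrank_eq_rank, rank_toEuclideanLin, Nat.cast_le]
    omega
  rw [h2]
  exact h1.isClosed_compl

theorem rank_le_of_tendsto {q r : ℕ} {Z : ℕ → MatSp q} {X : MatSp q}
    (h : Tendsto Z atTop (𝓝 X)) (hZ : ∀ᶠ k in atTop, (mat (Z k)).rank ≤ r) :
    (mat X).rank ≤ r :=
  (isClosed_setOf_rank_le r).mem_of_tendsto h hZ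

theorem euNorm_sq_le_of_dyad {q : ℕ} {N : MatOp q} {c : ℝ}
    (h : ∀ x y : EuclideanSpace ℝ (Fin q), ‖N (dyad x y)‖ ^ 2 ≤ c * (‖x‖ ^ 2 * ‖y‖ ^ 2)) :
    euNorm N ^ 2 ≤ (q : ℝ) ^ 2 * c := by
  rw [euNorm_sq, Fintype.sum_prod_type]
  calc _ ≤ ∑ _a : Fin q, ∑ _b : Fin q, c := by
        refine Finset.sum_le_sum fun a _ => Finset.sum_le_sum fun b _ => ?_
        rw [← dyad_single]
        simpa using h (EuclideanSpace.single a 1) (EuclideanSpace.single b 1)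
    _ = _ := by simp; ring

theorem norm_le_euNorm {q : ℕ} (N : MatOp q) : ‖N‖ ≤ euNorm N :=
  ContinuousLinearMap.opNorm_le_bound _ (euNorm_nonneg _) fun Z => norm_apply_le_euNorm N Z

theorem tendsto_clm_comp {q : ℕ} {ι : Type*} [Fintype ι] {N : ℕ → MatOp q} {T : MatOp q}
    {K : ℕ → MatSp q →L[ℝ] EuclideanSpace ℝ ι} {L : MatSp q →L[ℝ] EuclideanSpace ℝ ι}
    (hK : Tendsto K atTop (𝓝 L)) (hN : Tendsto N atTop (𝓝 T)) :
    Tendsto (fun k => K k ∘L N k) atTop (𝓝 (L ∘L T)) :=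
  (isBoundedBilinearMap_comp.continuous.tendsto (L, T)).comp (hK.prodMk_nhds hN)

theorem isRankPreserver_of_tendsto {q : ℕ} {N N' : ℕ → MatOp q} {T T' : MatOp q}
    (hN : ∀ k, IsRankPreserver (N k)) (hN' : ∀ k, IsRankPreserver (N' k))
    (hinv : ∀ k, N' k ∘L N k = ContinuousLinearMap.id ℝ (MatSp q))
    (hT : Tendsto N atTop (𝓝 T)) (hT' : Tendsto N' atTop (𝓝 T')) : IsRankPreserver T := by
  have happ : ∀ {S : ℕ → MatOp q} {U : MatOp q}, (∀ k, IsRankPreserver (S k)) →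
      Tendsto S atTop (𝓝 U) → ∀ X, (mat (U X)).rank ≤ (mat X).rank := by
    intro S U hS hU X
    exact rank_le_of_tendsto (((ContinuousLinearMap.apply ℝ (MatSp q) X).continuous.tendsto U).comp
      hU) (Eventually.of_forall fun k => (hS k X).le)
  have hTT : T' ∘L T = ContinuousLinearMap.id ℝ (MatSp q) := by
    refine tendsto_nhds_unique (tendsto_clm_comp hT' hT) ?_
    simp only [hinv]
    exact tendsto_const_nhds
  intro X
  refine le_antisymm (happ hN hT X) ?_
  have h1 : T' (T X) = X := congrArg (fun S : MatOp q => S X) hTT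
  have h2 := happ hN' hT' (T X)
  rwa [h1] at h2

/-- The limit of maps `L ∘ N k` with rank-preservers `N k` is again of this form if it stays
nondegenerate on dyads. -/
theorem exists_rankPreserver_of_tendsto {q d : ℕ} {L Lhat : MatMap q d} {N : ℕ → MatOp q}
    {μ m c : ℝ} (hμ : 0 < μ) (hL : DyadLower L μ) (hm : 0 < m)
    (hN : ∀ k, IsRankPreserver (N k)) (hlow : ∀ k, DyadLower (L ∘L N k) m)
    (hup : ∀ k, DyadUpper (L ∘L N k) c) (hlim : Tendsto (fun k => L ∘L N k) atTop (𝓝 Lhat)) :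
    ∃ T : MatOp q, IsRankPreserver T ∧ Lhat = L ∘L T := by
  choose N' hN' h1 h2 using fun k => (hN k).exists_inverse
  have hb1 : ∀ k, ‖N k‖ ≤ √((q : ℝ) ^ 2 * (c / μ)) := by
    intro k
    refine (norm_le_euNorm _).trans (Real.le_sqrt_of_sq_le (euNorm_sq_le_of_dyad fun x y => ?_))
    obtain ⟨u, v, huv⟩ := exists_dyad_of_rank_le_one ((hN k (dyad x y)).trans_le (rank_dyad_le x y))
    have h3 := hL u v
    rw [← norm_sq_dyad, ← huv] at h3
    have h4 := h3.trans (hup k x y)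
    rw [div_mul_eq_mul_div, le_div_iff₀ hμ]
    linarith
  have hb2 : ∀ k, ‖N' k‖ ≤ √((q : ℝ) ^ 2 * (‖L‖ ^ 2 / m)) := by
    intro k
    refine (norm_le_euNorm _).trans (Real.le_sqrt_of_sq_le (euNorm_sq_le_of_dyad fun x y => ?_))
    obtain ⟨u, v, huv⟩ :=
      exists_dyad_of_rank_le_one ((hN' k (dyad x y)).trans_le (rank_dyad_le x y))
    have h5 : N k (dyad u v) = dyad x y := by
      rw [← huv]
      exact congrArg (fun S : MatOp q => S (dyad x y)) (h1 k)
    have h3 := hlow k u v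
    rw [← norm_sq_dyad, ContinuousLinearMap.comp_apply, h5] at h3
    rw [huv, div_mul_eq_mul_div, le_div_iff₀ hm, mul_comm]
    exact h3.trans (dyadUpper_norm L x y)
  set C := max (√((q : ℝ) ^ 2 * (c / μ))) (√((q : ℝ) ^ 2 * (‖L‖ ^ 2 / m)))
  have hmem : ∀ k, (N k, N' k) ∈ Metric.closedBall (0 : MatOp q × MatOp q) C := by
    intro k
    rw [mem_closedBall_zero_iff, Prod.norm_def, max_le_iff]
    exact ⟨(hb1 k).trans (le_max_left _ _), (hb2 k).trans (le_max_right _ _)⟩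
  have : ProperSpace (MatOp q) := FiniteDimensional.proper ℝ _
  obtain ⟨⟨T, T'⟩, -, φ, hφ, hT⟩ := tendsto_subseq_of_bounded Metric.isBounded_closedBall hmem
  have hT1 : Tendsto (fun k => N (φ k)) atTop (𝓝 T) := (Prod.tendsto_iff _ _).1 hT |>.1
  have hT2 : Tendsto (fun k => N' (φ k)) atTop (𝓝 T') := (Prod.tendsto_iff _ _).1 hT |>.2
  refine ⟨T, isRankPreserver_of_tendsto (fun k => hN (φ k)) (fun k => hN' (φ k))
    (fun k => h2 (φ k)) hT1 hT2, ?_⟩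
  exact tendsto_nhds_unique (hlim.comp hφ.tendsto_atTop) (tendsto_clm_comp tendsto_const_nhds hT1)

theorem rowScaling_rankPreserver {q d : ℕ} (hq : 0 < q) {L H : MatMap q d}
    {P : Matrix (Fin q) (Fin q) ℝ} (hP : IsInvSqrt (rowGram L) P)
    (hH : ∀ i, component H i = √(q : ℝ) • (P * component L i)) :
    ∃ N : MatOp q, IsRankPreserver N ∧ H = L ∘L N := by
  refine ⟨_, isRankPreserver_sandwich (A' := (√(q : ℝ))⁻¹ • (P * rowGram L)) (B' := 1) ?_
    (Matrix.one_mul 1), rowScaling_eq hP hH⟩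
  have : √(q : ℝ) ≠ 0 := (Real.sqrt_pos.2 (by exact_mod_cast hq)).ne'
  rw [Matrix.smul_mul, Matrix.mul_smul, smul_smul, inv_mul_cancel₀ this, one_smul, hP.2]

theorem SinkhornStep.rankPreserver {q d : ℕ} (hq : 0 < q) {K K' : MatMap q d}
    (h : SinkhornStep K K') : ∃ N : MatOp q, IsRankPreserver N ∧ K' = K ∘L N := by
  obtain ⟨H, P, Q, hP, hH, hQ, hK'⟩ := h
  obtain ⟨N, hN, hHN⟩ := rowScaling_rankPreserver hq hP hH
  obtain ⟨hQ', hK''⟩ := colScaling_transpose hQ hK'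
  obtain ⟨N', hN', hKN⟩ := rowScaling_rankPreserver hq hQ' hK''
  refine ⟨N ∘L (transposeOp q ∘L (N' ∘L transposeOp q)), hN.comp (isRankPreserver_transposeOp.comp
    (hN'.comp isRankPreserver_transposeOp)), ?_⟩
  rw [← comp_transposeOp_comp_transposeOp K', hKN, hHN]
  rfl

/-- An Operator Sinkhorn sequence converges geometrically towards maps with normalized rows and
columns. -/
theorem sinkhorn_sequence {q d : ℕ} (hq : 0 < q) {L : MatMap q d} {μ : ℝ} (hμ : 0 < μ)
    (hL : DyadLower L μ) {K : ℕ → MatMap q d} (h0 : K 0 = L)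
    (hK : ∀ k, SinkhornStep (K k) (K (k + 1))) :
    ∃ C θ m : ℝ, 0 ≤ θ ∧ θ < 1 ∧ 0 < m ∧ ∀ k, ColScaled L (K (k + 1)) ∧
      (∃ N : MatOp q, IsRankPreserver N ∧ K (k + 1) = L ∘L N) ∧
      DyadLower (K (k + 1)) m ∧ ‖K (k + 2) - K (k + 1)‖ ≤ C * θ ^ k ∧
      ∃ H : MatMap q d, rowGram H = (q : ℝ) • (1 : Matrix (Fin q) (Fin q) ℝ) ∧
        ‖H - K (k + 1)‖ ≤ C * θ ^ k := by
  have hq0 : (0 : ℝ) < q := by exact_mod_cast hq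
  have hup := dyadUpper_norm L
  have hμ₂ : 0 < ‖L‖ ^ 2 := by
    have h1 := (hL (EuclideanSpace.single ⟨0, hq⟩ 1) (EuclideanSpace.single ⟨0, hq⟩ 1)).trans
      (hup _ _)
    simp at h1
    linarith
  set m := μ ^ 2 / (‖L‖ ^ 2) ^ 2 with hm
  have hm0 : 0 < m := by positivity
  have hscaled : ∀ k, ∃ A B, K k = L ∘L sandwich A B := by
    intro k
    induction k with
    | zero => exact ⟨1, 1, by rw [h0, sandwich_one_one, ContinuousLinearMap.comp_id]⟩
    | succ k ih =>
      obtain ⟨A, B, hAB⟩ := ih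
      obtain ⟨A', B', -, h1, -⟩ := (hK k).colScaled hAB
      exact ⟨A', B', h1⟩
  have hcol : ∀ k, ColScaled L (K (k + 1)) := fun k => by
    obtain ⟨A, B, hAB⟩ := hscaled k
    exact (hK k).colScaled hAB
  have hrp : ∀ k, ∃ N : MatOp q, IsRankPreserver N ∧ K k = L ∘L N := by
    intro k
    induction k with
    | zero => exact ⟨_, isRankPreserver_id, by rw [h0, ContinuousLinearMap.comp_id]⟩
    | succ k ih =>
      obtain ⟨N, hN, hKN⟩ := ih
      obtain ⟨N', hN', hKN'⟩ := (hK k).rankPreserver hq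
      exact ⟨N ∘L N', hN.comp hN', by rw [hKN', hKN, ContinuousLinearMap.comp_assoc]⟩
  have hlow : ∀ k, DyadLower (K (k + 1)) m := fun k => (hcol k).dyadLower hq hL hup hμ hμ₂
  set ρ : ℕ → ℝ := fun k => (q : ℝ) ^ 2 / m * ((1 - m) ^ 2) ^ k with hρ
  have hρ0 : ∀ k, 0 ≤ ρ k := fun k => by positivity
  have hinv : ∀ k, ∃ α : ℝ, 0 < α ∧ (∀ x, α * (q * ‖x‖ ^ 2) ≤ rowQuad (K (k + 1)) x) ∧
      ∀ x, rowQuad (K (k + 1)) x ≤ α * (1 + ρ k) * (q * ‖x‖ ^ 2) := by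
    intro k
    induction k with
    | zero =>
      refine ⟨m, hm0, (hlow 0).rowQuad_ge, fun x => ?_⟩
      obtain ⟨A, B, B', h1, h2, h3⟩ := hcol 0
      have h4 : ‖K 1‖ ≤ q := norm_le_of_hs _ hq0.le (hsSq_of_colGram h2).le
      refine ((dyadUpper_norm (K 1)).rowQuad_le x).trans ?_
      gcongr
      have h5 : m * (1 + ρ 0) = m + (q : ℝ) ^ 2 := by
        rw [hρ]
        field_simp
      rw [h5]
      have := pow_le_pow_left₀ (norm_nonneg _) h4 2
      linarith
    | succ k ih =>
      obtain ⟨α, hα, hl, hu⟩ := ih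
      obtain ⟨-, ⟨α', hα', hl', hu'⟩, -, -⟩ :=
        (hK (k + 1)).contract hq hL hup hμ hμ₂ (hcol k) hα (hρ0 k) hl hu
      refine ⟨α', hα', hl', fun x => (hu' x).trans (le_of_eq ?_)⟩
      have h5 : (1 - m) ^ 2 * ρ k = ρ (k + 1) := by
        simp only [hρ]
        ring
      rw [h5]
  have hm1 : m ≤ 1 := by
    obtain ⟨α, hα, hl, hu⟩ := hinv 0
    exact ((hK 1).contract hq hL hup hμ hμ₂ (hcol 0) hα (hρ0 0) hl hu).1
  refine ⟨2 * (q * ((q : ℝ) ^ 2 / m)), (1 - m) ^ 2, m, sq_nonneg _, ?_, hm0, fun k => ?_⟩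
  · nlinarith
  · obtain ⟨α, hα, hl, hu⟩ := hinv k
    obtain ⟨-, -, h1, H, h2, h3⟩ :=
      (hK (k + 1)).contract hq hL hup hμ hμ₂ (hcol k) hα (hρ0 k) hl hu
    have h4 : 2 * (q * ρ k) = 2 * (q * ((q : ℝ) ^ 2 / m)) * ((1 - m) ^ 2) ^ k := by
      simp only [hρ]
      ring
    refine ⟨hcol k, hrp (k + 1), hlow k, h4 ▸ h1, H, h2, h4 ▸ h3.trans ?_⟩
    have : 0 ≤ q * ρ k := mul_nonneg hq0.le (hρ0 k)
    linarith

theorem continuous_rowQuad {q d : ℕ} (x : EuclideanSpace ℝ (Fin q)) :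
    Continuous fun L : MatMap q d => rowQuad L x := by
  unfold rowQuad
  refine continuous_finsetSum _ fun b _ => ?_
  exact ((ContinuousLinearMap.apply ℝ (EuclideanSpace ℝ (Fin d))
    (dyad x (EuclideanSpace.single b 1))).continuous.norm).pow 2

theorem rowGram_of_tendsto {q d : ℕ} {K : ℕ → MatMap q d} {L : MatMap q d}
    (h : Tendsto K atTop (𝓝 L))
    (hK : ∀ k, rowGram (K k) = (q : ℝ) • (1 : Matrix (Fin q) (Fin q) ℝ)) :
    rowGram L = (q : ℝ) • (1 : Matrix (Fin q) (Fin q) ℝ) := by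
  refine rowGram_of_rowQuad fun x => ?_
  refine tendsto_nhds_unique (((continuous_rowQuad x).tendsto L).comp h) ?_
  have : (fun L => rowQuad L x) ∘ K = fun _ => q * ‖x‖ ^ 2 :=
    funext fun k => rowQuad_of_rowGram (hK k) x
  rw [this]
  exact tendsto_const_nhds

/-- The limits of Operator Sinkhorn are normalized, and differ from the starting point by a
rank-preserver. -/
theorem SinkhornReturns.spec {q d : ℕ} (hq : 0 < q) {L Lhat : MatMap q d} {μ : ℝ} (hμ : 0 < μ)
    (hL : DyadLower L μ) (h : SinkhornReturns L Lhat) :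
    IsNormalized Lhat ∧ ∃ N : MatOp q, IsRankPreserver N ∧ Lhat = L ∘L N := by
  obtain ⟨K, h0, hK, hlim⟩ := h
  obtain ⟨C, θ, m, hθ0, hθ1, hm, hk⟩ := sinkhorn_sequence hq hμ hL h0 hK
  choose hcol hrp hlow hdiff H hH1 hH2 using hk
  choose N hN hKN using hrp
  have hlim1 : Tendsto (fun k => K (k + 1)) atTop (𝓝 Lhat) := (tendsto_add_atTop_iff_nat 1).2 hlim
  have hcolGram : ∀ k, colGram (K (k + 1)) = (q : ℝ) • (1 : Matrix (Fin q) (Fin q) ℝ) := fun k => by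
    obtain ⟨A, B, B', -, h2, -⟩ := hcol k
    exact h2
  refine ⟨⟨?_, ?_⟩, ?_⟩
  · refine rowGram_of_tendsto (K := H) ?_ hH1
    have h1 : Tendsto (fun k => H k - K (k + 1)) atTop (𝓝 0) := by
      refine squeeze_zero_norm hH2 ?_
      simpa using (tendsto_pow_atTop_nhds_zero_of_lt_one hθ0 hθ1).const_mul C
    simpa using h1.add hlim1
  · rw [← rowGram_comp_transposeOp]
    refine rowGram_of_tendsto (K := fun k => K (k + 1) ∘L transposeOp q)
      (tendsto_clm_comp hlim1 tendsto_const_nhds) fun k => ?_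
    rw [rowGram_comp_transposeOp, hcolGram]
  · refine exists_rankPreserver_of_tendsto (m := m) (c := (q : ℝ) ^ 2) hμ hL hm hN
      (fun k => hKN k ▸ hlow k) (fun k x y => ?_) (by simpa only [← hKN] using hlim1)
    rw [← hKN]
    refine (dyadUpper_norm _ x y).trans ?_
    have := norm_le_of_hs _ (Nat.cast_nonneg q) (hsSq_of_colGram (hcolGram k)).le
    gcongr

theorem DyadLower.comp_rankPreserver {q d : ℕ} {L : MatMap q d} {m : ℝ} (hm : 0 < m)
    (hL : DyadLower L m) {N : MatOp q} (hN : IsRankPreserver N) :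
    ∃ m' : ℝ, 0 < m' ∧ DyadLower (L ∘L N) m' := by
  obtain ⟨N', hN', h1, h2⟩ := hN.exists_inverse
  have hpos : 0 < ‖N'‖ ^ 2 + 1 := by positivity
  refine ⟨m / (‖N'‖ ^ 2 + 1), by positivity, fun x y => ?_⟩
  obtain ⟨u, v, huv⟩ := exists_dyad_of_rank_le_one ((hN (dyad x y)).trans_le (rank_dyad_le x y))
  rw [ContinuousLinearMap.comp_apply, huv]
  refine le_trans ?_ (hL u v)
  rw [← norm_sq_dyad, ← norm_sq_dyad, ← huv, div_mul_eq_mul_div, div_le_iff₀ hpos, mul_assoc]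
  refine mul_le_mul_of_nonneg_left ?_ hm.le
  have h5 : dyad x y = N' (N (dyad x y)) :=
    (congrArg (fun S : MatOp q => S (dyad x y)) h2).symm
  have h6 : ‖dyad x y‖ ^ 2 ≤ (‖N'‖ * ‖N (dyad x y)‖) ^ 2 := by
    refine pow_le_pow_left₀ (norm_nonneg _) ?_ 2
    conv_lhs => rw [h5]
    exact N'.le_opNorm _
  nlinarith [sq_nonneg ‖N (dyad x y)‖]

theorem exists_sinkhornStep {q d : ℕ} (hq : 0 < q) {L : MatMap q d} {m : ℝ} (hm : 0 < m)
    (hL : DyadLower L m) : ∃ L' m', SinkhornStep L L' ∧ 0 < m' ∧ DyadLower L' m' := by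
  obtain ⟨H, P, hP, hH⟩ := exists_rowScaling hL hm
  obtain ⟨N, hN, hHN⟩ := rowScaling_rankPreserver hq hP hH
  obtain ⟨m₁, hm₁, h1⟩ := hL.comp_rankPreserver hm hN
  rw [← hHN] at h1
  obtain ⟨K, Q, hQ, hK⟩ := exists_rowScaling h1.comp_transposeOp hm₁
  have hstep : SinkhornStep L (K ∘L transposeOp q) := by
    refine ⟨H, P, Q, hP, hH, by rwa [← rowGram_comp_transposeOp], fun i => ?_⟩
    rw [component_comp_transposeOp, hK, component_comp_transposeOp, Matrix.transpose_smul,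
      Matrix.transpose_mul, hQ.transpose_eq, Matrix.transpose_transpose]
  obtain ⟨N', hN', hKN⟩ := hstep.rankPreserver hq
  obtain ⟨m₂, hm₂, h2⟩ := hL.comp_rankPreserver hm hN'
  exact ⟨_, m₂, hstep, hm₂, hKN ▸ h2⟩

/-- Operator Sinkhorn converges from maps that are nondegenerate on dyads. -/
theorem exists_sinkhornReturns {q d : ℕ} (hq : 0 < q) {L : MatMap q d} {μ : ℝ} (hμ : 0 < μ)
    (hL : DyadLower L μ) : ∃ Lhat, SinkhornReturns L Lhat := by
  let S := {K : MatMap q d // ∃ m : ℝ, 0 < m ∧ DyadLower K m}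
  have hstep : ∀ K : S, ∃ K' : S, SinkhornStep K.1 K'.1 := by
    rintro ⟨K, m, hm, hK⟩
    obtain ⟨K', m', h1, h2⟩ := exists_sinkhornStep hq hm hK
    exact ⟨⟨K', m', h2⟩, h1⟩
  choose f hf using hstep
  let K : ℕ → S := fun k => Nat.rec ⟨L, μ, hμ, hL⟩ (fun _ K => f K) k
  have hK : ∀ k, SinkhornStep (K k).1 (K (k + 1)).1 := fun k => hf (K k)
  obtain ⟨C, θ, m, hθ0, hθ1, hm, hk⟩ :=
    sinkhorn_sequence (K := fun k => (K k).1) hq hμ hL rfl hK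
  have hc : CauchySeq fun k => (K (k + 1)).1 := by
    refine cauchySeq_of_le_geometric θ C hθ1 fun k => ?_
    rw [dist_comm, dist_eq_norm]
    exact (hk k).2.2.2.1
  obtain ⟨Lhat, hlim⟩ := cauchySeq_tendsto_of_complete hc
  exact ⟨Lhat, fun k => (K k).1, rfl, hK, (tendsto_add_atTop_iff_nat 1).1 hlim⟩

end

section

/-! ### The structure of rank-preservers -/

/-- The bilinear map `(x, y) ↦ x y'`. -/
noncomputable def dyadBilin (q : ℕ) :
    EuclideanSpace ℝ (Fin q) →ₗ[ℝ] EuclideanSpace ℝ (Fin q) →ₗ[ℝ] MatSp q :=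
  LinearMap.mk₂ ℝ dyad
    (fun x x' y => by ext p; simp [dyad_apply, add_mul])
    (fun c x y => by ext p; simp [dyad_apply, mul_assoc])
    (fun x y y' => by ext p; simp [dyad_apply, mul_add])
    (fun c x y => by ext p; simp [dyad_apply]; ring)

theorem dyadBilin_apply {q : ℕ} (x y : EuclideanSpace ℝ (Fin q)) :
    dyadBilin q x y = dyad x y := rfl

theorem dyadBilin_flip_apply {q : ℕ} (x y : EuclideanSpace ℝ (Fin q)) :
    (dyadBilin q).flip y x = dyad x y := rfl

theorem dyad_eq_zero_iff {q : ℕ} {x y : EuclideanSpace ℝ (Fin q)} :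
    dyad x y = 0 ↔ x = 0 ∨ y = 0 := by
  rw [← norm_eq_zero, ← sq_eq_zero_iff, norm_sq_dyad, mul_eq_zero, sq_eq_zero_iff,
    sq_eq_zero_iff, norm_eq_zero, norm_eq_zero]

theorem exists_apply_ne_zero {q : ℕ} {x : EuclideanSpace ℝ (Fin q)} (hx : x ≠ 0) :
    ∃ i, x i ≠ 0 := by
  by_contra! h
  exact hx (by ext i; simpa using h i)

theorem exists_smul_of_dyad_eq_left {q : ℕ} {a b a' b' : EuclideanSpace ℝ (Fin q)}
    (hb : b ≠ 0) (h : dyad a b = dyad a' b') : ∃ k : ℝ, a = k • a' := by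
  obtain ⟨j, hj⟩ := exists_apply_ne_zero hb
  refine ⟨b' j / b j, ?_⟩
  ext i
  have h1 := congrArg (fun Z : MatSp q => Z (i, j)) h
  simp only [dyad_apply] at h1
  rw [PiLp.smul_apply, smul_eq_mul]
  field_simp
  linarith

/-- If the sum of two dyads has rank at most one, they share a column or a row. -/
theorem exists_smul_of_dyad_add_dyad {q : ℕ} {a b c d : EuclideanSpace ℝ (Fin q)} (ha : a ≠ 0)
    (hb : b ≠ 0) (h : (mat (dyad a b + dyad c d)).rank ≤ 1) :
    (∃ k : ℝ, c = k • a) ∨ ∃ k : ℝ, d = k • b := by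
  obtain ⟨u, v, huv⟩ := exists_dyad_of_rank_le_one h
  have hent : ∀ i j, a i * b j + c i * d j = u i * v j := fun i j =>
    congrArg (fun Z : MatSp q => Z (i, j)) huv
  have hminor : ∀ i k j l, (a i * c k - a k * c i) * (b j * d l - b l * d j) = 0 := by
    intro i k j l
    have e1 := hent i j
    have e2 := hent k l
    have e3 := hent i l
    have e4 := hent k j
    have : (a i * c k - a k * c i) * (b j * d l - b l * d j) =
        (a i * b j + c i * d j) * (a k * b l + c k * d l) -
          (a i * b l + c i * d l) * (a k * b j + c k * d j) := by ring
    rw [this, e1, e2, e3, e4]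
    ring
  obtain ⟨i, hi⟩ := exists_apply_ne_zero ha
  obtain ⟨j, hj⟩ := exists_apply_ne_zero hb
  by_cases hc : ∀ k, a i * c k - a k * c i = 0
  · refine Or.inl ⟨c i / a i, ?_⟩
    ext k
    have h1 := hc k
    rw [PiLp.smul_apply, smul_eq_mul]
    field_simp
    linarith
  · push Not at hc
    obtain ⟨k, hk⟩ := hc
    refine Or.inr ⟨d j / b j, ?_⟩
    ext l
    have h1 := (mul_eq_zero.1 (hminor i k j l)).resolve_left hk
    rw [PiLp.smul_apply, smul_eq_mul]
    field_simp
    linarith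

theorem forall_mem_or_forall_mem {V : Type*} [AddCommGroup V] [Module ℝ V]
    (S T : Submodule ℝ V) (h : ∀ y, y ∈ S ∨ y ∈ T) : (∀ y, y ∈ S) ∨ ∀ y, y ∈ T := by
  by_contra! hcon
  obtain ⟨⟨y, hy⟩, z, hz⟩ := hcon
  have hy' := (h y).resolve_left hy
  have hz' := (h z).resolve_right hz
  rcases h (y + z) with h1 | h1
  · exact hy ((Submodule.add_mem_iff_left S hz').1 h1)
  · exact hz ((Submodule.add_mem_iff_right T hy').1 h1)

/-- A linear space of matrices of rank at most one has a common column or a common row. -/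
theorem exists_common_factor {V : Type*} [AddCommGroup V] [Module ℝ V] {q : ℕ}
    (T : V →ₗ[ℝ] MatSp q) (hT : T ≠ 0) (hrank : ∀ y, (mat (T y)).rank ≤ 1) :
    (∃ a ≠ 0, ∀ y, T y ∈ (dyadBilin q a).range) ∨
      ∃ b ≠ 0, ∀ y, T y ∈ ((dyadBilin q).flip b).range := by
  obtain ⟨y₀, hy₀⟩ : ∃ y, T y ≠ 0 := by
    by_contra! h
    exact hT (LinearMap.ext h)
  obtain ⟨a, b, hab⟩ := exists_dyad_of_rank_le_one (hrank y₀)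
  rw [hab, Ne, dyad_eq_zero_iff, not_or] at hy₀
  have key : ∀ y, y ∈ (dyadBilin q a).range.comap T ∨
      y ∈ ((dyadBilin q).flip b).range.comap T := by
    intro y
    obtain ⟨c, d, hcd⟩ := exists_dyad_of_rank_le_one (hrank y)
    have h1 := hrank (y₀ + y)
    rw [map_add, hab, hcd] at h1
    rcases exists_smul_of_dyad_add_dyad hy₀.1 hy₀.2 h1 with ⟨k, rfl⟩ | ⟨k, rfl⟩
    · refine Or.inl ⟨k • d, ?_⟩
      rw [map_smul, hcd, ← dyadBilin_apply (k • a), map_smul, LinearMap.smul_apply]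
    · refine Or.inr ⟨k • c, ?_⟩
      rw [map_smul, hcd, ← dyadBilin_apply c, map_smul, dyadBilin_flip_apply, dyadBilin_apply]
  rcases forall_mem_or_forall_mem _ _ key with h | h
  · exact Or.inl ⟨a, hy₀.1, h⟩
  · exact Or.inr ⟨b, hy₀.2, h⟩

theorem not_forall_mem_of_injective {V W : Type*} [AddCommGroup V] [Module ℝ V]
    [AddCommGroup W] [Module ℝ W] [Module.Finite ℝ W] (T : V →ₗ[ℝ] W)
    (hT : Function.Injective T) (S : Submodule ℝ W)
    (hS : Module.finrank ℝ S < Module.finrank ℝ V) : ¬ ∀ y, T y ∈ S := by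
  intro h
  have h1 : Function.Injective (T.codRestrict S h) := fun x y hxy => hT (congrArg Subtype.val hxy)
  exact absurd (LinearMap.finrank_le_finrank_of_injective h1) (not_le.2 hS)

theorem dyadBilin_injective {q : ℕ} {x : EuclideanSpace ℝ (Fin q)} (hx : x ≠ 0) :
    Function.Injective (dyadBilin q x) := by
  rw [← LinearMap.ker_eq_bot, LinearMap.ker_eq_bot']
  intro y hy
  exact (dyad_eq_zero_iff.1 hy).resolve_left hx

theorem dyadBilin_flip_injective {q : ℕ} {y : EuclideanSpace ℝ (Fin q)} (hy : y ≠ 0) :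
    Function.Injective ((dyadBilin q).flip y) := by
  rw [← LinearMap.ker_eq_bot, LinearMap.ker_eq_bot']
  intro x hx
  exact (dyad_eq_zero_iff.1 hx).resolve_right hy

/-- For each column vector `x`, the images of the dyads `x y'` share their column. -/
def PreservesColumns {q : ℕ} (M : MatOp q) : Prop :=
  ∀ x ≠ 0, ∃ a ≠ 0, ∀ y, M (dyad x y) ∈ (dyadBilin q a).range

theorem preservesColumns_or {q : ℕ} (hq : 2 ≤ q) {M : MatOp q} (hinj : Function.Injective M)
    (hrank : ∀ x y, (mat (M (dyad x y))).rank ≤ 1) :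
    PreservesColumns M ∨ PreservesColumns (transposeOp q ∘L M) := by
  have hV : Module.finrank ℝ (EuclideanSpace ℝ (Fin q)) = q := finrank_euclideanSpace_fin
  let T : EuclideanSpace ℝ (Fin q) → EuclideanSpace ℝ (Fin q) →ₗ[ℝ] MatSp q := fun x =>
    (M : MatSp q →ₗ[ℝ] MatSp q) ∘ₗ dyadBilin q x
  have hTinj : ∀ x ≠ 0, Function.Injective (T x) := fun x hx => hinj.comp (dyadBilin_injective hx)
  have hne : ∀ x ≠ 0, T x ≠ 0 := by
    intro x hx h0
    refine not_forall_mem_of_injective (T x) (hTinj x hx) ⊥ ?_ fun y => by rw [h0]; rfl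
    rw [finrank_bot, hV]
    omega
  have htype := fun x hx => exists_common_factor (T x) (hne x hx) (hrank x)
  by_contra! hcon
  obtain ⟨h1, h2⟩ := hcon
  unfold PreservesColumns at h1 h2
  push Not at h1 h2
  obtain ⟨x₁, hx₁, h1⟩ := h1
  obtain ⟨x₂, hx₂, h2⟩ := h2
  have hR := (htype x₁ hx₁).resolve_left fun ⟨a, ha, h⟩ => by
    obtain ⟨y, hy⟩ := h1 a ha
    exact hy (h y)
  have hC := (htype x₂ hx₂).resolve_right fun ⟨b, hb, h⟩ => by
    obtain ⟨y, hy⟩ := h2 b hb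
    refine hy ?_
    obtain ⟨u, hu⟩ := h y
    refine ⟨u, ?_⟩
    change dyad b u = transposeOp q (M (dyad x₂ y))
    rw [← transposeOp_dyad]
    exact congrArg (transposeOp q) hu
  obtain ⟨b, hb, hR⟩ := hR
  obtain ⟨a, ha, hC⟩ := hC
  have hspan : Module.finrank ℝ (Submodule.span ℝ {dyad a b}) < q := by
    rw [finrank_span_singleton (fun h => (dyad_eq_zero_iff.1 h).elim ha hb)]
    omega
  have key : ∀ y, y ∈ (Submodule.span ℝ {dyad a b}).comap (T x₁) ∨
      y ∈ (Submodule.span ℝ {dyad a b}).comap (T x₂) := by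
    intro y
    by_cases hy : y = 0
    · rw [hy]; exact Or.inl (Submodule.zero_mem _)
    obtain ⟨h, hh⟩ := hR y
    obtain ⟨g, hg⟩ := hC y
    have hg0 : g ≠ 0 := by
      rintro rfl
      rw [map_zero] at hg
      exact hy (hTinj x₂ hx₂ (by rw [← hg, map_zero]))
    have h3 := hrank (x₂ + x₁) y
    rw [← dyadBilin_apply, map_add, LinearMap.add_apply, map_add] at h3
    have h4 : dyad a g = M (dyadBilin q x₂ y) := hg
    have h5 : dyad h b = M (dyadBilin q x₁ y) := hh
    rw [← h4, ← h5] at h3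
    rcases exists_smul_of_dyad_add_dyad ha hg0 h3 with ⟨k, hk⟩ | ⟨k, hk⟩
    · refine Or.inl (Submodule.mem_span_singleton.2 ⟨k, ?_⟩)
      rw [← smul_dyad_left, ← hk]
      exact h5
    · have hk0 : k ≠ 0 := by
        rintro rfl
        exact hb (by rw [hk, zero_smul])
      refine Or.inr (Submodule.mem_span_singleton.2 ⟨k⁻¹, ?_⟩)
      rw [hk, ← dyadBilin_apply, map_smul, smul_smul, inv_mul_cancel₀ hk0, one_smul]
      exact h4
  rcases forall_mem_or_forall_mem _ _ key with h | h
  · exact not_forall_mem_of_injective (T x₁) (hTinj x₁ hx₁) _ (by rwa [hV]) h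
  · exact not_forall_mem_of_injective (T x₂) (hTinj x₂ hx₂) _ (by rwa [hV]) h

theorem eq_of_eq_on_single {q : ℕ} {M N : MatOp q}
    (h : ∀ i j : Fin q, M (EuclideanSpace.single (i, j) 1) = N (EuclideanSpace.single (i, j) 1)) :
    M = N := by
  apply (opVec q).injective
  ext ⟨a, b⟩
  rw [opVec_apply, opVec_apply]
  exact congrArg (fun Z : MatSp q => Z a) (h b.1 b.2)

theorem PreservesColumns.exists_sandwich {q : ℕ} (hq : 2 ≤ q) {M : MatOp q}
    (hM : PreservesColumns M) (hinj : Function.Injective M)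
    (hrank : ∀ x y, (mat (M (dyad x y))).rank ≤ 1) : ∃ A B, M = sandwich A B := by
  have hV : Module.finrank ℝ (EuclideanSpace ℝ (Fin q)) = q := finrank_euclideanSpace_fin
  have hMdyad : ∀ {x y : EuclideanSpace ℝ (Fin q)}, x ≠ 0 → y ≠ 0 → M (dyad x y) ≠ 0 := by
    intro x y hx hy h0
    have := hinj (h0.trans (map_zero M).symm)
    exact (dyad_eq_zero_iff.1 this).elim hx hy
  have hrow : ∀ y ≠ 0, ∃ b ≠ 0, ∀ x, M (dyad x y) ∈ ((dyadBilin q).flip b).range := by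
    intro y hy
    let T : EuclideanSpace ℝ (Fin q) →ₗ[ℝ] MatSp q :=
      (M : MatSp q →ₗ[ℝ] MatSp q) ∘ₗ (dyadBilin q).flip y
    have hTinj : Function.Injective T := hinj.comp (dyadBilin_flip_injective hy)
    have hT0 : T ≠ 0 := by
      intro h0
      refine not_forall_mem_of_injective T hTinj ⊥ ?_ fun y => by rw [h0]; rfl
      rw [finrank_bot, hV]
      omega
    refine (exists_common_factor T hT0 fun x => hrank x y).resolve_left ?_
    rintro ⟨a, ha, h⟩
    have hall : ∀ x z, M (dyad x z) ∈ (dyadBilin q a).range := by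
      intro x z
      by_cases hx : x = 0
      · rw [hx, dyad_eq_zero_iff.2 (Or.inl rfl), map_zero]
        exact Submodule.zero_mem _
      obtain ⟨u, hu, hu'⟩ := hM x hx
      obtain ⟨w, hw⟩ := hu' y
      obtain ⟨w', hw'⟩ := h x
      have h1 : dyad u w = dyad a w' := hw.trans hw'.symm
      have hw0 : w ≠ 0 := by
        rintro rfl
        rw [map_zero] at hw
        exact hMdyad hx hy hw.symm
      obtain ⟨k, rfl⟩ := exists_smul_of_dyad_eq_left hw0 h1
      obtain ⟨v, hv⟩ := hu' z
      refine ⟨k • v, ?_⟩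
      rw [← hv, map_smul, map_smul, LinearMap.smul_apply]
    refine not_forall_mem_of_injective (M : MatSp q →ₗ[ℝ] MatSp q) hinj (dyadBilin q a).range ?_ ?_
    · refine (LinearMap.finrank_range_le _).trans_lt ?_
      rw [hV, finrank_euclideanSpace, Fintype.card_prod, Fintype.card_fin]
      nlinarith
    · intro Z
      have hZ : Z = ∑ p, Z p • EuclideanSpace.single p (1 : ℝ) := by
        ext p
        simp [Pi.single_apply]
      rw [hZ, map_sum]
      refine Submodule.sum_mem _ fun p _ => ?_
      rw [map_smul]
      refine Submodule.smul_mem _ _ ?_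
      have := hall (EuclideanSpace.single p.1 1) (EuclideanSpace.single p.2 1)
      rwa [dyad_single] at this
  have hlin : ∀ y ≠ 0, ∃ b ≠ 0, ∃ f : EuclideanSpace ℝ (Fin q) →ₗ[ℝ] EuclideanSpace ℝ (Fin q),
      ∀ x, M (dyad x y) = dyad (f x) b := by
    intro y hy
    obtain ⟨b, hb, h⟩ := hrow y hy
    obtain ⟨j, hj⟩ := exists_apply_ne_zero hb
    choose u hu using h
    refine ⟨b, hb, ⟨⟨u, fun x x' => ?_⟩, fun c x => ?_⟩, fun x => (hu x).symm⟩
    · apply dyadBilin_flip_injective hb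
      rw [hu, map_add, hu, hu, ← dyadBilin_apply, map_add, LinearMap.add_apply, map_add]
      rfl
    · apply dyadBilin_flip_injective hb
      change (dyadBilin q).flip b (u (c • x)) = (dyadBilin q).flip b (c • u x)
      rw [hu, map_smul, hu, smul_dyad_left, map_smul]
  obtain ⟨b₀, hb₀, f, hf⟩ := hlin (EuclideanSpace.single ⟨0, by omega⟩ 1) (by simp)
  set y₀ : EuclideanSpace ℝ (Fin q) := EuclideanSpace.single ⟨0, by omega⟩ 1 with hy₀
  have hy₀0 : y₀ ≠ 0 := by simp [hy₀]
  have hf0 : ∀ x ≠ 0, f x ≠ 0 := by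
    intro x hx h0
    refine hMdyad hx hy₀0 ?_
    rw [hf, h0]
    exact dyad_eq_zero_iff.2 (Or.inl rfl)
  have hfinj : Function.Injective f := by
    rw [← LinearMap.ker_eq_bot, LinearMap.ker_eq_bot']
    intro x hx
    by_contra h
    exact hf0 x h hx
  let e := LinearEquiv.ofInjectiveEndo f hfinj
  have he : ∀ z, f (e.symm z) = z := fun z => e.apply_symm_apply z
  have hg : ∀ y ≠ 0, ∃ g, ∀ x, M (dyad x y) = dyad (f x) g := by
    intro y hy
    obtain ⟨b, hb, h, hh⟩ := hlin y hy
    have hpar : ∀ x ≠ 0, ∃ k : ℝ, h x = k • f x := by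
      intro x hx
      obtain ⟨a, ha, hax⟩ := hM x hx
      obtain ⟨w, hw⟩ := hax y₀
      obtain ⟨w', hw'⟩ := hax y
      have h1 : dyad a w = dyad (f x) b₀ := hw.trans (hf x)
      have h2 : dyad (h x) b = dyad a w' := (hh x).symm.trans hw'.symm
      have hw0 : w ≠ 0 := by
        rintro rfl
        rw [map_zero] at hw
        exact hMdyad hx hy₀0 hw.symm
      obtain ⟨k, hk⟩ := exists_smul_of_dyad_eq_left hw0 h1
      obtain ⟨k', hk'⟩ := exists_smul_of_dyad_eq_left hb h2
      exact ⟨k' * k, by rw [hk', hk, smul_smul]⟩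
    obtain ⟨c, hc⟩ := LinearMap.exists_eq_smul_id_of_forall_notLinearIndependent
      (f := h ∘ₗ e.symm.toLinearMap) (fun v => by
        by_cases hv : v = 0
        · rw [hv]
          intro hli
          exact hli.ne_zero 0 rfl
        · rw [LinearIndependent.pair_iff' hv]
          push Not
          obtain ⟨k, hk⟩ := hpar (e.symm v) (by simpa using hv)
          refine ⟨k, ?_⟩
          rw [he] at hk
          exact hk.symm)
    refine ⟨c • b, fun x => ?_⟩
    have h1 := congrArg (fun S : EuclideanSpace ℝ (Fin q) →ₗ[ℝ] EuclideanSpace ℝ (Fin q) =>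
      S (f x)) hc
    have h2 : e.symm (f x) = x := e.symm_apply_apply x
    simp only [LinearMap.comp_apply, LinearEquiv.coe_coe, h2, LinearMap.smul_apply,
      Module.End.one_apply] at h1
    rw [hh, h1, smul_dyad_left, ← dyadBilin_apply, ← dyadBilin_apply, map_smul]
  choose g hg using fun j : Fin q => hg (EuclideanSpace.single j 1) (by simp)
  refine ⟨Matrix.of fun a i => f (EuclideanSpace.single i 1) a, Matrix.of fun j b => g j b,
    eq_of_eq_on_single fun i j => ?_⟩
  rw [← dyad_single, mat_sandwich_dyad, hg]
  congr 1
  · ext a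
    simp [Matrix.toEuclideanLin]
  · ext a
    simp [Matrix.toEuclideanLin]

/-- Every rank-preserver is a two-sided multiplication, possibly followed by a transposition. -/
theorem IsRankPreserver.exists_sandwich {q : ℕ} (hq : 2 ≤ q) {M : MatOp q}
    (hM : IsRankPreserver M) :
    ∃ A B, M = sandwich A B ∨ M = transposeOp q ∘L sandwich A B := by
  have hinv : ∀ {N : MatOp q}, IsRankPreserver N → Function.Injective N ∧
      ∀ x y, (mat (N (dyad x y))).rank ≤ 1 := by
    intro N hN
    obtain ⟨N', -, -, h2⟩ := hN.exists_inverse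
    refine ⟨Function.LeftInverse.injective (g := N') fun X => ?_,
      fun x y => (hN _).trans_le (rank_dyad_le x y)⟩
    exact congrArg (fun S : MatOp q => S X) h2
  have hTM := isRankPreserver_transposeOp.comp hM
  rcases preservesColumns_or hq (hinv hM).1 (hinv hM).2 with h | h
  · obtain ⟨A, B, hAB⟩ := h.exists_sandwich hq (hinv hM).1 (hinv hM).2
    exact ⟨A, B, Or.inl hAB⟩
  · obtain ⟨A, B, hAB⟩ := h.exists_sandwich hq (hinv hTM).1 (hinv hTM).2
    refine ⟨A, B, Or.inr ?_⟩
    rw [← hAB]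
    rfl

end

section
open scoped Matrix.Norms.L2Operator

/-! ### Normalization forces rank-preservers to be near isometries -/

theorem adjoint_bounds {V : Type*} [NormedAddCommGroup V] [InnerProductSpace ℝ V]
    [FiniteDimensional ℝ V] [CompleteSpace V] (S : V →L[ℝ] V) {α β : ℝ} (hα : 0 < α)
    (h : ∀ y, α * ‖y‖ ^ 2 ≤ ‖S y‖ ^ 2 ∧ ‖S y‖ ^ 2 ≤ β * ‖y‖ ^ 2) (z : V) :
    α * ‖z‖ ^ 2 ≤ ‖ContinuousLinearMap.adjoint S z‖ ^ 2 ∧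
      ‖ContinuousLinearMap.adjoint S z‖ ^ 2 ≤ β * ‖z‖ ^ 2 := by
  set w := ContinuousLinearMap.adjoint S z with hw
  constructor
  · have hinj : Function.Injective (S : V →ₗ[ℝ] V) := by
      rw [← LinearMap.ker_eq_bot, LinearMap.ker_eq_bot']
      intro y hy
      have h1 := (h y).1
      have h2 : S y = 0 := hy
      rw [h2, norm_zero] at h1
      have h3 : ‖y‖ ^ 2 ≤ 0 := by nlinarith
      exact norm_eq_zero.1 (pow_eq_zero_iff two_ne_zero |>.1 (le_antisymm h3 (sq_nonneg _)))
    obtain ⟨y, hy⟩ := LinearMap.surjective_of_injective hinj z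
    have hy' : S y = z := hy
    have h1 : ‖z‖ ^ 2 = inner ℝ w y := by
      rw [hw, ContinuousLinearMap.adjoint_inner_left, hy', real_inner_self_eq_norm_sq]
    have h2 := real_inner_le_norm w y
    have h3 := (h y).1
    rw [hy'] at h3
    rw [← h1] at h2
    by_cases hz : ‖z‖ = 0
    · rw [hz]
      nlinarith [sq_nonneg ‖w‖]
    have hz0 : 0 < ‖z‖ ^ 2 := by positivity
    have h4 : (‖z‖ ^ 2) ^ 2 ≤ ‖w‖ ^ 2 * ‖y‖ ^ 2 := by
      rw [← mul_pow]
      exact pow_le_pow_left₀ hz0.le h2 2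
    have h5 : (α * ‖z‖ ^ 2) * ‖z‖ ^ 2 ≤ ‖w‖ ^ 2 * ‖z‖ ^ 2 := by
      nlinarith [mul_le_mul_of_nonneg_left h3 (sq_nonneg ‖w‖)]
    exact le_of_mul_le_mul_right h5 hz0
  · have h1 : ‖w‖ ^ 2 = inner ℝ z (S w) := by
      rw [← ContinuousLinearMap.adjoint_inner_left, ← hw, real_inner_self_eq_norm_sq]
    have h2 := real_inner_le_norm z (S w)
    have h3 := (h w).2
    rw [← h1] at h2
    by_cases hw0 : ‖w‖ = 0
    · have h4 := (h z).2
      rw [hw0]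
      nlinarith [sq_nonneg ‖S z‖]
    have hpos : 0 < ‖w‖ ^ 2 := by positivity
    have h4 : (‖w‖ ^ 2) ^ 2 ≤ ‖z‖ ^ 2 * ‖S w‖ ^ 2 := by
      rw [← mul_pow]
      exact pow_le_pow_left₀ hpos.le h2 2
    have h5 : ‖w‖ ^ 2 * ‖w‖ ^ 2 ≤ (β * ‖z‖ ^ 2) * ‖w‖ ^ 2 := by
      nlinarith [mul_le_mul_of_nonneg_left h3 (sq_nonneg ‖z‖)]
    exact le_of_mul_le_mul_right h5 hpos

theorem sum_norm_sq_comp_bounds {q d : ℕ}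
    (T : EuclideanSpace ℝ (Fin q) →L[ℝ] EuclideanSpace ℝ (Fin d))
    (S : EuclideanSpace ℝ (Fin q) →L[ℝ] EuclideanSpace ℝ (Fin q)) {α β : ℝ} (hα : 0 < α)
    (h : ∀ y, α * ‖y‖ ^ 2 ≤ ‖S y‖ ^ 2 ∧ ‖S y‖ ^ 2 ≤ β * ‖y‖ ^ 2) :
    α * ∑ b, ‖T (EuclideanSpace.single b 1)‖ ^ 2 ≤
        ∑ b, ‖T (S (EuclideanSpace.single b 1))‖ ^ 2 ∧
      ∑ b, ‖T (S (EuclideanSpace.single b 1))‖ ^ 2 ≤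
        β * ∑ b, ‖T (EuclideanSpace.single b 1)‖ ^ 2 := by
  have hsum : ∀ R : EuclideanSpace ℝ (Fin q) →L[ℝ] EuclideanSpace ℝ (Fin d),
      ∑ b, ‖R (EuclideanSpace.single b 1)‖ ^ 2 =
        ∑ c, ‖ContinuousLinearMap.adjoint R (EuclideanSpace.single c 1)‖ ^ 2 := by
    intro R
    simp only [norm_sq_apply_eq_sum R]
    rw [Finset.sum_comm]
    simp only [sum_inner_single_sq]
  have h1 := hsum (T ∘L S)
  simp only [ContinuousLinearMap.comp_apply, ContinuousLinearMap.adjoint_comp] at h1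
  rw [h1, hsum T, Finset.mul_sum, Finset.mul_sum]
  exact ⟨Finset.sum_le_sum fun c _ => (adjoint_bounds S hα h _).1,
    Finset.sum_le_sum fun c _ => (adjoint_bounds S hα h _).2⟩

theorem norm_sq_ofMat_mul_bounds {q : ℕ} (A : Matrix (Fin q) (Fin q) ℝ) {α β : ℝ}
    (h : ∀ y, α * ‖y‖ ^ 2 ≤ ‖Matrix.toEuclideanLin A y‖ ^ 2 ∧
      ‖Matrix.toEuclideanLin A y‖ ^ 2 ≤ β * ‖y‖ ^ 2) (B : Matrix (Fin q) (Fin q) ℝ) :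
    α * ‖ofMat B‖ ^ 2 ≤ ‖ofMat (A * B)‖ ^ 2 ∧ ‖ofMat (A * B)‖ ^ 2 ≤ β * ‖ofMat B‖ ^ 2 := by
  rw [← sum_norm_sq_toEuclideanLin, ← sum_norm_sq_toEuclideanLin, Finset.mul_sum, Finset.mul_sum]
  have h1 : ∀ b : Fin q, Matrix.toEuclideanLin (A * B) (EuclideanSpace.single b 1) =
      Matrix.toEuclideanLin A (Matrix.toEuclideanLin B (EuclideanSpace.single b 1)) := by
    intro b
    ext c
    simp [Matrix.toEuclideanLin]
  simp only [h1]
  exact ⟨Finset.sum_le_sum fun c _ => (h _).1, Finset.sum_le_sum fun c _ => (h _).2⟩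

/-- If `K` is a near isometry on dyads with nearly normalized rows, and `K ∘ (A · B)` is
normalized, then `A · B` is a near isometry. -/
theorem sandwich_near_isometry {q d : ℕ} (hq : 0 < q) {K : MatMap q d} {a b c₁ c₂ : ℝ}
    (ha : 0 < a) (hc₁ : 0 < c₁) (hl : DyadLower K a) (hu : DyadUpper K b)
    (hrow : ∀ z, c₁ * (q * ‖z‖ ^ 2) ≤ rowQuad K z ∧ rowQuad K z ≤ c₂ * (q * ‖z‖ ^ 2))
    {A B : Matrix (Fin q) (Fin q) ℝ} (hN : IsNormalized (K ∘L sandwich A B)) (X : MatSp q) :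
    a / (b * c₂) * ‖X‖ ^ 2 ≤ ‖sandwich A B X‖ ^ 2 ∧
      ‖sandwich A B X‖ ^ 2 ≤ b / (a * c₁) * ‖X‖ ^ 2 := by
  have hq0 : (0 : ℝ) < q := by exact_mod_cast hq
  set e : EuclideanSpace ℝ (Fin q) := EuclideanSpace.single ⟨0, hq⟩ 1 with he
  have he1 : ‖e‖ = 1 := by simp [he]
  have hb : 0 < b := by
    have := (hl e e).trans (hu e e)
    rw [he1] at this
    linarith
  have hc₂ : 0 < c₂ := by
    have := (hrow e).1.trans (hrow e).2
    rw [he1] at this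
    nlinarith
  set w := ‖ofMat A‖ ^ 2 with hw
  have hcol := fun y => colScaled_bounds hl hu hN.2 y
  have hw0 : 0 < w := by
    refine lt_of_le_of_ne (sq_nonneg _) fun h0 => ?_
    have := (hcol e).2
    rw [← hw, ← h0, mul_zero, mul_zero, he1] at this
    linarith
  have hB : ∀ y, q / (b * w) * ‖y‖ ^ 2 ≤ ‖Matrix.toEuclideanLin B.transpose y‖ ^ 2 ∧
      ‖Matrix.toEuclideanLin B.transpose y‖ ^ 2 ≤ q / (a * w) * ‖y‖ ^ 2 := by
    intro y
    obtain ⟨h1, h2⟩ := hcol y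
    rw [div_mul_eq_mul_div, div_le_iff₀ (by positivity), div_mul_eq_mul_div,
      le_div_iff₀ (by positivity)]
    constructor <;> linarith
  have hA : ∀ x, a * w / (q * c₂) * ‖x‖ ^ 2 ≤ ‖Matrix.toEuclideanLin A x‖ ^ 2 ∧
      ‖Matrix.toEuclideanLin A x‖ ^ 2 ≤ b * w / (q * c₁) * ‖x‖ ^ 2 := by
    intro x
    have h1 := rowQuad_of_rowGram hN.1 x
    have h2 := sum_norm_sq_comp_bounds (dyadLeft (K ∘L transposeOp q) (Matrix.toEuclideanLin A x))
      (LinearMap.toContinuousLinearMap (Matrix.toEuclideanLin B.transpose))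
      (by positivity : 0 < q / (b * w)) hB
    simp only [dyadLeft_apply, ContinuousLinearMap.comp_apply, transposeOp_dyad,
      LinearMap.coe_toContinuousLinearMap'] at h2
    simp only [rowQuad, ContinuousLinearMap.comp_apply, mat_sandwich_dyad] at h1
    rw [h1] at h2
    obtain ⟨h3, h4⟩ := hrow (Matrix.toEuclideanLin A x)
    simp only [rowQuad] at h3 h4
    set p := ‖Matrix.toEuclideanLin A x‖ ^ 2
    set R := ∑ b, ‖K (dyad (Matrix.toEuclideanLin A x) (EuclideanSpace.single b 1))‖ ^ 2
    obtain ⟨h5, h6⟩ := h2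
    have h7 : q / (b * w) * (c₁ * (q * p)) ≤ q * ‖x‖ ^ 2 :=
      le_trans (by gcongr) h5
    have h8 : q * ‖x‖ ^ 2 ≤ q / (a * w) * (c₂ * (q * p)) :=
      h6.trans (by gcongr)
    rw [div_mul_eq_mul_div, div_le_iff₀ (by positivity)] at h7
    rw [div_mul_eq_mul_div, le_div_iff₀ (by positivity)] at h8
    rw [div_mul_eq_mul_div, div_le_iff₀ (by positivity), div_mul_eq_mul_div,
      le_div_iff₀ (by positivity)]
    constructor
    · refine le_of_mul_le_mul_left ?_ hq0
      linarith
    · refine le_of_mul_le_mul_left ?_ hq0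
      linarith
  obtain ⟨h1, h2⟩ := norm_sq_ofMat_mul_bounds A hA (mat X * B)
  obtain ⟨h3, h4⟩ := norm_sq_ofMat_mul_bounds B.transpose hB (mat X).transpose
  rw [← Matrix.transpose_mul, norm_ofMat_transpose, norm_ofMat_transpose, ofMat_mat] at h3 h4
  have h5 : sandwich A B X = ofMat (A * (mat X * B)) := by
    rw [← Matrix.mul_assoc, ← mat_sandwich, ofMat_mat]
  rw [h5]
  constructor
  · refine le_trans ?_ h1
    calc _ = a * w / (q * c₂) * (q / (b * w) * ‖X‖ ^ 2) := by field_simp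
      _ ≤ _ := by gcongr
  · refine h2.trans ?_
    calc _ ≤ b * w / (q * c₁) * (q / (a * w) * ‖X‖ ^ 2) := by gcongr
      _ = _ := by field_simp

theorem rankPreserver_near_isometry {q d : ℕ} (hq : 2 ≤ q) {K : MatMap q d} {a b c₁ c₂ : ℝ}
    (ha : 0 < a) (hc₁ : 0 < c₁) (hl : DyadLower K a) (hu : DyadUpper K b)
    (hrow : ∀ z, c₁ * (q * ‖z‖ ^ 2) ≤ rowQuad K z ∧ rowQuad K z ≤ c₂ * (q * ‖z‖ ^ 2))
    (hcol : ∀ z, c₁ * (q * ‖z‖ ^ 2) ≤ colQuad K z ∧ colQuad K z ≤ c₂ * (q * ‖z‖ ^ 2))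
    {M : MatOp q} (hM : IsRankPreserver M) (hN : IsNormalized (K ∘L M)) (X : MatSp q) :
    a / (b * c₂) * ‖X‖ ^ 2 ≤ ‖M X‖ ^ 2 ∧ ‖M X‖ ^ 2 ≤ b / (a * c₁) * ‖X‖ ^ 2 := by
  have hq0 : 0 < q := by omega
  obtain ⟨A, B, rfl | rfl⟩ := hM.exists_sandwich hq
  · exact sandwich_near_isometry hq0 ha hc₁ hl hu hrow hN X
  · rw [ContinuousLinearMap.comp_apply, norm_transposeOp]
    refine sandwich_near_isometry hq0 ha hc₁ hl.comp_transposeOp hu.comp_transposeOp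
      (fun z => ?_) (A := A) (B := B) hN X
    rw [rowQuad_comp_transposeOp]
    exact hcol z

theorem norm_add_sq_bounds {V : Type*} [NormedAddCommGroup V] [InnerProductSpace ℝ V] (u v : V)
    {t : ℝ} (ht : 0 < t) : (1 - t) * ‖u‖ ^ 2 - t⁻¹ * ‖v‖ ^ 2 ≤ ‖u + v‖ ^ 2 ∧
      ‖u + v‖ ^ 2 ≤ (1 + t) * ‖u‖ ^ 2 + (1 + t⁻¹) * ‖v‖ ^ 2 := by
  have h1 := abs_le.1 (abs_real_inner_le_norm u v)
  rw [norm_add_sq_real]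
  have h2 : 2 * (‖u‖ * ‖v‖) ≤ t * ‖u‖ ^ 2 + t⁻¹ * ‖v‖ ^ 2 := by
    have h3 := sq_nonneg (t * ‖u‖ - ‖v‖)
    have h4 : t * (2 * (‖u‖ * ‖v‖)) ≤ t * (t * ‖u‖ ^ 2 + t⁻¹ * ‖v‖ ^ 2) := by
      rw [mul_add, ← mul_assoc t t⁻¹, mul_inv_cancel₀ ht.ne']
      nlinarith
    exact le_of_mul_le_mul_left h4 ht
  constructor <;> nlinarith [sq_nonneg ‖v‖]

theorem rowQuad_perturb {q d : ℕ} {L : MatMap q d} {E : MatOp q} {e : ℝ}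
    (hE : ∀ Z, ‖E Z‖ ≤ e * ‖Z‖) (he : ‖L‖ * e ≤ 1 / 1000)
    (hL : ∀ z, rowQuad L z = q * ‖z‖ ^ 2) (z : EuclideanSpace ℝ (Fin q)) :
    997 / 1000 * (q * ‖z‖ ^ 2) ≤
        rowQuad (L ∘L (ContinuousLinearMap.id ℝ (MatSp q) + E)) z ∧
      rowQuad (L ∘L (ContinuousLinearMap.id ℝ (MatSp q) + E)) z ≤
        1003 / 1000 * (q * ‖z‖ ^ 2) := by
  have h1 := hL z
  have h2 : ∀ b : Fin q, ‖L (E (dyad z (EuclideanSpace.single b 1)))‖ ^ 2 ≤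
      1 / 1000000 * ‖z‖ ^ 2 := by
    intro b
    have h3 : ‖dyad z (EuclideanSpace.single b 1)‖ = ‖z‖ := by
      rw [← sq_eq_sq₀ (norm_nonneg _) (norm_nonneg _), norm_sq_dyad]
      simp
    have h4 : ‖L (E (dyad z (EuclideanSpace.single b 1)))‖ ≤ 1 / 1000 * ‖z‖ := by
      calc _ ≤ ‖L‖ * ‖E (dyad z (EuclideanSpace.single b 1))‖ := L.le_opNorm _
        _ ≤ ‖L‖ * (e * ‖z‖) := by
            gcongr
            rw [← h3]
            exact hE _
        _ = (‖L‖ * e) * ‖z‖ := by ring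
        _ ≤ _ := by gcongr
    calc _ ≤ (1 / 1000 * ‖z‖) ^ 2 := pow_le_pow_left₀ (norm_nonneg _) h4 2
      _ = _ := by ring
  have h3 : ∑ b : Fin q, ‖L (E (dyad z (EuclideanSpace.single b 1)))‖ ^ 2 ≤
      1 / 1000000 * (q * ‖z‖ ^ 2) := by
    refine (Finset.sum_le_sum fun b _ => h2 b).trans (le_of_eq ?_)
    simp
    ring
  have h4 := fun b : Fin q => norm_add_sq_bounds (L (dyad z (EuclideanSpace.single b 1)))
    (L (E (dyad z (EuclideanSpace.single b 1)))) (by norm_num : (0 : ℝ) < 1 / 1000)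
  have h5 := Finset.sum_le_sum fun (b : Fin q) (_ : b ∈ Finset.univ) => (h4 b).1
  have h6 := Finset.sum_le_sum fun (b : Fin q) (_ : b ∈ Finset.univ) => (h4 b).2
  rw [Finset.sum_sub_distrib, ← Finset.mul_sum, ← Finset.mul_sum] at h5
  rw [Finset.sum_add_distrib, ← Finset.mul_sum, ← Finset.mul_sum] at h6
  simp only [rowQuad, ContinuousLinearMap.comp_apply, add_apply, map_add,
    ContinuousLinearMap.id_apply] at h1 ⊢
  rw [h1] at h5 h6
  have h7 : 0 ≤ q * ‖z‖ ^ 2 := by positivity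
  constructor
  · refine le_trans ?_ h5
    norm_num
    nlinarith
  · refine h6.trans ?_
    norm_num
    nlinarith

theorem RankBound.dyadLower {q d k : ℕ} {L : MatMap q d} {a b : ℝ} (h : RankBound L k a b)
    (hk : 1 ≤ k) (ha : 0 ≤ a) : DyadLower L (a ^ 2) := fun x y => by
  rw [← norm_sq_dyad, ← mul_pow]
  exact pow_le_pow_left₀ (by positivity) (h _ ((rank_dyad_le x y).trans hk)).1 2

theorem RankBound.dyadUpper {q d k : ℕ} {L : MatMap q d} {a b : ℝ} (h : RankBound L k a b)
    (hk : 1 ≤ k) : DyadUpper L (b ^ 2) := fun x y => by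
  rw [← norm_sq_dyad, ← mul_pow]
  exact pow_le_pow_left₀ (norm_nonneg _) (h _ ((rank_dyad_le x y).trans hk)).2 2

/-- A normalized map `Lstar ∘ (1 + E) ∘ M` with small `E` is a restricted near isometry. -/
theorem normalized_bounds {q d k : ℕ} (hq : 2 ≤ q) (hk : 1 ≤ k) {L : MatMap q d}
    (hL : IsNormalized L) {E M : MatOp q} {e : ℝ} (hE : ∀ Z, ‖E Z‖ ≤ e * ‖Z‖)
    (he : ‖L‖ * e ≤ 1 / 1000) (hM : IsRankPreserver M)
    (hK : RankBound (L ∘L (ContinuousLinearMap.id ℝ (MatSp q) + E)) k (973 / 1000) (1026 / 1000))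
    (hN : IsNormalized ((L ∘L (ContinuousLinearMap.id ℝ (MatSp q) + E)) ∘L M)) :
    (∀ X, 896 / 1000 * ‖X‖ ^ 2 ≤ ‖M X‖ ^ 2 ∧ ‖M X‖ ^ 2 ≤ 1116 / 1000 * ‖X‖ ^ 2) ∧
      ∀ X, (mat X).rank ≤ k →
        848 / 1000 * ‖X‖ ^ 2 ≤
            ‖((L ∘L (ContinuousLinearMap.id ℝ (MatSp q) + E)) ∘L M) X‖ ^ 2 ∧
          ‖((L ∘L (ContinuousLinearMap.id ℝ (MatSp q) + E)) ∘L M) X‖ ^ 2 ≤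
            1175 / 1000 * ‖X‖ ^ 2 := by
  have hrow := rowQuad_perturb hE he (rowQuad_of_rowGram hL.1)
  have hcol : ∀ z, 997 / 1000 * (q * ‖z‖ ^ 2) ≤
        colQuad (L ∘L (ContinuousLinearMap.id ℝ (MatSp q) + E)) z ∧
      colQuad (L ∘L (ContinuousLinearMap.id ℝ (MatSp q) + E)) z ≤
        1003 / 1000 * (q * ‖z‖ ^ 2) := by
    have h1 := rowQuad_perturb (L := L ∘L transposeOp q)
      (E := transposeOp q ∘L E ∘L transposeOp q) (e := e) (fun Z => by
        rw [ContinuousLinearMap.comp_apply, ContinuousLinearMap.comp_apply, norm_transposeOp,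
          ← norm_transposeOp Z]
        exact hE _) (by rwa [norm_comp_transposeOp])
      (fun z => by rw [rowQuad_comp_transposeOp]; exact colQuad_of_colGram hL.2 z)
    have h2 : (L ∘L transposeOp q) ∘L (ContinuousLinearMap.id ℝ (MatSp q) +
        transposeOp q ∘L E ∘L transposeOp q) =
        (L ∘L (ContinuousLinearMap.id ℝ (MatSp q) + E)) ∘L transposeOp q := by
      ext1 Z
      simp only [ContinuousLinearMap.comp_apply, add_apply, ContinuousLinearMap.id_apply, map_add]
      rfl
    intro z
    have h3 := h1 z
    rwa [h2, rowQuad_comp_transposeOp] at h3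
  have hiso := rankPreserver_near_isometry hq (by norm_num) (by norm_num)
    (hK.dyadLower hk (by norm_num)) (hK.dyadUpper hk) hrow hcol hM hN
  have hiso' : ∀ X, 896 / 1000 * ‖X‖ ^ 2 ≤ ‖M X‖ ^ 2 ∧ ‖M X‖ ^ 2 ≤ 1116 / 1000 * ‖X‖ ^ 2 := by
    intro X
    obtain ⟨h1, h2⟩ := hiso X
    norm_num at h1 h2
    have := sq_nonneg ‖X‖
    constructor <;> linarith
  refine ⟨hiso', fun X hX => ?_⟩
  obtain ⟨h1, h2⟩ := hiso X
  obtain ⟨h3, h4⟩ := hK (M X) ((hM X).trans_le hX)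
  have h5 := pow_le_pow_left₀ (by positivity) h3 2
  have h6 := pow_le_pow_left₀ (norm_nonneg _) h4 2
  rw [ContinuousLinearMap.comp_apply]
  generalize ‖(L ∘L (ContinuousLinearMap.id ℝ (MatSp q) + E)) (M X)‖ = w at h5 h6 ⊢
  rw [mul_pow] at h5 h6
  norm_num at h1 h2 h5 h6
  have h7 := sq_nonneg ‖X‖
  constructor <;> linarith

end

section
open scoped Matrix.Norms.L2Operator

/-! ### Truncated singular value decompositions -/

theorem exists_isTruncation {q : ℕ} (r : ℕ) (W : MatSp q) : ∃ Y, IsTruncation r W Y := by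
  obtain ⟨U, V, σ, hU, hV, hσ, hσ0, hW, -⟩ := exists_svd W
  exact ⟨ofMat (U * Matrix.diagonal (fun i : Fin q => if (i : ℕ) < r then σ i else 0) *
    V.transpose), U, V, σ, hU, hV, hσ, hσ0, hW, rfl⟩

theorem IsTruncation.rank_le {q r : ℕ} {W Y : MatSp q} (h : IsTruncation r W Y) :
    (mat Y).rank ≤ r := by
  obtain ⟨U, V, σ, -, -, -, -, -, hY⟩ := h
  rw [hY]
  refine (Matrix.rank_mul_le_left _ _).trans ((Matrix.rank_mul_le_right _ _).trans ?_)
  rw [Matrix.rank_diagonal]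
  have h1 : Fintype.card {i : Fin q // (if (i : ℕ) < r then σ i else 0) ≠ 0} ≤
      Fintype.card (Fin r) := by
    refine Fintype.card_le_of_injective (fun i => ⟨(i : Fin q), ?_⟩) ?_
    · by_contra hlt
      exact i.2 (if_neg hlt)
    · intro i j hij
      have := congrArg Fin.val hij
      exact Subtype.ext (Fin.ext this)
  simpa using h1

/-- The squared norms of the projections of an orthonormal basis sum to the dimension. -/
theorem sum_norm_sq_starProjection {q : ℕ} (S : Submodule ℝ (EuclideanSpace ℝ (Fin q))) :
    ∑ i, ‖S.starProjection (EuclideanSpace.single i 1)‖ ^ 2 = Module.finrank ℝ S := by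
  let b := stdOrthonormalBasis ℝ S
  have h1 : ∀ x : EuclideanSpace ℝ (Fin q), ‖S.starProjection x‖ ^ 2 =
      ∑ k, inner ℝ (b k : EuclideanSpace ℝ (Fin q)) x ^ 2 := by
    intro x
    have h2 := b.sum_sq_norm_inner_right (S.orthogonalProjectionOnto x)
    have h3 : ‖S.starProjection x‖ = ‖S.orthogonalProjectionOnto x‖ := rfl
    rw [h3, ← h2]
    refine Finset.sum_congr rfl fun k _ => ?_
    rw [Real.norm_eq_abs, sq_abs, Submodule.inner_orthogonalProjectionOnto_eq_of_mem_left]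
  simp only [h1]
  rw [Finset.sum_comm]
  have h4 : ∀ k, ∑ i, inner ℝ (b k : EuclideanSpace ℝ (Fin q))
      (EuclideanSpace.single i (1 : ℝ)) ^ 2 = 1 := by
    intro k
    have h5 : ‖(b k : EuclideanSpace ℝ (Fin q))‖ = 1 := b.norm_eq_one k
    have h6 := EuclideanSpace.norm_sq_eq (b k : EuclideanSpace ℝ (Fin q))
    rw [h5, one_pow] at h6
    refine Eq.trans ?_ h6.symm
    refine Finset.sum_congr rfl fun i _ => ?_
    rw [EuclideanSpace.inner_single_right]
    simp
  simp [h4]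

/-- Truncating a diagonal matrix gives a best approximation of bounded rank. -/
theorem diagonal_approx {q r : ℕ} (hrq : r < q) {σ : Fin q → ℝ} (hσ : Antitone σ)
    (hσ0 : ∀ i, 0 ≤ σ i) (B : Matrix (Fin q) (Fin q) ℝ) (hB : B.rank ≤ r) :
    ∑ i : Fin q, (if (i : ℕ) < r then 0 else σ i ^ 2) ≤ ‖ofMat (Matrix.diagonal σ - B)‖ ^ 2 := by
  set S := (Matrix.toEuclideanLin B).range with hS
  have hdim : Module.finrank ℝ S ≤ r := by rw [hS, rank_toEuclideanLin]; exact hB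
  set p : Fin q → ℝ := fun i => ‖S.starProjection (EuclideanSpace.single i 1)‖ ^ 2 with hp
  have hp0 : ∀ i, 0 ≤ p i := fun i => sq_nonneg _
  have hp1 : ∀ i, p i ≤ 1 := by
    intro i
    have h1 := S.norm_starProjection_apply_le (EuclideanSpace.single i (1 : ℝ))
    rw [PiLp.norm_single, norm_one] at h1
    exact pow_le_one₀ (norm_nonneg _) h1
  have hpsum : ∑ i, p i ≤ r := by
    rw [hp, sum_norm_sq_starProjection]
    exact_mod_cast hdim
  have hcol : ∀ i, σ i ^ 2 * (1 - p i) ≤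
      ‖Matrix.toEuclideanLin (Matrix.diagonal σ - B) (EuclideanSpace.single i 1)‖ ^ 2 := by
    intro i
    set e : EuclideanSpace ℝ (Fin q) := EuclideanSpace.single i 1 with he
    have h1 : Matrix.toEuclideanLin (Matrix.diagonal σ - B) e =
        σ i • e - Matrix.toEuclideanLin B e := by
      rw [map_sub, LinearMap.sub_apply]
      congr 1
      ext c
      by_cases hc : c = i
      · subst hc; simp [Matrix.toEuclideanLin, he]
      · simp [Matrix.toEuclideanLin, he, hc]
    have h2 : Matrix.toEuclideanLin B e ∈ S := LinearMap.mem_range_self _ _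
    have h3 : Sᗮ.starProjection (Matrix.toEuclideanLin (Matrix.diagonal σ - B) e) =
        σ i • Sᗮ.starProjection e := by
      rw [h1, map_sub, map_smul, Submodule.starProjection_orthogonal_val,
        Submodule.starProjection_orthogonal_val, Submodule.starProjection_eq_self_iff.2 h2,
        sub_self, sub_zero]
    have h4 := Sᗮ.norm_starProjection_apply_le
      (Matrix.toEuclideanLin (Matrix.diagonal σ - B) e)
    rw [h3] at h4
    have h5 := pow_le_pow_left₀ (norm_nonneg _) h4 2
    rw [norm_sq_smul] at h5
    have h6 := Submodule.norm_sq_eq_add_norm_sq_starProjection e S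
    have h7 : ‖e‖ = 1 := by simp [he]
    rw [h7, one_pow] at h6
    have h8 : 1 - p i = ‖Sᗮ.starProjection e‖ ^ 2 := by
      rw [h6]
      simp only [hp]
      ring
    rw [h8]
    exact h5
  rw [← sum_norm_sq_toEuclideanLin]
  refine le_trans ?_ (Finset.sum_le_sum fun i _ => hcol i)
  set c := σ ⟨r, hrq⟩ ^ 2 with hc
  have hterm : ∀ i : Fin q, (if (i : ℕ) < r then 0 else σ i ^ 2) +
      c * ((if (i : ℕ) < r then 1 else 0) - p i) ≤ σ i ^ 2 * (1 - p i) := by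
    intro i
    split_ifs with hi
    · have h1 : c ≤ σ i ^ 2 := pow_le_pow_left₀ (hσ0 _) (hσ (Fin.le_def.2 hi.le)) 2
      nlinarith [mul_le_mul_of_nonneg_right h1 (sub_nonneg.2 (hp1 i))]
    · have h1 : σ i ^ 2 ≤ c := pow_le_pow_left₀ (hσ0 _) (hσ (Fin.le_def.2 (not_lt.1 hi))) 2
      nlinarith [mul_le_mul_of_nonneg_right h1 (hp0 i)]
  have hsum := Finset.sum_le_sum fun i (_ : i ∈ Finset.univ) => hterm i
  rw [Finset.sum_add_distrib, ← Finset.mul_sum, Finset.sum_sub_distrib] at hsum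
  have hcard : ∑ i : Fin q, (if (i : ℕ) < r then (1 : ℝ) else 0) = r := by
    rw [Finset.sum_boole]
    have : (Finset.univ.filter fun i : Fin q => (i : ℕ) < r) = Finset.Iio ⟨r, hrq⟩ := by
      ext i
      simp [Fin.lt_def]
    rw [this, Fin.card_Iio]
  rw [hcard] at hsum
  have : 0 ≤ c * (r - ∑ i, p i) := mul_nonneg (sq_nonneg _) (by linarith)
  linarith

/-- The truncated singular value decomposition is a best approximation of bounded rank. -/
theorem IsTruncation.norm_sub_le {q r : ℕ} (hrq : r < q) {W Y V : MatSp q}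
    (h : IsTruncation r W Y) (hV : (mat V).rank ≤ r) : ‖W - Y‖ ≤ ‖W - V‖ := by
  obtain ⟨U, T, σ, hU, hT, hσ, hσ0, hW, hY⟩ := h
  set τ : Fin q → ℝ := fun i => if (i : ℕ) < r then σ i else 0 with hτ
  have hU' := mul_transpose_self_orthogonal hU
  have hT' := mul_transpose_self_orthogonal hT
  have h1 : W - Y = ofMat (U * (Matrix.diagonal σ - Matrix.diagonal τ) * T.transpose) := by
    apply mat_injective
    rw [mat_sub, hW, hY, mat_ofMat, Matrix.mul_sub, Matrix.sub_mul]
  have h2 : W - V = ofMat (U * (Matrix.diagonal σ - U.transpose * mat V * T) * T.transpose) := by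
    apply mat_injective
    rw [mat_sub, hW, mat_ofMat, Matrix.mul_sub, Matrix.sub_mul]
    congr 1
    calc mat V = (U * U.transpose) * mat V * (T * T.transpose) := by
          rw [hU', hT', Matrix.one_mul, Matrix.mul_one]
      _ = _ := by simp only [Matrix.mul_assoc]
  rw [← sq_le_sq₀ (norm_nonneg _) (norm_nonneg _), h1, h2,
    norm_ofMat_mul_orthogonal (transpose_mem_orthogonalGroup hT), norm_ofMat_orthogonal_mul hU,
    norm_ofMat_mul_orthogonal (transpose_mem_orthogonalGroup hT), norm_ofMat_orthogonal_mul hU]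
  refine le_trans (le_of_eq ?_) (diagonal_approx hrq hσ hσ0 (U.transpose * mat V * T) ?_)
  · rw [Matrix.diagonal_sub, norm_sq_ofMat_diagonal]
    refine Finset.sum_congr rfl fun i _ => ?_
    simp only [hτ]
    split_ifs <;> ring
  · exact (Matrix.rank_mul_le_left _ _).trans ((Matrix.rank_mul_le_right _ _).trans hV)

end

section

/-! ### Convergence of Singular Value Projection -/

theorem polar_bound {V W : Type*} [NormedAddCommGroup V] [InnerProductSpace ℝ V]
    [NormedAddCommGroup W] [InnerProductSpace ℝ W] (L : V →L[ℝ] W) {ν δ : ℝ} {u v : V}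
    (h : ∀ a b : ℝ, |‖a • u + b • v‖ ^ 2 - ν * ‖L (a • u + b • v)‖ ^ 2| ≤
      δ * ‖a • u + b • v‖ ^ 2) :
    inner ℝ u v - ν * inner ℝ (L u) (L v) ≤ δ * (‖u‖ * ‖v‖) := by
  by_cases hu : u = 0
  · simp [hu]
  by_cases hv : v = 0
  · simp [hv]
  have hpos : 0 < ‖u‖ * ‖v‖ := mul_pos (norm_pos_iff.2 hu) (norm_pos_iff.2 hv)
  have h1 := (abs_le.1 (h ‖v‖ ‖u‖)).2
  have h2 := (abs_le.1 (h ‖v‖ (-‖u‖))).1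
  simp only [map_add, map_smul, norm_add_sq_real, norm_smul, inner_smul_left, inner_smul_right,
    mul_pow, Real.norm_eq_abs, sq_abs, norm_neg, RCLike.conj_to_real] at h1 h2
  refine le_of_mul_le_mul_left ?_ hpos
  nlinarith

/-- One step of Singular Value Projection contracts the distance to the minimizer. -/
theorem svp_step {q d r : ℕ} (hrq : r < q) {L : MatMap q d} {ν : ℝ} (hν : 3 / 5 ≤ ν)
    (hν1 : ν ≤ 1)
    (hL : ∀ X, (mat X).rank ≤ 4 * r → 848 / 1000 * ‖X‖ ^ 2 ≤ ‖L X‖ ^ 2 ∧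
      ‖L X‖ ^ 2 ≤ 1175 / 1000 * ‖X‖ ^ 2) {y : EuclideanSpace ℝ (Fin d)} {Xh Z Y : MatSp q}
    (hXh : (mat Xh).rank ≤ r) (hZ : (mat Z).rank ≤ r)
    (hnoise : ∀ Y, (mat Y).rank ≤ r →
      inner ℝ (L (Y - Xh)) (y - L Xh) ≤ 1 / 1000 * ‖Y - Xh‖ ^ 2)
    (hY : IsTruncation r (Z + ν • ContinuousLinearMap.adjoint L (y - L Z)) Y) :
    ‖Y - Xh‖ ≤ 99 / 100 * ‖Z - Xh‖ := by
  have hYr := hY.rank_le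
  have h1 := hY.norm_sub_le hrq hXh
  set W := Z + ν • ContinuousLinearMap.adjoint L (y - L Z) with hW
  set u := Y - Xh with hu
  set v := Z - Xh with hv
  have h2 : ‖u‖ ^ 2 ≤ 2 * inner ℝ u (W - Xh) := by
    have h3 : W - Y = (W - Xh) - u := by rw [hu]; abel
    rw [h3] at h1
    have h4 := pow_le_pow_left₀ (norm_nonneg _) h1 2
    rw [norm_sub_sq_real, real_inner_comm] at h4
    linarith
  have h3 : inner ℝ u (W - Xh) = inner ℝ u v - ν * inner ℝ (L u) (L v) +
      ν * inner ℝ (L u) (y - L Xh) := by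
    have h4 : W - Xh = v + ν • ContinuousLinearMap.adjoint L ((y - L Xh) - L v) := by
      have h5 : y - L Z = (y - L Xh) - L v := by rw [hv, map_sub]; abel
      rw [hW, h5, hv]
      abel
    rw [h4, inner_add_right, inner_smul_right, ContinuousLinearMap.adjoint_inner_right,
      inner_sub_right (L u) (y - L Xh) (L v)]
    ring
  have h4 : inner ℝ u v - ν * inner ℝ (L u) (L v) ≤ 4912 / 10000 * (‖u‖ * ‖v‖) := by
    refine polar_bound L fun a b => ?_
    have hrank : (mat (a • u + b • v)).rank ≤ 4 * r := by
      have h5 : a • u + b • v = ofMat (a • mat Y + b • mat Z - (a + b) • mat Xh) := by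
        apply mat_injective
        rw [mat_add, mat_smul, mat_smul, mat_ofMat, hu, hv, mat_sub, mat_sub, smul_sub, smul_sub,
          add_smul]
        abel
      have hs : ∀ (c : ℝ) (X : Matrix (Fin q) (Fin q) ℝ), (c • X).rank ≤ X.rank := fun c X => by
        rw [← Matrix.mul_one X, ← Matrix.mul_smul, Matrix.mul_one]
        exact Matrix.rank_mul_le_left _ _
      rw [h5, mat_ofMat]
      have h6 := rank_sub_le (a • mat Y + b • mat Z) ((a + b) • mat Xh)
      have h7 := rank_add_le (a • mat Y) (b • mat Z)
      have h8 := hs a (mat Y)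
      have h9 := hs b (mat Z)
      have h10 := hs (a + b) (mat Xh)
      omega
    obtain ⟨h5, h6⟩ := hL _ hrank
    have h7 := sq_nonneg ‖a • u + b • v‖
    rw [abs_le]
    constructor
    · nlinarith [mul_le_mul_of_nonneg_left h6 (by linarith : (0 : ℝ) ≤ ν)]
    · nlinarith [mul_le_mul_of_nonneg_left h5 (by linarith : (0 : ℝ) ≤ ν)]
  have h5 := hnoise Y hYr
  have h6 : ν * inner ℝ (L u) (y - L Xh) ≤ 1 / 1000 * ‖u‖ ^ 2 := by
    calc _ ≤ ν * (1 / 1000 * ‖u‖ ^ 2) := mul_le_mul_of_nonneg_left h5 (by linarith)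
      _ ≤ 1 * (1 / 1000 * ‖u‖ ^ 2) := by gcongr
      _ = _ := one_mul _
  rw [h3] at h2
  have h7 : ‖u‖ * (998 / 1000 * ‖u‖) ≤ ‖u‖ * (9824 / 10000 * ‖v‖) := by nlinarith
  rcases (norm_nonneg u).eq_or_lt with h0 | h0
  · rw [← h0]
    positivity
  · have h8 := le_of_mul_le_mul_left h7 h0
    have := norm_nonneg v
    linarith

theorem svp_tendsto {q d r : ℕ} (hrq : r < q) {L : MatMap q d} {ν : ℝ} (hν : 3 / 5 ≤ ν)
    (hν1 : ν ≤ 1)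
    (hL : ∀ X, (mat X).rank ≤ 4 * r → 848 / 1000 * ‖X‖ ^ 2 ≤ ‖L X‖ ^ 2 ∧
      ‖L X‖ ^ 2 ≤ 1175 / 1000 * ‖X‖ ^ 2) {y : EuclideanSpace ℝ (Fin d)} {Xh : MatSp q}
    (hXh : (mat Xh).rank ≤ r)
    (hnoise : ∀ Y, (mat Y).rank ≤ r →
      inner ℝ (L (Y - Xh)) (y - L Xh) ≤ 1 / 1000 * ‖Y - Xh‖ ^ 2)
    {Z : ℕ → MatSp q} (h0 : Z 0 = 0)
    (hZ : ∀ k, IsTruncation r (Z k + ν • ContinuousLinearMap.adjoint L (y - L (Z k)))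
      (Z (k + 1))) : Tendsto Z atTop (𝓝 Xh) := by
  have hrank : ∀ k, (mat (Z k)).rank ≤ r := by
    intro k
    cases k with
    | zero => rw [h0, mat_zero, Matrix.rank_zero]; exact Nat.zero_le _
    | succ k => exact (hZ k).rank_le
  have hle : ∀ k, ‖Z k - Xh‖ ≤ (99 / 100) ^ k * ‖Z 0 - Xh‖ := by
    intro k
    induction k with
    | zero => simp
    | succ k ih =>
      refine (svp_step hrq hν hν1 hL hXh (hrank k) hnoise (hZ k)).trans ?_
      rw [pow_succ]
      linarith
  rw [tendsto_iff_norm_sub_tendsto_zero]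
  refine squeeze_zero (fun k => norm_nonneg _) hle ?_
  simpa using (tendsto_pow_atTop_nhds_zero_of_lt_one (by norm_num : (0 : ℝ) ≤ 99 / 100)
    (by norm_num)).mul_const ‖Z 0 - Xh‖

theorem exists_svp_sequence {q d : ℕ} (r : ℕ) (L : MatMap q d) (ν : ℝ)
    (y : EuclideanSpace ℝ (Fin d)) : ∃ Z : ℕ → MatSp q, Z 0 = 0 ∧
      ∀ k, IsTruncation r (Z k + ν • ContinuousLinearMap.adjoint L (y - L (Z k))) (Z (k + 1)) := by
  choose f hf using fun W : MatSp q => exists_isTruncation r W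
  exact ⟨fun k => Nat.rec 0 (fun _ Z => f (Z + ν • ContinuousLinearMap.adjoint L (y - L Z))) k,
    rfl, fun k => hf _⟩

/-- Rank-constrained least-squares problems for restricted isometries have solutions. -/
theorem exists_solvesRankProblem {q d r : ℕ} {L : MatMap q d} {a : ℝ} (ha : 0 < a)
    (hL : ∀ X, (mat X).rank ≤ r → a * ‖X‖ ≤ ‖L X‖) (y : EuclideanSpace ℝ (Fin d)) :
    ∃ X, SolvesRankProblem r L y X := by
  set S := {X : MatSp q | (mat X).rank ≤ r} ∩ Metric.closedBall 0 (2 * ‖y‖ / a) with hS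
  have hcompact : IsCompact S :=
    (isCompact_closedBall _ _).inter_left (isClosed_setOf_rank_le r)
  have h0 : (0 : MatSp q) ∈ S := by
    refine ⟨?_, by simpa using by positivity⟩
    change (mat (0 : MatSp q)).rank ≤ r
    rw [mat_zero, Matrix.rank_zero]
    exact Nat.zero_le _
  obtain ⟨X, hX, hmin⟩ := hcompact.exists_isMinOn ⟨0, h0⟩
    (f := fun X => ‖y - L X‖) (by fun_prop)
  refine ⟨X, hX.1, fun V hV => ?_⟩
  by_cases hVS : ‖V‖ ≤ 2 * ‖y‖ / a
  · exact hmin ⟨hV, mem_closedBall_zero_iff.2 hVS⟩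
  · rw [not_le, div_lt_iff₀ ha] at hVS
    have h1 : ‖y - L X‖ ≤ ‖y - L 0‖ := hmin h0
    rw [map_zero, sub_zero] at h1
    have h2 := hL V hV
    have h3 := norm_sub_norm_le (L V) y
    rw [norm_sub_rev] at h3
    linarith

/-- The residual at the minimizer is nearly orthogonal to the feasible directions. -/
theorem GoodData.noise_le {q d n r : ℕ} {L : MatMap q d} {X : Fin n → MatSp q} {s : ℝ}
    (G : GoodData r L X s) {E M : MatOp q} (hM : IsRankPreserver M)
    (hE : q * (‖L‖ * euNorm E) ≤ 1 / 1000)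
    (hE' : ‖L‖ * euNorm E * √(r : ℝ) ≤ 1 / 100000)
    (hiso : ∀ Z, ‖M Z‖ ^ 2 ≤ 1116 / 1000 * ‖Z‖ ^ 2) {j : Fin n} {Xh : MatSp q}
    (hXh : SolvesRankProblem r (L ∘L (ContinuousLinearMap.id ℝ (MatSp q) + E) ∘L M)
      (L (X j)) Xh) {Y : MatSp q} (hY : (mat Y).rank ≤ r) :
    inner ℝ ((L ∘L (ContinuousLinearMap.id ℝ (MatSp q) + E) ∘L M) (Y - Xh))
      (L (X j) - (L ∘L (ContinuousLinearMap.id ℝ (MatSp q) + E) ∘L M) Xh) ≤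
        1 / 1000 * ‖Y - Xh‖ ^ 2 := by
  obtain ⟨hL, hK'⟩ := G.near hE
  have hK := hK'.mono (le_refl (4 * r)) (show (97 / 100 : ℝ) ≤ _ by norm_num)
    (show _ ≤ (103 / 100 : ℝ) by norm_num)
  have hs := G.s_pos
  have hYh : SolvesRankProblem r (L ∘L (ContinuousLinearMap.id ℝ (MatSp q) + E)) (L (X j))
      (M Xh) := SolvesRankProblem.comp hM hXh
  obtain ⟨hn1, hn2⟩ := hYh.near (norm_apply_le_euNorm E) (euNorm_nonneg E) hK (G.rank_eq j)
    (G.norm_le j)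
  have hle : ‖L‖ * euNorm E * (s * √(r : ℝ)) ≤ s / 100000 := by
    calc _ = s * (‖L‖ * euNorm E * √(r : ℝ)) := by ring
      _ ≤ s * (1 / 100000) := by gcongr
      _ = _ := by ring
  obtain ⟨J, hJ⟩ := G.pinv j
  obtain ⟨⟨J', hJ'⟩, hrank⟩ := hJ.isGInv.perturb (Y := M Xh) (hYh.1.trans (G.rank_eq j).ge) (by
    rw [div_mul_eq_mul_div, div_le_iff₀ hs]
    linarith)
  set K := L ∘L (ContinuousLinearMap.id ℝ (MatSp q) + E) with hKdef
  obtain ⟨Q, hQ1, hQ2, hQ3⟩ := hJ'.curvature (Y := M Y) (by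
    rw [hM, hrank, G.rank_eq]
    exact hY)
  have hKM : ∀ Z, (L ∘L (ContinuousLinearMap.id ℝ (MatSp q) + E) ∘L M) Z = K (M Z) := fun Z => rfl
  rw [hKM, hKM]
  have h1 := hYh.stationary hQ1
  have h2 : M (Y - Xh) = (M Y - M Xh - Q) + Q := by rw [map_sub]; abel
  have h3 : inner ℝ (K (M (Y - Xh))) (L (X j) - K (M Xh)) =
      inner ℝ (K Q) (L (X j) - K (M Xh)) := by
    rw [h2, map_add, inner_add_left, real_inner_comm, h1, zero_add]
  rw [h3]
  have h4 : ‖K Q‖ ≤ 103 / 100 * ‖Q‖ :=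
    (hK Q (hQ3.trans (by rw [hrank, G.rank_eq]; omega))).2
  rw [← map_sub] at hQ2
  have h5 := hiso (Y - Xh)
  have h6 : ‖Q‖ ≤ 36 / s * ‖Y - Xh‖ ^ 2 := by
    refine hQ2.trans ?_
    have h7 : 2 * (2 : ℝ) ^ 2 * (2 * (2 / s)) = 32 / s := by ring
    rw [h7]
    calc _ ≤ 32 / s * (1116 / 1000 * ‖Y - Xh‖ ^ 2) := by gcongr
      _ = (32 * (1116 / 1000)) / s * ‖Y - Xh‖ ^ 2 := by ring
      _ ≤ _ := by gcongr; norm_num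
  calc _ ≤ ‖K Q‖ * ‖L (X j) - K (M Xh)‖ := real_inner_le_norm _ _
    _ ≤ (103 / 100 * (36 / s * ‖Y - Xh‖ ^ 2)) * (s / 100000) := by
        gcongr
        · exact h4.trans (by gcongr)
        · exact hn1.trans hle
    _ = 103 / 100 * 36 / 100000 * ‖Y - Xh‖ ^ 2 := by field_simp
    _ ≤ _ := mul_le_mul_of_nonneg_right (by norm_num) (sq_nonneg _)

/-- Singular Value Projection succeeds. -/
theorem GoodData.svp {q d n r : ℕ} {L : MatMap q d} {X : Fin n → MatSp q} {s : ℝ}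
    (G : GoodData r L X s) (hrq : r < q) (hLn : IsNormalized L) {E M : MatOp q}
    (hM : IsRankPreserver M) (hE : q * (‖L‖ * euNorm E) ≤ 1 / 1000)
    (hE' : ‖L‖ * euNorm E * √(r : ℝ) ≤ 1 / 100000)
    (hN : IsNormalized (L ∘L (ContinuousLinearMap.id ℝ (MatSp q) + E) ∘L M)) {ν : ℝ}
    (hν : 3 / 5 ≤ ν) (hν1 : ν ≤ 1) (j : Fin n) :
    (∃ Xh, SVPReturns ν r (L ∘L (ContinuousLinearMap.id ℝ (MatSp q) + E) ∘L M) (L (X j)) Xh) ∧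
      ∀ Xh, SVPReturns ν r (L ∘L (ContinuousLinearMap.id ℝ (MatSp q) + E) ∘L M) (L (X j)) Xh →
        SolvesRankProblem r (L ∘L (ContinuousLinearMap.id ℝ (MatSp q) + E) ∘L M) (L (X j)) Xh := by
  obtain ⟨hL, hK⟩ := G.near hE
  have hq : (2 : ℝ) ≤ q := by exact_mod_cast G.q_ge
  have h0 : 0 ≤ ‖L‖ * euNorm E := mul_nonneg (norm_nonneg _) (euNorm_nonneg _)
  obtain ⟨hiso, hrip⟩ := normalized_bounds G.q_ge (by have := G.r_pos; omega : 1 ≤ 4 * r) hLn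
    (norm_apply_le_euNorm E) (by nlinarith) hM hK hN
  rw [ContinuousLinearMap.comp_assoc] at hrip
  obtain ⟨Xh, hXh⟩ := exists_solvesRankProblem (r := r)
    (L := L ∘L (ContinuousLinearMap.id ℝ (MatSp q) + E) ∘L M) (by norm_num : (0 : ℝ) < 1 / 2)
    (fun X hX => by
      have h1 := (hrip X (by omega)).1
      refine (sq_le_sq₀ (by positivity) (norm_nonneg _)).1 (le_trans ?_ h1)
      nlinarith [sq_nonneg ‖X‖]) (L (X j))
  have hnoise := fun Y hY => G.noise_le hM hE hE' (fun Z => (hiso Z).2) hXh (Y := Y) hY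
  refine ⟨?_, fun X' ⟨Z, hZ0, hZ, hlim⟩ => ?_⟩
  · obtain ⟨Z, hZ0, hZ⟩ := exists_svp_sequence r
      (L ∘L (ContinuousLinearMap.id ℝ (MatSp q) + E) ∘L M) ν (L (X j))
    exact ⟨Xh, Z, hZ0, hZ, svp_tendsto hrq hν hν1 hrip hXh.1 hnoise hZ0 hZ⟩
  · rwa [tendsto_nhds_unique hlim (svp_tendsto hrq hν hν1 hrip hXh.1 hnoise hZ0 hZ)]

end

section

/-! ### Verification of the hypotheses of the analysis -/

theorem lambdaMin_covariance_nonneg {q n : ℕ} (hn : 0 < n) (X : Fin n → MatSp q) :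
    0 ≤ lambdaMin (covariance X) := by
  refine Real.sInf_nonneg fun μ hμ => ?_
  obtain ⟨v, hv⟩ := Module.End.HasEigenvalue.exists_hasEigenvector hμ
  have h1 : covariance X v = μ • v := hv.apply_eq_smul
  have h2 := sum_inner_sq_eq hn X v
  rw [h1, inner_smul_left, real_inner_self_eq_norm_sq, conj_trivial] at h2
  have h3 : 0 ≤ ∑ j, inner ℝ (X j) v ^ 2 := Finset.sum_nonneg fun j _ => sq_nonneg _
  have h4 : 0 < ‖v‖ := norm_pos_iff.2 hv.2
  have h5 : (0 : ℝ) < n := by exact_mod_cast hn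
  by_contra hlt
  rw [not_le] at hlt
  have h6 : n * (μ * ‖v‖ ^ 2) < 0 :=
    mul_neg_of_pos_of_neg h5 (mul_neg_of_neg_of_pos hlt (by positivity))
  linarith

theorem bigDelta_nonneg {q n : ℕ} (hn : 0 < n) (hq : 0 < q) (X : Fin n → MatSp q) :
    0 ≤ bigDelta X := by
  obtain ⟨h1, h2⟩ := sum_inner_sq_bounds hn X (EuclideanSpace.single (⟨0, hq⟩, ⟨0, hq⟩) 1)
  have h5 : (0 : ℝ) < n := by exact_mod_cast hn
  have h3 := h1.trans h2
  simp only [PiLp.norm_single, norm_one, one_pow, mul_one] at h3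
  have := le_of_mul_le_mul_left h3 h5
  linarith

theorem IsNormalized.dim_pos {q d : ℕ} (hq : 0 < q) {L : MatMap q d} (hL : IsNormalized L) :
    0 < d := by
  rcases Nat.eq_zero_or_pos d with rfl | h
  · have h0 : rowGram L = 0 := Finset.sum_of_isEmpty _
    have h1 := congrFun (congrFun hL.1 ⟨0, hq⟩) ⟨0, hq⟩
    rw [h0, Matrix.zero_apply, Matrix.smul_apply, Matrix.one_apply_eq, smul_eq_mul, mul_one] at h1
    have h2 : q = 0 := by exact_mod_cast h1.symm
    omega
  · exact h

theorem dim_le_of_surjective {q d : ℕ} {L : MatMap q d} (hL : Function.Surjective L) :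
    d ≤ q ^ 2 := by
  have h := LinearMap.finrank_le_finrank_of_surjective
    (f := (L : MatSp q →ₗ[ℝ] EuclideanSpace ℝ (Fin d))) hL
  rw [finrank_euclideanSpace, finrank_euclideanSpace, Fintype.card_prod, Fintype.card_fin,
    Fintype.card_fin] at h
  nlinarith

theorem goodData_of_hypotheses {q d n r : ℕ} (hn : 0 < n) (hr : 0 < r) (hrq : r < q)
    {L : MatMap q d} {X : Fin n → MatSp q} {s : ℝ} (hs : 0 < s)
    (hrank : ∀ j, (mat (X j)).rank = r)
    (hsing : ∀ j, singVal (X j) 1 ≤ s ∧ s / 2 ≤ singVal (X j) r)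
    (hDelta : bigDelta X / bigLambda X ≤ √(d : ℝ) / (150 * (q : ℝ) ^ 3))
    (hrip : ripConst (4 * r) L ≤ 1 / 20) (hsurj : Function.Surjective L) :
    GoodData r L X s := by
  have hq2 : 2 ≤ q := by omega
  have hq : (2 : ℝ) ≤ q := by exact_mod_cast hq2
  have hq0 : (0 : ℝ) < q := by linarith
  have hn0 : (0 : ℝ) < n := by exact_mod_cast hn
  have hr1 : (1 : ℝ) ≤ r := by exact_mod_cast hr
  have hX := fun j => exists_pinv hr hrq.le hs (hrank j) (hsing j).1 (hsing j).2
  have hbound := rankBound_of_ripConst_le hrip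
  have hD0 := bigDelta_nonneg hn (by omega : 0 < q) X
  have hmin : bigLambda X - bigDelta X = lambdaMin (covariance X) := by
    rw [bigLambda, bigDelta]
    ring
  have hmin0 := lambdaMin_covariance_nonneg hn X
  have hsum : n * (r * s ^ 2 / 4) ≤ n * (bigLambda X + bigDelta X) * (q : ℝ) ^ 2 := by
    have h1 : ∑ j, ‖X j‖ ^ 2 ≤ n * (bigLambda X + bigDelta X) * (q : ℝ) ^ 2 := by
      have h2 := fun j => sum_inner_single_sq (X j)
      calc ∑ j, ‖X j‖ ^ 2 =
            ∑ p : Fin q × Fin q, ∑ j, inner ℝ (X j) (EuclideanSpace.single p (1 : ℝ)) ^ 2 := by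
            rw [Finset.sum_comm]
            refine Finset.sum_congr rfl fun j _ => ?_
            rw [← h2 j]
            exact Finset.sum_congr rfl fun p _ => by rw [real_inner_comm]
        _ ≤ ∑ _p : Fin q × Fin q, n * (bigLambda X + bigDelta X) := by
            refine Finset.sum_le_sum fun p _ => ?_
            have := (sum_inner_sq_bounds hn X (EuclideanSpace.single p 1)).2
            rwa [PiLp.norm_single, norm_one, one_pow, mul_one] at this
        _ = _ := by simp; ring
    refine le_trans ?_ h1
    calc n * (r * s ^ 2 / 4) = ∑ _j : Fin n, r * s ^ 2 / 4 := by simp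
      _ ≤ _ := Finset.sum_le_sum fun j _ => (hX j).2.2
  have hsum' : r * s ^ 2 / 4 ≤ (bigLambda X + bigDelta X) * (q : ℝ) ^ 2 := by
    rw [mul_assoc] at hsum
    exact le_of_mul_le_mul_left hsum hn0
  have hrs : 0 < r * s ^ 2 / 4 := by positivity
  have hLD : 0 < bigLambda X + bigDelta X := by
    by_contra h
    have := mul_nonneg (neg_nonneg.2 (not_lt.1 h)) (sq_nonneg (q : ℝ))
    linarith
  have hL0 : 0 < bigLambda X := by linarith
  have hD600 : bigDelta X ≤ bigLambda X / 600 := by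
    have hd : √(d : ℝ) ≤ q := by
      rw [Real.sqrt_le_left hq0.le]
      exact_mod_cast dim_le_of_surjective hsurj
    have h1 : √(d : ℝ) / (150 * (q : ℝ) ^ 3) ≤ 1 / 600 := by
      rw [div_le_div_iff₀ (by positivity) (by norm_num)]
      have h2 : (4 : ℝ) ≤ q ^ 2 := by nlinarith
      have h3 : 4 * (q : ℝ) ≤ q ^ 3 := by nlinarith
      linarith
    have h2 := hDelta.trans h1
    rw [div_le_iff₀ hL0] at h2
    linarith
  have hsq : √(r : ℝ) ^ 2 = r := Real.sq_sqrt (by linarith)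
  refine ⟨hn, hr, hq2, hs, hrank, fun j => (hX j).1, fun j => ?_, hbound, ?_, hL0, hD0,
    by linarith, fun V => ?_⟩
  · refine (sq_le_sq₀ (norm_nonneg _) (by positivity)).1 ?_
    rw [mul_pow, hsq]
    linarith [(hX j).2.1]
  · have h1 := (hbound (X ⟨0, hn⟩) (by rw [hrank]; omega)).1
    have h2 := h1.trans (L.le_opNorm _)
    have h3 : 0 < ‖X ⟨0, hn⟩‖ := by
      have := (hX ⟨0, hn⟩).2.2
      by_contra h
      have h4 : ‖X ⟨0, hn⟩‖ = 0 := le_antisymm (not_lt.1 h) (norm_nonneg _)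
      rw [h4] at this
      linarith
    have := le_of_mul_le_mul_right h2 h3
    linarith
  · refine le_trans ?_ (sum_inner_sq_bounds hn X V).1
    refine mul_le_mul_of_nonneg_right (mul_le_mul_of_nonneg_left ?_ hn0.le) (sq_nonneg _)
    rw [div_pow, mul_pow, mul_pow, hsq, div_le_iff₀ (by positivity)]
    have h1 : (bigLambda X + bigDelta X) * (q : ℝ) ^ 2 ≤
        601 / 599 * ((bigLambda X - bigDelta X) * (q : ℝ) ^ 2) := by
      rw [← mul_assoc]
      refine mul_le_mul_of_nonneg_right ?_ (sq_nonneg _)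
      linarith
    linarith

/-- The linear rate of one update. -/
noncomputable def stepRate {q d n : ℕ} (L : MatMap q d) (X : Fin n → MatSp q) : ℝ :=
  2 * ‖L‖ ^ 2 * (bigOmega X / bigLambda X) + 2 * ‖L‖ * (bigDelta X / bigLambda X)

theorem GoodData.stepRate_le {q d n r : ℕ} {L : MatMap q d} {X : Fin n → MatSp q} {s : ℝ}
    (G : GoodData r L X s) : 0 ≤ stepRate L X ∧ stepRate L X ≤ rateBound L X := by
  have hq : (2 : ℝ) ≤ q := by exact_mod_cast G.q_ge
  have h1 : 0 ≤ bigDelta X / bigLambda X := div_nonneg G.delta_nonneg G.lambda_pos.le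
  have h2 : 0 ≤ bigOmega X / bigLambda X := div_nonneg (bigOmega_nonneg X) G.lambda_pos.le
  refine ⟨by unfold stepRate; positivity, ?_⟩
  unfold stepRate rateBound
  gcongr
  nlinarith

theorem rateBound_le {q d n r : ℕ} {L : MatMap q d} {X : Fin n → MatSp q} {s : ℝ}
    (G : GoodData r L X s) (hd : 0 < d)
    (hOmega : bigOmega X / bigLambda X ≤ (d : ℝ) / (40 * (q : ℝ) ^ 2))
    (hDelta : bigDelta X / bigLambda X ≤ √(d : ℝ) / (150 * (q : ℝ) ^ 3))
    (hnorm : ‖L‖ ^ 2 ≤ 5 * (q : ℝ) ^ 2 / (d : ℝ)) : rateBound L X ≤ 48 / 100 := by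
  have hq : (2 : ℝ) ≤ q := by exact_mod_cast G.q_ge
  have hd0 : (0 : ℝ) < d := by exact_mod_cast hd
  have h1 : 2 * ‖L‖ ^ 2 * (bigOmega X / bigLambda X) ≤ 1 / 4 := by
    calc _ ≤ 2 * (5 * (q : ℝ) ^ 2 / (d : ℝ)) * ((d : ℝ) / (40 * (q : ℝ) ^ 2)) := by
          gcongr
          exact div_nonneg (bigOmega_nonneg X) G.lambda_pos.le
      _ = _ := by field_simp; norm_num
  have h2 : ‖L‖ * √(d : ℝ) ≤ 9 / 4 * q := by
    refine (sq_le_sq₀ (by positivity) (by positivity)).1 ?_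
    rw [mul_pow, Real.sq_sqrt hd0.le]
    rw [le_div_iff₀ hd0] at hnorm
    nlinarith
  have h3 : 15 * (q : ℝ) ^ 2 * ‖L‖ * (bigDelta X / bigLambda X) ≤ 23 / 100 := by
    calc _ ≤ 15 * (q : ℝ) ^ 2 * ‖L‖ * (√(d : ℝ) / (150 * (q : ℝ) ^ 3)) := by gcongr
      _ = (‖L‖ * √(d : ℝ)) / (10 * q) := by field_simp; ring
      _ ≤ (9 / 4 * q) / (10 * q) := by gcongr
      _ = 9 / 40 := by field_simp; norm_num
      _ ≤ _ := by norm_num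
  unfold rateBound
  linarith

/-- The admissible size of the initial error. -/
noncomputable def errorRadius {q d : ℕ} (r : ℕ) (L : MatMap q d) : ℝ :=
  1 / (36000 * (q : ℝ) ^ (7 / 2 : ℝ) * (r : ℝ) ^ 2 * ‖L‖ ^ 2)

theorem GoodData.small {q d n r : ℕ} {L : MatMap q d} {X : Fin n → MatSp q} {s : ℝ}
    (G : GoodData r L X s) {e : ℝ} (he0 : 0 ≤ e) (he : e < errorRadius r L) :
    q * (‖L‖ * e) ≤ 1 / 1000 ∧ ‖L‖ * e * √(r : ℝ) ≤ 1 / 100000 ∧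
      ‖L‖ * (5 * q * (‖L‖ * e)) ≤ 1 / 2 ∧ 150 * r * q ^ 2 * ‖L‖ ^ 2 * e ≤ 1 / 100 := by
  have hq : (2 : ℝ) ≤ q := by exact_mod_cast G.q_ge
  have hr : (1 : ℝ) ≤ r := by exact_mod_cast G.r_pos
  have hl := G.norm_ge
  have hl0 : 0 < ‖L‖ := by linarith
  have h1 : (q : ℝ) ^ 3 ≤ (q : ℝ) ^ (7 / 2 : ℝ) := by
    rw [← Real.rpow_natCast]
    exact Real.rpow_le_rpow_of_exponent_le (by linarith) (by norm_num)
  have h2 : ‖L‖ ^ 2 * e * (r : ℝ) ^ 2 * (q : ℝ) ^ 3 ≤ 1 / 36000 := by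
    rw [errorRadius, lt_div_iff₀ (by positivity)] at he
    have h3 : e * (36000 * (q : ℝ) ^ 3 * (r : ℝ) ^ 2 * ‖L‖ ^ 2) ≤
        e * (36000 * (q : ℝ) ^ (7 / 2 : ℝ) * (r : ℝ) ^ 2 * ‖L‖ ^ 2) := by gcongr
    linarith
  have hr2 : (1 : ℝ) ≤ (r : ℝ) ^ 2 := one_le_pow₀ hr
  have hq2 : (4 : ℝ) ≤ (q : ℝ) ^ 2 := by nlinarith
  have hsr : √(r : ℝ) ≤ r := by
    rw [Real.sqrt_le_left (by linarith)]
    nlinarith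
  have hle : 0 ≤ ‖L‖ * e := by positivity
  refine ⟨?_, ?_, ?_, ?_⟩
  · have h3 : q * (‖L‖ * e) * (97 / 100 * 1 * 4) ≤
        q * (‖L‖ * e) * (‖L‖ * (r : ℝ) ^ 2 * (q : ℝ) ^ 2) := by gcongr
    have h4 : q * (‖L‖ * e) * (‖L‖ * (r : ℝ) ^ 2 * (q : ℝ) ^ 2) =
      ‖L‖ ^ 2 * e * (r : ℝ) ^ 2 * (q : ℝ) ^ 3 := by ring
    linarith
  · have h3 : ‖L‖ * e * √(r : ℝ) * (97 / 100 * 1 * 8) ≤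
        ‖L‖ * e * r * (‖L‖ * r * (q : ℝ) ^ 3) := by
      have : (8 : ℝ) ≤ (q : ℝ) ^ 3 := by nlinarith
      gcongr
    have h4 : ‖L‖ * e * r * (‖L‖ * r * (q : ℝ) ^ 3) =
      ‖L‖ ^ 2 * e * (r : ℝ) ^ 2 * (q : ℝ) ^ 3 := by ring
    linarith
  · have h3 : ‖L‖ * (5 * q * (‖L‖ * e)) * (1 * 4) ≤
        ‖L‖ * (5 * q * (‖L‖ * e)) * ((r : ℝ) ^ 2 * (q : ℝ) ^ 2) := by gcongr
    have h4 : ‖L‖ * (5 * q * (‖L‖ * e)) * ((r : ℝ) ^ 2 * (q : ℝ) ^ 2) =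
      5 * (‖L‖ ^ 2 * e * (r : ℝ) ^ 2 * (q : ℝ) ^ 3) := by ring
    linarith
  · have h3 : 150 * r * q ^ 2 * ‖L‖ ^ 2 * e * (1 * 2) ≤
        150 * r * q ^ 2 * ‖L‖ ^ 2 * e * (r * q) := by gcongr
    have h4 : 150 * r * q ^ 2 * ‖L‖ ^ 2 * e * (r * q) =
      150 * (‖L‖ ^ 2 * e * (r : ℝ) ^ 2 * (q : ℝ) ^ 3) := by ring
    linarith

end

section

/-! ### Convergence of the alternating updates -/

theorem xi_le {q d : ℕ} {Lstar : MatMap q d} {E M : MatOp q} (hM : IsRankPreserver M) :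
    xi Lstar (Lstar ∘L (ContinuousLinearMap.id ℝ (MatSp q) + E) ∘L M) ≤ euNorm E :=
  csInf_le ⟨0, by rintro _ ⟨E, M, -, -, rfl⟩; exact euNorm_nonneg E⟩ ⟨E, M, hM, rfl, rfl⟩

theorem xi_nonneg {q d : ℕ} (Lstar L : MatMap q d) : 0 ≤ xi Lstar L :=
  Real.sInf_nonneg (by rintro _ ⟨E, M, -, -, rfl⟩; exact euNorm_nonneg E)

theorem exists_representation {q d : ℕ} {Lstar : MatMap q d} (hsurj : Function.Surjective Lstar)
    (L : MatMap q d) {c : ℝ} (hc : xi Lstar L < c) :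
    ∃ E M : MatOp q, IsRankPreserver M ∧
      L = Lstar ∘L (ContinuousLinearMap.id ℝ (MatSp q) + E) ∘L M ∧ euNorm E < c := by
  obtain ⟨R, hR⟩ := (Lstar : MatSp q →ₗ[ℝ] EuclideanSpace ℝ (Fin d)).exists_rightInverse_of_surjective
    (LinearMap.range_eq_top.2 hsurj)
  have hne : {e : ℝ | ∃ E M : MatOp q, IsRankPreserver M ∧
      L = Lstar ∘L (ContinuousLinearMap.id ℝ (MatSp q) + E) ∘L M ∧ e = euNorm E}.Nonempty := by
    refine ⟨_, LinearMap.toContinuousLinearMap R ∘L L - ContinuousLinearMap.id ℝ (MatSp q),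
      ContinuousLinearMap.id ℝ (MatSp q), isRankPreserver_id, ?_, rfl⟩
    rw [add_sub_cancel, ContinuousLinearMap.comp_id]
    ext1 Z
    exact (congrArg (fun T : EuclideanSpace ℝ (Fin d) →ₗ[ℝ] EuclideanSpace ℝ (Fin d) =>
      T (L Z)) hR).symm
  obtain ⟨_, ⟨E, M, hM, hL, rfl⟩, hlt⟩ := exists_lt_of_csInf_lt hne hc
  exact ⟨E, M, hM, hL, hlt⟩

/-- The outcome of the least-squares and Sinkhorn steps for a fixed representation. -/
theorem GoodData.update_of_representation {q d n r : ℕ} {Lstar : MatMap q d}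
    {X : Fin n → MatSp q} {s : ℝ} (G : GoodData r Lstar X s) (hrate : stepRate Lstar X ≤ 1)
    {E M : MatOp q} (hM : IsRankPreserver M) (hE : euNorm E < errorRadius r Lstar)
    {Xh : Fin n → MatSp q}
    (hXh : ∀ j, SolvesRankProblem r
      (Lstar ∘L (ContinuousLinearMap.id ℝ (MatSp q) + E) ∘L M) (Lstar (X j)) (Xh j)) :
    (∃ K, IsLeastSquares (fun j => Lstar (X j)) Xh K ∧ ∃ L', SinkhornReturns K L') ∧
      ∀ K L', IsLeastSquares (fun j => Lstar (X j)) Xh K → SinkhornReturns K L' →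
        IsNormalized L' ∧ xi Lstar L' ≤ stepRate Lstar X * euNorm E +
          150 * r * q ^ 2 * ‖Lstar‖ ^ 2 * euNorm E ^ 2 := by
  have hq : 0 < q := by have := G.q_ge; omega
  obtain ⟨h1, -, h3, -⟩ := G.small (euNorm_nonneg E) hE
  obtain ⟨Fh, hF⟩ := G.exists_update hM h1 hrate hXh
  have hb := (G.bound.perturb (norm_apply_le_euNorm Fh)).mono (le_refl (4 * r))
    (show (4 / 10 : ℝ) ≤ _ by
      have := mul_le_mul_of_nonneg_left hF.euNorm_le (norm_nonneg Lstar)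
      linarith) le_rfl
  obtain ⟨μ, hμ, hlow⟩ := (hb.dyadLower (by have := G.r_pos; omega)
    (by norm_num)).comp_rankPreserver (by norm_num) hM
  rw [ContinuousLinearMap.comp_assoc] at hlow
  refine ⟨⟨_, hF.isLeastSquares, exists_sinkhornReturns hq hμ hlow⟩, fun K L' hK hL' => ?_⟩
  rw [hF.unique K hK] at hL'
  obtain ⟨hN, N, hNr, rfl⟩ := hL'.spec hq hμ hlow
  refine ⟨hN, ?_⟩
  obtain ⟨E', N', hN', hfac, hle⟩ := hF.factor
  rw [hfac]
  have h4 : (Lstar ∘L ((ContinuousLinearMap.id ℝ (MatSp q) + E') ∘L N') ∘L M) ∘L N =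
      Lstar ∘L (ContinuousLinearMap.id ℝ (MatSp q) + E') ∘L (N' ∘L M ∘L N) := rfl
  rw [h4]
  refine (xi_le (hN'.comp (hM.comp hNr))).trans (hle.trans (le_of_eq ?_))
  rw [stepRate]
  ring

/-- One update of the algorithm. -/
theorem GoodData.update {q d n r : ℕ} {Lstar : MatMap q d} {X : Fin n → MatSp q} {s : ℝ}
    (G : GoodData r Lstar X s) (hsurj : Function.Surjective Lstar)
    (hrate : stepRate Lstar X ≤ 1) {L : MatMap q d} (hL : xi Lstar L < errorRadius r Lstar)
    {Xh : Fin n → MatSp q}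
    (hXh : ∀ j, SolvesRankProblem r L (Lstar (X j)) (Xh j)) :
    (∃ K, IsLeastSquares (fun j => Lstar (X j)) Xh K ∧ ∃ L', SinkhornReturns K L') ∧
      ∀ K L', IsLeastSquares (fun j => Lstar (X j)) Xh K → SinkhornReturns K L' →
        IsNormalized L' ∧ xi Lstar L' ≤ stepRate Lstar X * xi Lstar L +
          150 * r * q ^ 2 * ‖Lstar‖ ^ 2 * xi Lstar L ^ 2 := by
  have key : ∀ c, xi Lstar L < c → c ≤ errorRadius r Lstar →
      (∃ K, IsLeastSquares (fun j => Lstar (X j)) Xh K ∧ ∃ L', SinkhornReturns K L') ∧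
      ∀ K L', IsLeastSquares (fun j => Lstar (X j)) Xh K → SinkhornReturns K L' →
        IsNormalized L' ∧ xi Lstar L' ≤ stepRate Lstar X * c +
          150 * r * q ^ 2 * ‖Lstar‖ ^ 2 * c ^ 2 := by
    intro c hc hcr
    obtain ⟨E, M, hM, rfl, hE⟩ := exists_representation hsurj L hc
    obtain ⟨h1, h2⟩ := G.update_of_representation hrate hM (hE.trans_le hcr) hXh
    refine ⟨h1, fun K L' hK hL' => ⟨(h2 K L' hK hL').1, (h2 K L' hK hL').2.trans ?_⟩⟩
    have h3 := euNorm_nonneg E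
    have h4 := G.stepRate_le.1
    gcongr
  obtain ⟨h1, h2⟩ := key _ hL le_rfl
  refine ⟨h1, fun K L' hK hL' => ⟨(h2 K L' hK hL').1, ?_⟩⟩
  have hlim : Tendsto (fun c : ℝ => stepRate Lstar X * c +
      150 * r * q ^ 2 * ‖Lstar‖ ^ 2 * c ^ 2) (𝓝[>] (xi Lstar L)) (𝓝 (stepRate Lstar X *
        xi Lstar L + 150 * r * q ^ 2 * ‖Lstar‖ ^ 2 * xi Lstar L ^ 2)) :=
    (Continuous.tendsto (by fun_prop) _).mono_left nhdsWithin_le_nhds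
  refine ge_of_tendsto hlim ?_
  filter_upwards [Ioo_mem_nhdsGT hL] with c hc
  exact ((key c hc.1 hc.2.le).2 K L' hK hL').2

/-- Singular Value Projection succeeds near the true map. -/
theorem GoodData.svp_of_xi_lt {q d n r : ℕ} {Lstar : MatMap q d} {X : Fin n → MatSp q} {s : ℝ}
    (G : GoodData r Lstar X s) (hrq : r < q) (hsurj : Function.Surjective Lstar)
    (hLstar : IsNormalized Lstar) {L : MatMap q d} (hL : xi Lstar L < errorRadius r Lstar)
    (hN : IsNormalized L) {ν : ℝ} (hν : 3 / 5 ≤ ν) (hν1 : ν ≤ 1) (j : Fin n) :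
    (∃ Xh, SVPReturns ν r L (Lstar (X j)) Xh) ∧
      ∀ Xh, SVPReturns ν r L (Lstar (X j)) Xh → SolvesRankProblem r L (Lstar (X j)) Xh := by
  obtain ⟨E, M, hM, rfl, hE⟩ := exists_representation hsurj L hL
  obtain ⟨h1, h2, -, -⟩ := G.small (euNorm_nonneg E) hE
  exact G.svp hrq hLstar hM h1 h2 hN hν hν1 j

theorem GoodData.contract {q d n r : ℕ} {Lstar : MatMap q d} {X : Fin n → MatSp q} {s : ℝ}
    (G : GoodData r Lstar X s) {γ a b : ℝ} (hγ : γ ≤ 48 / 100) (ha0 : 0 ≤ a)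
    (ha : a < errorRadius r Lstar)
    (hb : b ≤ γ * a + 150 * r * q ^ 2 * ‖Lstar‖ ^ 2 * a ^ 2) : b ≤ 1 / 2 * a := by
  obtain ⟨-, -, -, h⟩ := G.small ha0 ha
  have h1 := mul_le_mul_of_nonneg_right h ha0
  have h2 := mul_le_mul_of_nonneg_right hγ ha0
  nlinarith

/-- A sequence of nonnegative numbers that contracts up to a quadratic error. -/
theorem limsup_ratio_le {a : ℕ → ℝ} {γ C : ℝ} (hγ : 0 ≤ γ) (ha : ∀ t, 0 ≤ a t)
    (hstep : ∀ t, a (t + 1) ≤ γ * a t + C * a t ^ 2) (hhalf : ∀ t, a (t + 1) ≤ 1 / 2 * a t) :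
    Tendsto a atTop (𝓝 0) ∧
      limsup (fun t => ((a (t + 1) / a t : ℝ) : EReal)) atTop ≤ ((γ : ℝ) : EReal) ∧
      ∀ ε : ℝ, 0 < ε → ∀ᶠ t in atTop, a (t + 1) ≤ (γ + ε) * a t := by
  have hle : ∀ t, a t ≤ (1 / 2) ^ t * a 0 := by
    intro t
    induction t with
    | zero => simp
    | succ t ih =>
      refine (hhalf t).trans ?_
      rw [pow_succ]
      linarith
  have hlim : Tendsto a atTop (𝓝 0) := by
    refine squeeze_zero ha hle ?_
    simpa using (tendsto_pow_atTop_nhds_zero_of_lt_one (by norm_num : (0 : ℝ) ≤ 1 / 2)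
      (by norm_num)).mul_const (a 0)
  have hlim' : Tendsto (fun t => γ + C * a t) atTop (𝓝 γ) := by
    simpa using (hlim.const_mul C).const_add γ
  refine ⟨hlim, ?_, fun ε hε => ?_⟩
  · have hratio : ∀ t, a (t + 1) / a t ≤ γ + C * a t := by
      intro t
      rcases (ha t).eq_or_lt with h0 | h0
      · rw [← h0, div_zero, mul_zero, add_zero]
        exact hγ
      · rw [div_le_iff₀ h0]
        nlinarith [hstep t]
    have hE : Tendsto (fun t => ((γ + C * a t : ℝ) : EReal)) atTop (𝓝 (γ : EReal)) :=
      (continuous_coe_real_ereal.tendsto γ).comp hlim'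
    rw [← hE.limsup_eq]
    exact limsup_le_limsup (Eventually.of_forall fun t => EReal.coe_le_coe_iff.2 (hratio t))
  · filter_upwards [hlim'.eventually_lt_const (by linarith : γ < γ + ε)] with t ht
    nlinarith [hstep t, mul_le_mul_of_nonneg_right ht.le (ha t)]

/-- Runs of the algorithm exist. -/
theorem GoodData.exists_run {q d n r : ℕ} {Lstar : MatMap q d} {X : Fin n → MatSp q} {s : ℝ}
    (G : GoodData r Lstar X s) (hrq : r < q) (hsurj : Function.Surjective Lstar)
    (hLstar : IsNormalized Lstar) (hrate : stepRate Lstar X ≤ 48 / 100) {L₀ : MatMap q d}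
    (hL₀ : IsNormalized L₀) (hxi : xi Lstar L₀ < errorRadius r Lstar) {ν : ℝ} (hν : 3 / 5 ≤ ν)
    (hν1 : ν ≤ 1) : ∃ L Xh, IsRun ν r (fun j => Lstar (X j)) L₀ L Xh := by
  let S := {L : MatMap q d // IsNormalized L ∧ xi Lstar L < errorRadius r Lstar}
  have hstep : ∀ L : S, ∃ (Xh : Fin n → MatSp q) (L' : S),
      (∀ j, SVPReturns ν r L.1 (Lstar (X j)) (Xh j)) ∧
      ∃ K, IsLeastSquares (fun j => Lstar (X j)) Xh K ∧ SinkhornReturns K L'.1 := by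
    rintro ⟨L, hN, hL⟩
    choose Xh hXh using fun j => (G.svp_of_xi_lt hrq hsurj hLstar hL hN hν hν1 j).1
    have hsol := fun j => (G.svp_of_xi_lt hrq hsurj hLstar hL hN hν hν1 j).2 _ (hXh j)
    obtain ⟨⟨K, hK, L', hL'⟩, h2⟩ := G.update hsurj (by linarith) hL hsol
    obtain ⟨hN', hxi'⟩ := h2 K L' hK hL'
    have h3 := G.contract hrate (xi_nonneg _ _) hL hxi'
    exact ⟨Xh, ⟨L', hN', by linarith [xi_nonneg Lstar L]⟩, hXh, K, hK, hL'⟩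
  choose f g hf hg using hstep
  let L : ℕ → S := fun t => Nat.rec ⟨L₀, hL₀, hxi⟩ (fun _ L => g L) t
  exact ⟨fun t => (L t).1, fun t => f (L t), rfl, fun t j => hf (L t) j, fun t => hg (L t)⟩

/-- The iterates of runs whose first steps succeed stay normalized and near the true map. -/
theorem GoodData.run_step {q d n r : ℕ} {Lstar : MatMap q d} {X : Fin n → MatSp q} {s : ℝ}
    (G : GoodData r Lstar X s) (hsurj : Function.Surjective Lstar)
    (hrate : stepRate Lstar X ≤ 48 / 100) {L₀ : MatMap q d} {ν : ℝ} {L : ℕ → MatMap q d}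
    {Xh : ℕ → Fin n → MatSp q} (hrun : IsRun ν r (fun j => Lstar (X j)) L₀ L Xh) {t : ℕ}
    (hxi : xi Lstar (L t) < errorRadius r Lstar)
    (hsol : ∀ j, SolvesRankProblem r (L t) (Lstar (X j)) (Xh t j)) :
    IsNormalized (L (t + 1)) ∧ xi Lstar (L (t + 1)) < errorRadius r Lstar ∧
      xi Lstar (L (t + 1)) ≤ stepRate Lstar X * xi Lstar (L t) +
        150 * r * q ^ 2 * ‖Lstar‖ ^ 2 * xi Lstar (L t) ^ 2 ∧
      xi Lstar (L (t + 1)) ≤ 1 / 2 * xi Lstar (L t) := by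
  obtain ⟨K, hK, hL'⟩ := hrun.update t
  obtain ⟨hN, hle⟩ := (G.update hsurj (by linarith) hxi hsol).2 K _ hK hL'
  have h3 := G.contract hrate (xi_nonneg _ _) hxi hle
  exact ⟨hN, by linarith [xi_nonneg Lstar (L t)], hle, h3⟩

end

theorem mainTheorem1 (q d n r : ℕ) (hn : 0 < n) (hr : 0 < r) (hrq : r < q)
    (Lstar : MatMap q d) (Xstar : Fin n → MatSp q) (s : ℝ) (hs : 0 < s)
    (hrank : ∀ j, (mat (Xstar j)).rank = r)
    (hsing : ∀ j, singVal (Xstar j) 1 ≤ s ∧ s / 2 ≤ singVal (Xstar j) r)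
    (hOmega : bigOmega Xstar / bigLambda Xstar ≤ (d : ℝ) / (40 * (q : ℝ) ^ 2))
    (hDelta : bigDelta Xstar / bigLambda Xstar ≤ √(d : ℝ) / (150 * (q : ℝ) ^ 3))
    (hrip : ripConst (4 * r) Lstar ≤ 1 / 20)
    (hnormalized : IsNormalized Lstar) (hsurj : Function.Surjective Lstar)
    (hnorm : ‖Lstar‖ ^ 2 ≤ 5 * (q : ℝ) ^ 2 / (d : ℝ))
    (L0 : MatMap q d) (hL0 : IsNormalized L0)
    (hxi : xi Lstar L0 <
      1 / (36000 * (q : ℝ) ^ (7 / 2 : ℝ) * (r : ℝ) ^ 2 * ‖Lstar‖ ^ 2))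
    (ν : ℝ) (hν0 : 0 < ν) (hν1 : ν ≤ 1) :
    rateBound Lstar Xstar < 1 ∧
    (3 / 5 ≤ ν →
      (∃ L X, IsRun ν r (fun j => Lstar (Xstar j)) L0 L X) ∧
      ∀ L X, IsRun ν r (fun j => Lstar (Xstar j)) L0 L X →
        ∀ t j, SolvesRankProblem r (L t) (Lstar (Xstar j)) (X t j)) ∧
    ∀ L X, IsRun ν r (fun j => Lstar (Xstar j)) L0 L X →
      (∀ t j, SolvesRankProblem r (L t) (Lstar (Xstar j)) (X t j)) →
        Tendsto (fun t => xi Lstar (L t)) atTop (𝓝 0) ∧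
        limsup (fun t => ((xi Lstar (L (t + 1)) / xi Lstar (L t) : ℝ) : EReal)) atTop
          ≤ ((rateBound Lstar Xstar : ℝ) : EReal) ∧
        ∀ ε : ℝ, 0 < ε → ∀ᶠ t in atTop,
          xi Lstar (L (t + 1)) ≤ (rateBound Lstar Xstar + ε) * xi Lstar (L t) := by
  have G := goodData_of_hypotheses hn hr hrq hs hrank hsing hDelta hrip hsurj
  have hbound := rateBound_le G (hnormalized.dim_pos (by omega)) hOmega hDelta hnorm
  obtain ⟨hrate0, hrate1⟩ := G.stepRate_le
  have hrate : stepRate Lstar Xstar ≤ 48 / 100 := hrate1.trans hbound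
  refine ⟨by linarith, fun hν => ⟨G.exists_run hrq hsurj hnormalized hrate hL0 hxi hν hν1, ?_⟩,
    fun L X hrun hsol => ?_⟩
  · intro L X hrun
    have hinv : ∀ t, IsNormalized (L t) ∧ xi Lstar (L t) < errorRadius r Lstar := by
      intro t
      induction t with
      | zero =>
        rw [hrun.init]
        exact ⟨hL0, hxi⟩
      | succ t ih =>
        have hsol := fun j => (G.svp_of_xi_lt hrq hsurj hnormalized ih.2 ih.1 hν hν1 j).2 _
          (hrun.svp t j)
        obtain ⟨h1, h2, -, -⟩ := G.run_step hsurj hrate hrun ih.2 hsol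
        exact ⟨h1, h2⟩
    intro t j
    exact (G.svp_of_xi_lt hrq hsurj hnormalized (hinv t).2 (hinv t).1 hν hν1 j).2 _ (hrun.svp t j)
  · have hinv : ∀ t, xi Lstar (L t) < errorRadius r Lstar := by
      intro t
      induction t with
      | zero =>
        rw [hrun.init]
        exact hxi
      | succ t ih => exact (G.run_step hsurj hrate hrun ih (hsol t)).2.1
    have hstep := fun t => G.run_step hsurj hrate hrun (hinv t) (hsol t)
    have hx := fun t => xi_nonneg Lstar (L t)
    refine limsup_ratio_le (C := 150 * r * q ^ 2 * ‖Lstar‖ ^ 2)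
      (hrate0.trans hrate1) hx (fun t => (hstep t).2.2.1.trans ?_) fun t => (hstep t).2.2.2
    have := mul_le_mul_of_nonneg_right hrate1 (hx t)
    linarith
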